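/- **Setting.** Consider an $R$-matrix model with $N_\lambda$ levels and $N_c$ channels of massive particle pairs. Channel $c$ has angular momentum $\ell_c\in\mathbb N$, masses $m_{c,1},m_{c,2}>0$ with reduced mass $\mu_c$, charge numbers $Z_{c,1},Z_{c,2}\in\mathbb N$ (so the Coulomb force, if any, is repulsive; the channel is *neutral* if $Z_{c,1}Z_{c,2}=0$), radius $a_c>0$ and threshold $E_{T_c}\in\mathbb R$. The other parameters are real: resonance energies $e=\mathrm{diag}(E_\lambda)$, widths $\gamma=(\gamma_{\lambda c})$ and boundary parameters $B=\mathrm{diag}(B_c)$. Energy and wavenumbers are related by $\rho_c(E)=\pm\rho_{0,c}\sqrt{E-E_{T_c}}$, $\rho_{0,c}=a_c\sqrt{2\mu_c/\hbar^2}$ (principal square root). This mapping has a Riemann surface of points $(E,(\rho_c)_c)$ with $2^{N_c}$ sheets $\{E,\pm,\dots,\pm\}$; $\{E,+,\dots,+\}$ is the physical sheet. Let $O_c$ be the outgoing (Hankel or Coulomb) wave with $\eta_c=Z_{c,1}Z_{c,2}e^2\mu_ca_c/(\hbar^2\rho_c)$, and $L_c=\frac{\rho_c}{O_c}\frac{\partial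 O_c}{\partial\rho_c}$ (at fixed $\eta_c$, and defined by continuity at threshold). Take the Lane–Thomas shift function $S_c=\operatorname{Re}L_c$ and $S=\mathrm{diag}(S_c)$. The *alternative branch poles* are the points of the Riemann surface, over $E\in\mathbb C$, at which every $S_c$ is finite and Brune's eigenproblem $$[\,e-\gamma\,(S-B)\,\gamma^{\mathsf T}]\,a=E\,a$$ has a solution $a\neq0$. They are counted with multiplicity, the number of linearly independent solutions $a$. A *shadow pole* is an alternative branch pole with $E<E_{T_c}$ and $\rho_c$ on the "$-$" branch for some channel $c$. **Theorem 2.** 1. All alternative branch poles have real energy, and they lie on the $2^{N_c}$ sheets of the energy–wavenumber mapping. 2. Exactly $N_\lambda$ of them lie on the physical sheet $\{E,+,\dots,+\}$. 3. A pole that is not a shadow pole has the same energy and multiplicity as a pole of the physical sheet; hence all additional poles lie below a threshold, on a "$-$" sheet of that channel. Whether additional shadow poles exist depends on the parameters: for one level and one neutral channel of even $\ell$, any $\gamma\ne0$ and any $B$, there are values of $E_\lambda$ for which shadow poles exist and values for which there are none. The poles, their multiplicities and the shadow poles are invariant under change of boundary parameter: for every real diagonal $B'$ there are a real orthogonal $K$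 and a real diagonal $e'$ with $e-\gamma(B'-B)\gamma^{\mathsf T}=K^{\mathsf T}e'K$, and for all such $K,e'$ the parameters $(e',K\gamma,B')$ have the same poles, multiplicities and shadow poles as $(e,\gamma,B)$. 4. Each neutral channel $c$ of odd angular momentum with $\gamma_{\lambda c}\ne0$ for some $\lambda$ adds a shadow pole, with $E<E_{T_c}$, on the sheet that is "$-$" in channel $c$ and "$+$" in all others. Hence the total number $N_S^{\pm}$ of alternative branch poles on all sheets satisfies $N_S^{\pm}\ge N_\lambda$, and moreover $N_S^{\pm}\ge N_\lambda+\#\{\text{channels as in 4}\}$. -/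

import Mathlib

open Filter Topology MeasureTheory

namespace RMatrix

noncomputable section

/-! ### Outgoing waves -/

/-- The integral representation of Tricomi's confluent hypergeometric function,
`U(a,b,z) = z⁻ᵃ / Γ(a) * ∫₀^∞ e⁻ᵘ u^(a-1) (1 + u/z)^(b-a-1) du`,
valid for `Re a > 0` and `z` off the negative real axis
(for every `z ≠ 0` if `a` and `b - a - 1` are natural numbers). -/
def tricomiU (a b z : ℂ) : ℂ :=
  z ^ (-a) / Complex.Gamma a *
    ∫ u in Set.Ioi (0 : ℝ),
      Complex.exp (-(u : ℂ)) * (u : ℂ) ^ (a - 1) * (1 + (u : ℂ) / z) ^ (b - a - 1)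

/-- Kummer's regularised function `M(a, N + 1, z) / Γ(N + 1) = ∑ (a)ₙ zⁿ / ((N + n)! n!)`. -/
def kummerM (a : ℂ) (N : ℕ) (z : ℂ) : ℂ :=
  ∑' n : ℕ, (ascPochhammer ℂ n).eval a * z ^ n / (((N + n).factorial : ℂ) * (n.factorial : ℂ))

/-- The outgoing wave function with angular momentum `ℓ` and Coulomb field parameter `η`,
the solution of `O'' + (1 - 2η/ρ - ℓ(ℓ+1)/ρ²) O = 0` proportional to the Whittaker function
`W_{-iη, ℓ+1/2}(-2iρ)`, that is, to
`e^{iρ} ρ^{ℓ+1} U(ℓ + 1 + iη, 2ℓ + 2, -2iρ)`, with `O ~ const * e^{i(ρ - η log 2ρ)}`.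
Only its logarithmic derivative matters, so constant factors are dropped.

For repulsive channels `η = α/ρ` with `α ≥ 0`, so that `Re (iη) ≥ 0` means that the particles are
neutral or that `ρ` is in the closed upper half plane; there the integral representation holds.
In the open lower half plane, the second line is the analytic continuation of the first line
(from the side `Re ρ > 0`), by the connection formula of the confluent hypergeometric functions. -/
def outgoingWave (ℓ : ℕ) (η ρ : ℂ) : ℂ :=
  let a : ℂ := ℓ + 1 + Complex.I * η
  let b : ℂ := 2 * ℓ + 2
  let z : ℂ := -2 * Complex.I * ρ
  Complex.exp (Complex.I * ρ) * ρ ^ (ℓ + 1) *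
    (if 0 ≤ (Complex.I * η).re then tricomiU a b z
     else Complex.Gamma (b - a) *
      (Complex.exp (Complex.I * Real.pi * a) * kummerM a (2 * ℓ + 1) z
        - Complex.exp z * tricomiU (b - a) b (-z) / Complex.Gamma a))

/-- `L = (ρ / O) ∂O/∂ρ` at `ρ ≠ 0`, with Coulomb parameter `η = α/ρ` (the derivative is the
radial one, so `η` is held fixed). -/
def reducedLogDerivAux (ℓ : ℕ) (α : ℝ) (ρ : ℂ) : ℂ :=
  ρ * deriv (outgoingWave ℓ ((α : ℂ) / ρ)) ρ / outgoingWave ℓ ((α : ℂ) / ρ) ρ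

open Classical in
/-- The reduced logarithmic derivative `L` of the outgoing wave; at the threshold `ρ = 0` it is
defined by continuity, as its limit from below the threshold on the physical sheet
(for neutral particles this is `-ℓ`). -/
def reducedLogDeriv (ℓ : ℕ) (α : ℝ) (ρ : ℂ) : ℂ :=
  if ρ = 0 then
    limUnder (𝓝[>] (0 : ℝ)) (fun κ : ℝ => reducedLogDerivAux ℓ α (Complex.I * (κ : ℂ)))
  else reducedLogDerivAux ℓ α ρ

/-! ### Channels -/

/-- The system of units: reduced Planck constant and square of the elementary charge
(Gaussian units). -/
structure Constants where
  hbar : ℝ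
  esq : ℝ
  hbar_pos : 0 < hbar
  esq_pos : 0 < esq

/-- A two-body channel of massive particles: angular momentum, masses, charge numbers
(those of nuclei, so nonnegative), channel radius and threshold energy. -/
structure Channel where
  ℓ : ℕ
  m₁ : ℝ
  m₂ : ℝ
  Z₁ : ℕ
  Z₂ : ℕ
  radius : ℝ
  threshold : ℝ
  m₁_pos : 0 < m₁
  m₂_pos : 0 < m₂
  radius_pos : 0 < radius

namespace Channel

/-- The reduced mass. -/
def mass (ch : Channel) : ℝ := ch.m₁ * ch.m₂ / (ch.m₁ + ch.m₂)

/-- There is no Coulomb interaction in the channel. -/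
def IsNeutral (ch : Channel) : Prop := ch.Z₁ * ch.Z₂ = 0

/-- The constant `ρ₀` in `ρ = k a = ± ρ₀ √(E - E_T)`. -/
def rho0 (u : Constants) (ch : Channel) : ℝ :=
  ch.radius * Real.sqrt (2 * ch.mass / u.hbar ^ 2)

/-- The constant `α` in the Coulomb field parameter `η = α / ρ`. -/
def coulomb (u : Constants) (ch : Channel) : ℝ :=
  (ch.Z₁ : ℝ) * (ch.Z₂ : ℝ) * u.esq * ch.mass * ch.radius / u.hbar ^ 2

/-- The branch `ρ(E) = s ρ₀ √(E - E_T)`, `s = ±1`, of the energy-wavenumber mapping, with the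
principal square root; for real `E` below the threshold it is `s i ρ₀ √|E - E_T|`. -/
def rho (u : Constants) (ch : Channel) (s : ℤˣ) (E : ℂ) : ℂ :=
  ((s : ℤ) : ℂ) * (ch.rho0 u : ℂ) * (E - (ch.threshold : ℂ)) ^ (1 / 2 : ℂ)

/-- The Lane–Thomas shift function `S = Re L`. -/
def shift (u : Constants) (ch : Channel) (ρ : ℂ) : ℝ :=
  (reducedLogDeriv ch.ℓ (ch.coulomb u) ρ).re

/-- `L`, hence `S`, is finite: `ρ` is not a zero of the outgoing wave. -/
def IsRegular (u : Constants) (ch : Channel) (ρ : ℂ) : Prop :=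
  ρ = 0 ∨ outgoingWave ch.ℓ ((ch.coulomb u : ℂ) / ρ) ρ ≠ 0

end Channel

/-! ### Brune's eigenproblem -/

/-- Wigner–Eisenbud parameters with `NL` levels and `NC` channels: the channels (with their radii
and thresholds), the resonance energies, the resonance widths and the boundary parameters. -/
structure Parameters (NL NC : ℕ) where
  channel : Fin NC → Channel
  energy : Fin NL → ℝ
  width : Matrix (Fin NL) (Fin NC) ℝ
  boundary : Fin NC → ℝ

namespace Parameters

variable {NL NC : ℕ}

/-- The Riemann surface of the energy-wavenumber mapping: the pairs `(E, (ρ_c)_c)` with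
`ρ_c² = ρ₀_c² (E - E_{T_c})` for every channel `c`. -/
def surface (u : Constants) (P : Parameters NL NC) : Set (ℂ × (Fin NC → ℂ)) :=
  {p | ∀ c, p.2 c ^ 2 =
    ((P.channel c).rho0 u : ℂ) ^ 2 * (p.1 - ((P.channel c).threshold : ℂ))}

/-- The wavenumbers at energy `E` on the sheet `{E, σ}`. -/
def rho (u : Constants) (P : Parameters NL NC) (σ : Fin NC → ℤˣ) (E : ℂ) : Fin NC → ℂ :=
  fun c => (P.channel c).rho u (σ c) E

/-- The sheet `{E, σ}`; the physical sheet `{E, +, …, +}` is `sheet u P 1`. -/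
def sheet (u : Constants) (P : Parameters NL NC) (σ : Fin NC → ℤˣ) :
    Set (ℂ × (Fin NC → ℂ)) :=
  {p | p.2 = P.rho u σ p.1}

/-- The matrix `e - γ (S - B) γᵀ`. -/
def bruneMatrix (u : Constants) (P : Parameters NL NC) (ρ : Fin NC → ℂ) :
    Matrix (Fin NL) (Fin NL) ℝ :=
  Matrix.diagonal P.energy -
    P.width * Matrix.diagonal (fun c => (P.channel c).shift u (ρ c) - P.boundary c) *
      P.width.transpose

/-- The space of the complex vectors `a` with `[e - γ (S - B) γᵀ] a = E a`. -/
def solutionSpace (u : Constants) (P : Parameters NL NC) (p : ℂ × (Fin NC → ℂ)) :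
    Submodule ℂ (Fin NL → ℂ) :=
  Module.End.eigenspace
    (Matrix.toLin' ((P.bruneMatrix u p.2).map (fun x : ℝ => (x : ℂ)))) p.1

/-- The point `p = (E, ρ)` of the Riemann surface, at which all shift functions are finite, solves
Brune's eigenproblem: `[e - γ (S - B) γᵀ] a = E a` for some `a ≠ 0`. -/
def IsBranchPole (u : Constants) (P : Parameters NL NC) (p : ℂ × (Fin NC → ℂ)) : Prop :=
  p ∈ P.surface u ∧ (∀ c, (P.channel c).IsRegular u (p.2 c)) ∧
    ∃ a ∈ P.solutionSpace u p, a ≠ 0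

open Classical in
/-- The multiplicity of a point of the Riemann surface as an alternative branch pole: the number
of linearly independent solutions `a` (zero if the point is not a pole). -/
def multiplicity (u : Constants) (P : Parameters NL NC) (p : ℂ × (Fin NC → ℂ)) : ℕ :=
  if P.IsBranchPole u p then Module.finrank ℂ (P.solutionSpace u p) else 0

/-- The number of alternative branch poles in `A`, counted with multiplicity. -/
def poleCount (u : Constants) (P : Parameters NL NC) (A : Set (ℂ × (Fin NC → ℂ))) : ℕ∞ :=
  Set.encard {x : (ℂ × (Fin NC → ℂ)) × ℕ | x.1 ∈ A ∧ x.2 < P.multiplicity u x.1}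

/-- A shadow pole: an alternative branch pole of real energy which lies, for some channel, below
the threshold of that channel and on its `-` sheet. -/
def IsShadowPole (u : Constants) (P : Parameters NL NC) (p : ℂ × (Fin NC → ℂ)) : Prop :=
  P.IsBranchPole u p ∧ ∃ E : ℝ, p.1 = (E : ℂ) ∧
    ∃ c, E < (P.channel c).threshold ∧ p.2 c = (P.channel c).rho u (-1) (E : ℂ)

/-- `P'` describes the same system as `P` with another boundary parameter: the channels are the
same, and there is a real orthogonal matrix `K` with `e - γ (B' - B) γᵀ = Kᵀ e' K` and
`γ' = K γ`. -/
def IsBoundaryChange (P P' : Parameters NL NC) : Prop :=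
  P'.channel = P.channel ∧ ∃ K : Matrix (Fin NL) (Fin NL) ℝ,
    K * K.transpose = 1 ∧
    Matrix.diagonal P.energy -
        P.width * Matrix.diagonal (fun c => P'.boundary c - P.boundary c) * P.width.transpose
      = K.transpose * Matrix.diagonal P'.energy * K ∧
    P'.width = K * P.width

/-- The channels without Coulomb interaction and with odd angular momentum that are coupled to
some level. -/
def oddNeutralChannels (P : Parameters NL NC) : Set (Fin NC) :=
  {c | (P.channel c).IsNeutral ∧ Odd (P.channel c).ℓ ∧ ∃ l, P.width l c ≠ 0}

/-- One level and one channel. -/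
def single (ch : Channel) (E γ B : ℝ) : Parameters 1 1 where
  channel := fun _ => ch
  energy := fun _ => E
  width := fun _ _ => γ
  boundary := fun _ => B

end Parameters

end

end RMatrix

/-!
# Poles of the alternative branch point parametrization on all sheets

Brune's matrix `N = e - γ (S - B) γᵀ` is real symmetric at every point of the Riemann surface, so
all energies are real. Everything else follows from the behaviour of the shift functions `S_c` at
real energies.

*Physical sheet.* There each `S_c` is continuous and nondecreasing in `E`
(`monotone_physicalShift`, `continuous_physicalShift`). Hence the sorted eigenvalues of `N(E)` are
continuous and nonincreasing, each of them crosses the diagonal exactly once, and the number of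
solutions of `N(E) a = E a` is the dimension (`encard_eigenvalue_crossings`, by Weyl's monotonicity
principle `eigenvalues_add_le`). At and above its threshold, a channel has complex conjugate waves,
hence the same `S_c`, on both of its sheets; this identifies a pole that is not a shadow pole with
a pole of the physical sheet.

*Monotonicity of `S`.* With `z = -2iρ` the outgoing wave along a ray is
`e^{-zr/2} r^{ℓ+1} ∫₀^∞ e^{-ry} y^{ℓ+c} (1 + y/z)^{ℓ-c} dy`, `c = iη`, which solves the radial
equation `u'' = (ℓ(ℓ+1)/r² + 2α/r - ρ²) u`. Below the threshold it is a positive decaying solution,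
and comparison of Wronskians gives the monotonicity (`IsDecaying.logDeriv_le`) and the continuity,
also across the threshold (`IsDecaying.norm_logDeriv_sub_le`).
Above the threshold, the squared amplitude `M = |u|²` satisfies Appell's equation. In terms of its
Laplace density this is a Volterra equation with a positive kernel, so that `M - 1` is the Laplace
transform of a nonnegative function (`exists_amplitude`); thus `M` is decreasing and
logarithmically convex. Hence, for two outgoing solutions, `|u₁ u₂| dr / dθ` is a convex
function of the phase `θ` of `u₁ u₂` (`phase_convexity`), which controls the sign of the
oscillating integral `∫ Re (u₁ u₂) dr` that is the difference of two values of `S` up to a positive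
factor (`IsOutgoing.re_logDeriv_le`).

*Neutral channels on the `-` sheet.* There the wave is elementary: up to an exponential and a power
it is the polynomial `∫₀^∞ e^{-u} u^ℓ (z + u)^ℓ du`. For even `ℓ` it has no real zero; for odd `ℓ`
it has negative zeros, and `S` tends to `+∞` as the energy increases to the one that belongs to the
lowest zero (`exists_tendsto_neutralLogDeriv_atTop`). Since `S = O(√|E|)` far below the threshold,
the lowest eigenvalue of `N(E)` crosses the diagonal in between, which is the shadow pole of an odd
channel (`Parameters.exists_isShadowPole`). For one level and one even channel, `E + γ² (S - B)` is
bounded from above, so that whether there is a shadow pole depends on the resonance energy.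

*Change of boundary parameter.* By the definition of the transformed parameters, Brune's matrix is
conjugated by the orthogonal matrix `K` at every point of the surface.
-/

namespace RMatrix

/-! ### Laplace transforms of functions of polynomial growth -/

section Laplace

variable {F : Type*} [NormedAddCommGroup F] [NormedSpace ℝ F]

/-- The Laplace transform `∫₀^∞ e^{-ry} f(y) dy`. -/
noncomputable def laplace (f : ℝ → F) (r : ℝ) : F :=
  ∫ y in Set.Ioi (0 : ℝ), Real.exp (-(r * y)) • f y

/-- `f` is measurable and polynomially bounded on the positive half line. -/
structure PolyBounded (f : ℝ → F) : Prop where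
  meas : AEStronglyMeasurable f (volume.restrict (Set.Ioi 0))
  bound : ∃ K : ℝ, ∃ N : ℕ, 0 ≤ K ∧ ∀ y > 0, ‖f y‖ ≤ K * (1 + y) ^ N

theorem integrableOn_exp_mul_one_add_pow {r : ℝ} (hr : 0 < r) (N : ℕ) :
    IntegrableOn (fun y : ℝ => Real.exp (-(r * y)) * (1 + y) ^ N) (Set.Ioi 0) := by
  apply integrable_of_isBigO_exp_neg (b := r / 2) (by positivity)
  · fun_prop
  · have h1 : (fun y : ℝ => (1 + y) ^ N) =O[atTop] fun y : ℝ => y ^ N := by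
      apply Asymptotics.IsBigO.pow
      apply Asymptotics.IsBigO.of_bound 2
      filter_upwards [eventually_ge_atTop 1] with y hy
      rw [Real.norm_of_nonneg (by linarith), Real.norm_of_nonneg (by linarith)]
      linarith
    have h2 := (isLittleO_pow_exp_pos_mul_atTop N (b := r / 2) (by positivity)).isBigO
    have h3 := (Asymptotics.isBigO_refl (fun y : ℝ => Real.exp (-(r * y))) atTop).mul (h1.trans h2)
    refine h3.congr_right fun y => ?_
    rw [← Real.exp_add]; ring_nf

namespace PolyBounded

theorem smul {p : ℝ → ℝ} {f : ℝ → F} (hp : PolyBounded p) (hf : PolyBounded f) :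
    PolyBounded fun y => p y • f y := by
  obtain ⟨K, N, hK, h⟩ := hf.bound
  obtain ⟨K', N', hK', h'⟩ := hp.bound
  refine ⟨hp.meas.smul hf.meas, K' * K, N' + N, by positivity, fun y hy => ?_⟩
  rw [norm_smul, pow_add, show K' * K * ((1 + y) ^ N' * (1 + y) ^ N)
    = (K' * (1 + y) ^ N') * (K * (1 + y) ^ N) by ring]
  exact mul_le_mul (h' y hy) (h y hy) (norm_nonneg _) (by positivity)

theorem id : PolyBounded (fun y : ℝ => y) := by
  refine ⟨by fun_prop, 1, 1, zero_le_one, fun y hy => ?_⟩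
  rw [Real.norm_of_nonneg hy.le]; simp

theorem const {G : Type*} [NormedAddCommGroup G] (c : G) : PolyBounded (fun _ : ℝ => c) :=
  ⟨by fun_prop, ‖c‖, 0, norm_nonneg _, fun y _ => by simp⟩

theorem add {G : Type*} [NormedAddCommGroup G] {f g : ℝ → G} (hf : PolyBounded f) (hg : PolyBounded g) :
    PolyBounded fun y => f y + g y := by
  obtain ⟨K, N, hK, h⟩ := hf.bound
  obtain ⟨K', N', hK', h'⟩ := hg.bound
  refine ⟨hf.meas.add hg.meas, K + K', max N N', by positivity, fun y hy => ?_⟩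
  have e1 : (1 + y) ^ N ≤ (1 + y) ^ max N N' :=
    pow_le_pow_right₀ (by linarith) (le_max_left _ _)
  have e2 : (1 + y) ^ N' ≤ (1 + y) ^ max N N' :=
    pow_le_pow_right₀ (by linarith) (le_max_right _ _)
  calc ‖f y + g y‖ ≤ ‖f y‖ + ‖g y‖ := norm_add_le _ _
    _ ≤ K * (1 + y) ^ N + K' * (1 + y) ^ N' := add_le_add (h y hy) (h' y hy)
    _ ≤ K * (1 + y) ^ max N N' + K' * (1 + y) ^ max N N' := by gcongr
    _ = _ := by ring

theorem id_smul {f : ℝ → F} (hf : PolyBounded f) : PolyBounded fun y => y • f y := id.smul hf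

theorem const_smul {f : ℝ → F} (hf : PolyBounded f) (c : ℝ) : PolyBounded fun y => c • f y :=
  (const c).smul hf

theorem integrableOn {f : ℝ → F} (hf : PolyBounded f) {r : ℝ} (hr : 0 < r) :
    IntegrableOn (fun y => Real.exp (-(r * y)) • f y) (Set.Ioi 0) := by
  obtain ⟨K, N, hK, h⟩ := hf.bound
  refine Integrable.mono' ((integrableOn_exp_mul_one_add_pow hr N).const_mul K)
    (AEStronglyMeasurable.smul (by fun_prop) hf.meas) ?_
  filter_upwards [ae_restrict_mem measurableSet_Ioi] with y hy
  rw [norm_smul, Real.norm_of_nonneg (Real.exp_pos _).le, mul_left_comm]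
  exact mul_le_mul_of_nonneg_left (h y hy) (Real.exp_pos _).le

end PolyBounded

theorem hasDerivAt_laplace {f : ℝ → F} (hf : PolyBounded f) {r : ℝ} (hr : 0 < r) :
    HasDerivAt (laplace f) (-laplace (fun y => y • f y) r) r := by
  have key := hasDerivAt_integral_of_dominated_loc_of_deriv_le
    (μ := volume.restrict (Set.Ioi (0 : ℝ))) (x₀ := r) (s := Set.Ioi (r / 2))
    (F := fun r y => Real.exp (-(r * y)) • f y)
    (F' := fun r y => -(Real.exp (-(r * y)) • (y • f y)))
    (bound := fun y => ‖Real.exp (-((r / 2) * y)) • (y • f y)‖)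
    (Ioi_mem_nhds (by linarith)) ?_ (hf.integrableOn hr) ?_ ?_ ?_ ?_
  · have := key.2
    rw [integral_neg] at this
    exact this
  · filter_upwards with x
    exact AEStronglyMeasurable.smul (by fun_prop) hf.meas
  · exact (AEStronglyMeasurable.smul (by fun_prop) hf.id_smul.meas).neg
  · filter_upwards [ae_restrict_mem measurableSet_Ioi] with y hy x hx
    rw [norm_neg, norm_smul, norm_smul (Real.exp (-((r / 2) * y)))]
    refine mul_le_mul_of_nonneg_right ?_ (norm_nonneg _)
    rw [Real.norm_of_nonneg (Real.exp_pos _).le, Real.norm_of_nonneg (Real.exp_pos _).le]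
    apply Real.exp_le_exp.2
    have : r / 2 * y ≤ x * y := mul_le_mul_of_nonneg_right (le_of_lt hx) (le_of_lt hy)
    linarith
  · exact (hf.id_smul.integrableOn (half_pos hr)).norm
  · filter_upwards with y x hx
    have h1 : HasDerivAt (fun x : ℝ => Real.exp (-(x * y))) (Real.exp (-(x * y)) * (-(1 * y))) x :=
      (((hasDerivAt_id x).mul_const y).neg).exp
    have h2 := h1.smul_const (f y)
    convert h2 using 1
    rw [smul_smul, ← neg_smul]; congr 1; ring

theorem tendsto_laplace_atTop {f : ℝ → F} (hf : PolyBounded f) :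
    Tendsto (laplace f) atTop (𝓝 0) := by
  have key := tendsto_integral_filter_of_dominated_convergence (l := atTop)
    (μ := volume.restrict (Set.Ioi (0 : ℝ)))
    (F := fun r y => Real.exp (-(r * y)) • f y) (f := fun _ => (0 : F))
    (bound := fun y => ‖Real.exp (-(1 * y)) • f y‖) ?_ ?_ (hf.integrableOn one_pos).norm ?_
  · rw [integral_zero] at key
    exact key
  · filter_upwards with x
    exact AEStronglyMeasurable.smul (by fun_prop) hf.meas
  · filter_upwards [eventually_ge_atTop 1] with x hx
    filter_upwards [ae_restrict_mem measurableSet_Ioi] with y hy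
    rw [norm_smul, norm_smul (Real.exp (-(1 * y)))]
    refine mul_le_mul_of_nonneg_right ?_ (norm_nonneg _)
    rw [Real.norm_of_nonneg (Real.exp_pos _).le, Real.norm_of_nonneg (Real.exp_pos _).le]
    apply Real.exp_le_exp.2
    have : 1 * y ≤ x * y := mul_le_mul_of_nonneg_right hx (le_of_lt hy)
    linarith
  · filter_upwards [ae_restrict_mem measurableSet_Ioi] with y hy
    have : Tendsto (fun x : ℝ => Real.exp (-(x * y))) atTop (𝓝 0) :=
      Real.tendsto_exp_neg_atTop_nhds_zero.comp (tendsto_id.atTop_mul_const hy)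
    simpa using this.smul_const (f y)

theorem laplace_add {f g : ℝ → F} (hf : PolyBounded f) (hg : PolyBounded g) {r : ℝ} (hr : 0 < r) :
    laplace (fun y => f y + g y) r = laplace f r + laplace g r := by
  unfold laplace
  rw [← integral_add (hf.integrableOn hr) (hg.integrableOn hr)]
  simp only [smul_add]

theorem laplace_congr {f g : ℝ → F} (h : ∀ y > 0, f y = g y) (r : ℝ) :
    laplace f r = laplace g r :=
  setIntegral_congr_fun measurableSet_Ioi fun y hy => congrArg _ (h y hy)

theorem laplace_const_smul (f : ℝ → F) (c : ℝ) (r : ℝ) :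
    laplace (fun y => c • f y) r = c • laplace f r := by
  unfold laplace
  rw [← integral_smul]
  exact integral_congr_ae (Eventually.of_forall fun y => smul_comm _ _ _)

theorem laplace_nonneg {f : ℝ → ℝ} (hf : ∀ y > 0, 0 ≤ f y) (r : ℝ) : 0 ≤ laplace f r :=
  setIntegral_nonneg measurableSet_Ioi fun y hy => mul_nonneg (Real.exp_pos _).le (hf y hy)

/-- The Laplace transform turns convolutions into products. -/
theorem laplace_convolution {f g : ℝ → ℝ} (hf : PolyBounded f) (hg : PolyBounded g)
    {r : ℝ} (hr : 0 < r) :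
    laplace (fun x => ∫ t in (0 : ℝ)..x, f t * g (x - t)) r = laplace f r * laplace g r := by
  have h := integral_posConvolution (hf.integrableOn hr) (hg.integrableOn hr)
    (ContinuousLinearMap.mul ℝ ℝ)
  simp only [ContinuousLinearMap.mul_apply'] at h
  unfold laplace
  rw [← h]
  congr 1
  ext x
  rw [smul_eq_mul, ← intervalIntegral.integral_const_mul]
  congr 1
  ext t
  simp only [smul_eq_mul]
  rw [show -(r * x) = -(r * t) + -(r * (x - t)) by ring, Real.exp_add]
  ring

theorem PolyBounded.convolution {f g : ℝ → ℝ} (hf : PolyBounded f) (hg : PolyBounded g)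
    (hfc : Continuous f) (hgc : Continuous g) :
    PolyBounded fun x => ∫ t in (0 : ℝ)..x, f t * g (x - t) := by
  obtain ⟨K, N, hK, h⟩ := hf.bound
  obtain ⟨K', N', hK', h'⟩ := hg.bound
  have hcont : Continuous fun x => ∫ t in (0 : ℝ)..x, f t * g (x - t) :=
    intervalIntegral.continuous_parametric_intervalIntegral_of_continuous
      (by simp only [Function.uncurry_def]; fun_prop) continuous_id
  refine ⟨hcont.aestronglyMeasurable, K * K', N + N' + 1, by positivity, fun y hy => ?_⟩
  have h1 : ∀ t ∈ Set.Ioo (0 : ℝ) y,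
      ‖f t * g (y - t)‖ ≤ K * (1 + y) ^ N * (K' * (1 + y) ^ N') := by
    intro t ht
    rw [norm_mul]
    have ht1 : 0 < t := ht.1
    have ht2 : 0 < y - t := by linarith [ht.2]
    have e1 : (1 + t) ^ N ≤ (1 + y) ^ N := by gcongr; exact ht.2.le
    have e2 : (1 + (y - t)) ^ N' ≤ (1 + y) ^ N' := by gcongr; linarith
    have f1 := (h t ht1).trans (mul_le_mul_of_nonneg_left e1 hK)
    have f2 := (h' _ ht2).trans (mul_le_mul_of_nonneg_left e2 hK')
    exact mul_le_mul f1 f2 (norm_nonneg _) (by positivity)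
  have h2 := norm_setIntegral_le_of_norm_le_const (μ := volume) (s := Set.Ioo (0 : ℝ) y)
    (by simp) h1
  rw [intervalIntegral.integral_of_le hy.le, integral_Ioc_eq_integral_Ioo]
  refine h2.trans ?_
  have : volume.real (Set.Ioo (0 : ℝ) y) = y := by simp [Measure.real, hy.le]
  rw [this]
  calc _ = K * K' * ((1 + y) ^ N * (1 + y) ^ N') * y := by ring
    _ ≤ K * K' * ((1 + y) ^ N * (1 + y) ^ N') * (1 + y) := by gcongr; linarith
    _ = _ := by ring

theorem laplace_pow (n : ℕ) {r : ℝ} (hr : 0 < r) :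
    laplace (fun y : ℝ => y ^ n) r = n.factorial / r ^ (n + 1) := by
  have h := Real.integral_rpow_mul_exp_neg_mul_Ioi (a := n + 1) (r := r) (by positivity) hr
  simp only [add_sub_cancel_right, Real.rpow_natCast] at h
  rw [Real.Gamma_nat_eq_factorial] at h
  unfold laplace
  simp only [smul_eq_mul]
  rw [integral_congr_ae (g := fun y : ℝ => y ^ n * Real.exp (-(r * y)))
    (Eventually.of_forall fun y => mul_comm _ _), h,
    show (n : ℝ) + 1 = ((n + 1 : ℕ) : ℝ) by push_cast; ring, Real.rpow_natCast]
  rw [one_div, inv_pow, div_eq_inv_mul]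

end Laplace


/-! ### The squared amplitude of the outgoing wave above threshold -/

section Amplitude

variable (A α ε : ℝ)

/-- The effective potential `A / r² + 2 α / r`, with `A = ℓ (ℓ + 1)`. -/
noncomputable def potential (r : ℝ) : ℝ := A / r ^ 2 + 2 * α / r

/-- The derivative of the effective potential. -/
noncomputable def potentialDeriv (r : ℝ) : ℝ := -(2 * A / r ^ 3) - 2 * α / r ^ 2

theorem hasDerivAt_potential {r : ℝ} (hr : r ≠ 0) :
    HasDerivAt (potential A α) (potentialDeriv A α r) r := by
  have h1 := ((hasDerivAt_pow 2 r).inv (pow_ne_zero 2 hr)).const_mul A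
  have h2 := (hasDerivAt_inv hr).const_mul (2 * α)
  have h3 := h1.add h2
  refine (h3.congr_deriv ?_).congr_of_eventuallyEq (Eventually.of_forall fun x => ?_)
  · unfold potentialDeriv
    field_simp
    ring
  · simp [potential, div_eq_mul_inv]

theorem tendsto_potential_atTop : Tendsto (potential A α) atTop (𝓝 0) := by
  have h1 : Tendsto (fun r : ℝ => A / r ^ 2) atTop (𝓝 0) :=
    tendsto_const_nhds.div_atTop (tendsto_pow_atTop two_ne_zero)
  have h2 : Tendsto (fun r : ℝ => 2 * α / r) atTop (𝓝 0) :=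
    tendsto_const_nhds.div_atTop tendsto_id
  have h := h1.add h2
  rw [add_zero] at h
  exact h

/-- The Volterra operator whose resolvent yields the Laplace density of the squared amplitude. -/
noncomputable def volterraOp (f : ℝ → ℝ) (x : ℝ) : ℝ :=
  2 * x / (x ^ 2 + 4 * ε) * ∫ t in (0 : ℝ)..1, (2 * α + A * (x * (1 - t))) * (1 + t) * f (x * t)

/-- The terms of the Neumann series for the Laplace density of the squared amplitude. The
first term comes from the limit `1` of the amplitude. -/
noncomputable def neumannTerm : ℕ → ℝ → ℝ
  | 0 => fun x => 2 * (2 * α + A * x) / (x ^ 2 + 4 * ε)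
  | n + 1 => volterraOp A α ε (neumannTerm n)

variable {A α ε}

theorem integral_one_add_pow_le (y : ℝ) (N : ℕ) :
    y * ∫ t in (0 : ℝ)..1, (1 + y * t) ^ N ≤ (1 + y) ^ (N + 1) / (N + 1) := by
  have h : ∀ t ∈ Set.uIcc (0 : ℝ) 1,
      HasDerivAt (fun t : ℝ => (1 + y * t) ^ (N + 1) / (N + 1)) (y * (1 + y * t) ^ N) t := by
    intro t _
    have h1 : HasDerivAt (fun t : ℝ => 1 + y * t) (y * 1) t :=
      ((hasDerivAt_id t).const_mul y).const_add 1
    refine ((h1.pow (N + 1)).div_const ((N : ℝ) + 1)).congr_deriv ?_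
    have : (N : ℝ) + 1 ≠ 0 := by positivity
    push_cast
    field_simp
  have h2 := intervalIntegral.integral_eq_sub_of_hasDerivAt h
    (Continuous.intervalIntegrable (by fun_prop) _ _)
  rw [intervalIntegral.integral_const_mul] at h2
  rw [h2]
  have : 0 ≤ (1 + y * 0) ^ (N + 1) / ((N : ℝ) + 1) := by
    simp only [mul_zero, add_zero, one_pow]; positivity
  simp only [mul_one]
  linarith

theorem continuous_volterraOp (hε : 0 < ε) {f : ℝ → ℝ} (hf : Continuous f) :
    Continuous (volterraOp A α ε f) := by
  unfold volterraOp
  refine Continuous.mul (Continuous.div (by fun_prop) (by fun_prop) fun x => ?_) ?_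
  · positivity
  · apply intervalIntegral.continuous_parametric_intervalIntegral_of_continuous'
    simp only [Function.uncurry_def]
    fun_prop

theorem continuous_neumannTerm (hε : 0 < ε) (n : ℕ) : Continuous (neumannTerm A α ε n) := by
  induction n with
  | zero => exact Continuous.div (by fun_prop) (by fun_prop) fun x => by positivity
  | succ n ih => exact continuous_volterraOp hε ih

theorem neumannTerm_nonneg (hA : 0 ≤ A) (hα : 0 ≤ α) (hε : 0 < ε) (n : ℕ) {x : ℝ} (hx : 0 ≤ x) :
    0 ≤ neumannTerm A α ε n x := by
  induction n generalizing x with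
  | zero => simp only [neumannTerm]; positivity
  | succ n ih =>
    simp only [neumannTerm, volterraOp]
    refine mul_nonneg (by positivity) ?_
    apply intervalIntegral.integral_nonneg zero_le_one
    intro t ht
    have : 0 ≤ 1 - t := by linarith [ht.2]
    have h0 : 0 ≤ t := ht.1
    have := ih (mul_nonneg hx h0)
    positivity

/-- A constant with `(2α + A y) (1 + y) ≤ C (y² + 4ε)`. -/
noncomputable def volterraConst (A α ε : ℝ) : ℝ := (4 * α + A) / (4 * ε) + (2 * α + 2 * A)

theorem density_le (hA : 0 ≤ A) (hα : 0 ≤ α) (hε : 0 < ε) {y : ℝ} (hy : 0 ≤ y) :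
    (2 * α + A * y) / (y ^ 2 + 4 * ε) ≤ volterraConst A α ε / (1 + y) := by
  rw [div_le_div_iff₀ (by positivity) (by positivity)]
  have h1 : (4 * α + A) / (4 * ε) * (4 * ε) = 4 * α + A := by field_simp
  have h2 : 0 ≤ (4 * α + A) / (4 * ε) * y ^ 2 := by positivity
  have h3 : 0 ≤ (2 * α + 2 * A) * (4 * ε) := by positivity
  unfold volterraConst
  have h4 : 0 ≤ (2 * α + A) * (y - 1) ^ 2 := by positivity
  have h5 : 0 ≤ α * y ^ 2 := by positivity
  have h6 : 0 ≤ A * y ^ 2 := by positivity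
  nlinarith

/-- The Volterra operator contracts by `1 / 2` in a polynomially weighted norm. -/
theorem abs_volterraOp_le (hA : 0 ≤ A) (hα : 0 ≤ α) (hε : 0 < ε) {N : ℕ}
    (hN : 8 * volterraConst A α ε ≤ N + 1) {f : ℝ → ℝ} (hc : Continuous f) {b : ℝ} (hb : 0 ≤ b)
    (hf : ∀ x, |f x| ≤ b * (1 + |x|) ^ N) (x : ℝ) :
    |volterraOp A α ε f x| ≤ b / 2 * (1 + |x|) ^ N := by
  have hx := abs_nonneg x
  have h1 : |∫ t in (0 : ℝ)..1, (2 * α + A * (x * (1 - t))) * (1 + t) * f (x * t)|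
      ≤ ∫ t in (0 : ℝ)..1, ((2 * α + A * |x|) * 2 * b) * (1 + |x| * t) ^ N := by
    refine (intervalIntegral.abs_integral_le_integral_abs zero_le_one).trans ?_
    refine intervalIntegral.integral_mono_on zero_le_one
      (Continuous.intervalIntegrable (by fun_prop) _ _)
      (Continuous.intervalIntegrable (by fun_prop) _ _) fun t ht => ?_
    have h0 : 0 ≤ t := ht.1
    rw [abs_mul, abs_mul]
    have e1 : |2 * α + A * (x * (1 - t))| ≤ 2 * α + A * |x| := by
      refine (abs_add_le _ _).trans ?_
      rw [abs_of_nonneg (by positivity : 0 ≤ 2 * α), abs_mul, abs_mul, abs_of_nonneg hA,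
        abs_of_nonneg (by linarith [ht.2] : 0 ≤ 1 - t)]
      have : |x| * (1 - t) ≤ |x| := mul_le_of_le_one_right hx (by linarith)
      have := mul_le_mul_of_nonneg_left this hA
      linarith
    have e2 : |1 + t| ≤ 2 := by
      rw [abs_of_nonneg (by positivity)]; linarith [ht.2]
    have e3 := hf (x * t)
    rw [abs_mul, abs_of_nonneg h0] at e3
    calc _ ≤ (2 * α + A * |x|) * 2 * (b * (1 + |x| * t) ^ N) := by gcongr
      _ = _ := by ring
  rw [intervalIntegral.integral_const_mul] at h1
  unfold volterraOp
  rw [abs_mul, abs_div, abs_mul, abs_of_pos (by positivity : 0 < x ^ 2 + 4 * ε), abs_two]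
  have h2 := density_le hA hα hε hx
  rw [sq_abs] at h2
  have h3 := integral_one_add_pow_le |x| N
  have hC : 0 ≤ volterraConst A α ε := by unfold volterraConst; positivity
  have hint : 0 ≤ ∫ t in (0 : ℝ)..1, (1 + |x| * t) ^ N :=
    intervalIntegral.integral_nonneg zero_le_one fun t ht => by
      have : 0 ≤ t := ht.1
      positivity
  calc _ ≤ 2 * |x| / (x ^ 2 + 4 * ε) *
        ((2 * α + A * |x|) * 2 * b * ∫ t in (0 : ℝ)..1, (1 + |x| * t) ^ N) := by gcongr
    _ = 4 * b * ((2 * α + A * |x|) / (x ^ 2 + 4 * ε)) *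
        (|x| * ∫ t in (0 : ℝ)..1, (1 + |x| * t) ^ N) := by ring
    _ ≤ 4 * b * (volterraConst A α ε / (1 + |x|)) * ((1 + |x|) ^ (N + 1) / (N + 1)) := by gcongr
    _ = b / 2 * (1 + |x|) ^ N * (8 * volterraConst A α ε / (N + 1)) := by
      field_simp
      ring
    _ ≤ b / 2 * (1 + |x|) ^ N * 1 := by
      gcongr
      rw [div_le_one (by positivity)]
      exact hN
    _ = _ := by ring

theorem abs_neumannTerm_le (hA : 0 ≤ A) (hα : 0 ≤ α) (hε : 0 < ε) {N : ℕ}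
    (hN : 8 * volterraConst A α ε ≤ N + 1) (n : ℕ) (x : ℝ) :
    |neumannTerm A α ε n x| ≤ 2 * volterraConst A α ε * (1 / 2) ^ n * (1 + |x|) ^ N := by
  have hC : 0 ≤ volterraConst A α ε := by unfold volterraConst; positivity
  induction n generalizing x with
  | zero =>
    have hx := abs_nonneg x
    simp only [neumannTerm, pow_zero, mul_one]
    rw [abs_div, abs_mul, abs_two, abs_of_pos (by positivity : 0 < x ^ 2 + 4 * ε)]
    have h1 : |2 * α + A * x| ≤ 2 * α + A * |x| := by
      refine (abs_add_le _ _).trans ?_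
      rw [abs_of_nonneg (by positivity : 0 ≤ 2 * α), abs_mul, abs_of_nonneg hA]
    have h2 := density_le hA hα hε hx
    rw [sq_abs] at h2
    calc _ ≤ 2 * (2 * α + A * |x|) / (x ^ 2 + 4 * ε) := by gcongr
      _ = 2 * ((2 * α + A * |x|) / (x ^ 2 + 4 * ε)) := by ring
      _ ≤ 2 * (volterraConst A α ε / (1 + |x|)) := by gcongr
      _ ≤ 2 * volterraConst A α ε := by
        gcongr
        exact div_le_self hC (by linarith)
      _ ≤ 2 * volterraConst A α ε * (1 + |x|) ^ N :=
        le_mul_of_one_le_right (by positivity) (one_le_pow₀ (by linarith))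
  | succ n ih =>
    have := abs_volterraOp_le hA hα hε hN (continuous_neumannTerm hε n)
      (b := 2 * volterraConst A α ε * (1 / 2) ^ n) (by positivity) ih x
    refine this.trans (le_of_eq ?_)
    ring

/-- The Volterra equation for the Laplace density of the squared amplitude has a nonnegative
continuous solution of polynomial growth: the kernel is positive, and it contracts in a weighted
norm, so that the Neumann series converges. -/
theorem exists_density (hA : 0 ≤ A) (hα : 0 ≤ α) (hε : 0 < ε) :
    ∃ m : ℝ → ℝ, Continuous m ∧ (∀ x ≥ 0, 0 ≤ m x) ∧ PolyBounded m ∧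
      ∀ x > 0, x * (x ^ 2 + 4 * ε) * m x = 2 * x * (2 * α + A * x) +
        ∫ y in (0 : ℝ)..x, (2 * α + A * (x - y)) * (2 * x + 2 * y) * m y := by
  obtain ⟨N, hN⟩ := exists_nat_ge (8 * volterraConst A α ε)
  have hN : 8 * volterraConst A α ε ≤ N + 1 := by linarith
  have hC : 0 ≤ volterraConst A α ε := by unfold volterraConst; positivity
  set u : ℕ → ℝ := fun n => 2 * volterraConst A α ε * (1 / 2) ^ n with hu
  have hus : Summable u := (summable_geometric_of_lt_one (by norm_num) (by norm_num)).mul_left _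
  have hle := abs_neumannTerm_le hA hα hε hN
  have hsum : ∀ x, Summable fun n => neumannTerm A α ε n x := fun x =>
    Summable.of_norm_bounded (hus.mul_right ((1 + |x|) ^ N)) fun n => hle n x
  set m : ℝ → ℝ := fun x => ∑' n, neumannTerm A α ε n x with hm
  have hmb : ∀ x, |m x| ≤ (∑' n, u n) * (1 + |x|) ^ N := by
    intro x
    rw [← tsum_mul_right]
    exact tsum_of_norm_bounded (f := fun n => neumannTerm A α ε n x)
      (hus.mul_right ((1 + |x|) ^ N)).hasSum fun n => hle n x
  have hmc : Continuous m := by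
    have h1 : Continuous fun x => ∑' n, neumannTerm A α ε n x / (1 + |x|) ^ N := by
      refine continuous_tsum (fun n => (continuous_neumannTerm hε n).div (by fun_prop)
        fun x => by positivity) hus fun n x => ?_
      rw [norm_div, Real.norm_of_nonneg (by positivity : 0 ≤ (1 + |x|) ^ N),
        div_le_iff₀ (by positivity)]
      exact hle n x
    have h2 : m = fun x => (∑' n, neumannTerm A α ε n x / (1 + |x|) ^ N) * (1 + |x|) ^ N := by
      ext x
      rw [tsum_div_const, div_mul_cancel₀ _ (by positivity)]
    rw [h2]
    exact h1.mul (by fun_prop)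
  have hfix : ∀ x, m x = 2 * (2 * α + A * x) / (x ^ 2 + 4 * ε) + volterraOp A α ε m x := by
    intro x
    simp only [hm]
    rw [(hsum x).tsum_eq_zero_add]
    congr 1
    simp only [neumannTerm, volterraOp]
    rw [tsum_mul_left]
    congr 1
    have h := intervalIntegral.hasSum_integral_of_dominated_convergence (μ := volume)
      (a := 0) (b := 1)
      (F := fun n t => (2 * α + A * (x * (1 - t))) * (1 + t) * neumannTerm A α ε n (x * t))
      (f := fun t => (2 * α + A * (x * (1 - t))) * (1 + t) * m (x * t))
      (fun n t => ((2 * α + A * |x|) * 2) * (u n * (1 + |x|) ^ N)) ?_ ?_ ?_ ?_ ?_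
    · exact h.tsum_eq
    · intro n
      have := continuous_neumannTerm (A := A) (α := α) hε n
      exact Continuous.aestronglyMeasurable (by fun_prop)
    · intro n
      refine Eventually.of_forall fun t ht => ?_
      rw [Set.uIoc_of_le zero_le_one] at ht
      have h0 : 0 ≤ t := ht.1.le
      have hx := abs_nonneg x
      rw [Real.norm_eq_abs, abs_mul, abs_mul]
      have e1 : |2 * α + A * (x * (1 - t))| ≤ 2 * α + A * |x| := by
        refine (abs_add_le _ _).trans ?_
        rw [abs_of_nonneg (by positivity : 0 ≤ 2 * α), abs_mul, abs_mul, abs_of_nonneg hA,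
          abs_of_nonneg (by linarith [ht.2] : 0 ≤ 1 - t)]
        have : |x| * (1 - t) ≤ |x| := mul_le_of_le_one_right hx (by linarith)
        have := mul_le_mul_of_nonneg_left this hA
        linarith
      have e2 : |1 + t| ≤ 2 := by
        rw [abs_of_nonneg (by positivity)]; linarith [ht.2]
      have e3 := hle n (x * t)
      have e4 : |x * t| ≤ |x| := by
        rw [abs_mul, abs_of_nonneg h0]; exact mul_le_of_le_one_right hx ht.2
      have e5 : |neumannTerm A α ε n (x * t)| ≤ u n * (1 + |x|) ^ N := by
        refine e3.trans ?_
        simp only [hu]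
        gcongr
      gcongr
    · exact Eventually.of_forall fun t _ => (hus.mul_right _).mul_left _
    · exact intervalIntegrable_const
    · exact Eventually.of_forall fun t _ => (hsum (x * t)).hasSum.mul_left _
  refine ⟨m, hmc, fun x hx => tsum_nonneg fun n => neumannTerm_nonneg hA hα hε n hx,
    ⟨hmc.aestronglyMeasurable, ∑' n, u n, N, tsum_nonneg fun n => by positivity, fun y hy => ?_⟩,
    fun x hx => ?_⟩
  · have := hmb y
    rwa [abs_of_pos hy] at this
  · have h1 := intervalIntegral.mul_integral_comp_mul_left (a := 0) (b := 1) (c := x)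
      (f := fun y => (2 * α + A * (x - y)) * (2 * x + 2 * y) * m y)
    rw [mul_zero, mul_one] at h1
    rw [← h1]
    have h2 : (∫ t in (0 : ℝ)..1, (2 * α + A * (x - x * t)) * (2 * x + 2 * (x * t)) * m (x * t))
        = 2 * x * ∫ t in (0 : ℝ)..1, (2 * α + A * (x * (1 - t))) * (1 + t) * m (x * t) := by
      rw [← intervalIntegral.integral_const_mul]
      congr 1; ext t; ring
    rw [h2, hfix x, volterraOp]
    have : x ^ 2 + 4 * ε ≠ 0 := by positivity
    field_simp

/-- Above the threshold there is a squared amplitude `M → 1` which is the Laplace transform of a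
positive measure: it satisfies Appell's equation `M''' = 4 Q M' + 2 Q' M` of the products of
solutions of `u'' = Q u`, and it is decreasing and logarithmically convex. -/
theorem exists_amplitude (hA : 0 ≤ A) (hα : 0 ≤ α) (hε : 0 < ε) :
    ∃ M M₁ M₂ : ℝ → ℝ,
      (∀ r > 0, HasDerivAt M (M₁ r) r ∧ HasDerivAt M₁ (M₂ r) r ∧
        HasDerivAt M₂ (4 * (potential A α r - ε) * M₁ r + 2 * potentialDeriv A α r * M r) r ∧
        1 ≤ M r ∧ M₁ r ≤ 0 ∧ M₁ r ^ 2 ≤ M r * M₂ r) ∧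
      Tendsto M atTop (𝓝 1) ∧ Tendsto M₁ atTop (𝓝 0) ∧ Tendsto M₂ atTop (𝓝 0) := by
  obtain ⟨m, hc, hpos, hpb, heq⟩ := exists_density hA hα hε
  set m1 : ℝ → ℝ := fun y => y • m y with hm1
  set m2 : ℝ → ℝ := fun y => y • m1 y with hm2
  set m3 : ℝ → ℝ := fun y => y • m2 y with hm3
  have p1 : PolyBounded m1 := hpb.id_smul
  have p2 : PolyBounded m2 := p1.id_smul
  have p3 : PolyBounded m3 := p2.id_smul
  have n0 : ∀ y > 0, 0 ≤ m y := fun y hy => hpos y hy.le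
  have n1 : ∀ y > 0, 0 ≤ m1 y := fun y hy => mul_nonneg hy.le (n0 y hy)
  set v : ℝ → ℝ := fun x => 2 * α + A * x with hv
  have pv : PolyBounded v := (PolyBounded.const (2 * α)).add (PolyBounded.id.const_smul A)
  have pxv : PolyBounded fun x => x • v x := pv.id_smul
  refine ⟨fun r => 1 + laplace m r, fun r => -laplace m1 r, laplace m2, fun r hr => ?_,
    ?_, ?_, ?_⟩
  · have lv : laplace v r = potential A α r := by
      have h0 := laplace_pow 0 hr
      have h1 := laplace_pow 1 hr
      have : laplace v r = laplace (fun y => (2 * α) • y ^ 0 + A • y ^ 1) r :=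
        laplace_congr (fun y _ => by simp [hv]) r
      rw [this, laplace_add (by simpa using PolyBounded.const (2 * α))
        (by simpa using PolyBounded.id.const_smul A) hr,
        laplace_const_smul, laplace_const_smul, h0, h1]
      simp [potential]; ring
    have lxv : laplace (fun x => x • v x) r = -potentialDeriv A α r := by
      have h0 := laplace_pow 1 hr
      have h1 := laplace_pow 2 hr
      have : laplace (fun x => x • v x) r = laplace (fun y => (2 * α) • y ^ 1 + A • y ^ 2) r :=
        laplace_congr (fun y _ => by simp [hv]; ring) r
      rw [this, laplace_add (by simpa using PolyBounded.id.const_smul (2 * α))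
        ((by simpa [pow_two] using PolyBounded.id.id_smul.const_smul A)) hr,
        laplace_const_smul, laplace_const_smul, h0, h1]
      simp [potentialDeriv]; ring
    -- The Laplace transform of the Volterra equation is Appell's equation.
    have hm2' : laplace m3 r + 4 * ε * laplace m1 r = 2 * laplace (fun x => x • v x) r +
        (4 * (laplace m1 r * laplace v r) + 2 * (laplace m r * laplace (fun x => x • v x) r)) := by
      have c1 := p1.convolution pv (by fun_prop) (by fun_prop)
      have c2 := hpb.convolution pxv (by fun_prop) (by fun_prop)
      rw [← laplace_convolution p1 pv hr, ← laplace_convolution hpb pxv hr]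
      have e : ∀ (c : ℝ) (f : ℝ → ℝ), c * laplace f r = laplace (fun y => c • f y) r :=
        fun c f => (laplace_const_smul f c r).symm
      rw [e, e, e, e]
      rw [← laplace_add p3 (p1.const_smul _) hr, ← laplace_add (c1.const_smul _)
        (c2.const_smul _) hr, ← laplace_add (pxv.const_smul _) ((c1.const_smul _).add
        (c2.const_smul _)) hr]
      refine laplace_congr (fun x hx => ?_) r
      have h := heq x hx
      have hi : (∫ y in (0 : ℝ)..x, (2 * α + A * (x - y)) * (2 * x + 2 * y) * m y) =
          4 * (∫ t in (0 : ℝ)..x, m1 t * v (x - t)) +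
            2 * ∫ t in (0 : ℝ)..x, m t * ((x - t) • v (x - t)) := by
        rw [← intervalIntegral.integral_const_mul, ← intervalIntegral.integral_const_mul,
          ← intervalIntegral.integral_add (Continuous.intervalIntegrable (by fun_prop) _ _)
          (Continuous.intervalIntegrable (by fun_prop) _ _)]
        congr 1; ext t
        simp only [hm1, hv, smul_eq_mul]
        ring
      rw [hi] at h
      simp only [smul_eq_mul] at h ⊢
      simp only [hm3, hm2, smul_eq_mul, hm1] at h ⊢
      simp only [hv] at h ⊢
      linear_combination h
    have hM : 1 ≤ 1 + laplace m r := by linarith [laplace_nonneg n0 r]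
    refine ⟨(hasDerivAt_laplace hpb hr).const_add 1, ?_, ?_, hM, ?_, ?_⟩
    · exact (hasDerivAt_laplace p1 hr).neg.congr_deriv (neg_neg _)
    · refine (hasDerivAt_laplace p2 hr).congr_deriv ?_
      rw [← lv, show potentialDeriv A α r = -laplace (fun x => x • v x) r by rw [lxv]; ring]
      change -laplace m3 r = _
      linear_combination -hm2'
    · linarith [laplace_nonneg n1 r]
    · -- Cauchy–Schwarz: the second moment about the mean is nonnegative.
      set c := laplace m1 r / (1 + laplace m r) with hcdef
      have hvar : 0 ≤ laplace (fun y => m2 y + ((-(2 * c)) • m1 y + c ^ 2 • m y)) r := by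
        refine laplace_nonneg (fun y hy => ?_) r
        have : m2 y + ((-(2 * c)) • m1 y + c ^ 2 • m y) = (y - c) ^ 2 * m y := by
          simp only [hm2, hm1, smul_eq_mul]; ring
        rw [this]
        exact mul_nonneg (sq_nonneg _) (n0 y hy)
      rw [laplace_add p2 ((p1.const_smul _).add (hpb.const_smul _)) hr,
        laplace_add (p1.const_smul _) (hpb.const_smul _) hr, laplace_const_smul,
        laplace_const_smul] at hvar
      have hcM : c * (1 + laplace m r) = laplace m1 r := by
        rw [hcdef]; field_simp
      simp only [smul_eq_mul] at hvar
      have h1 : 0 ≤ laplace m2 r - c * laplace m1 r := by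
        have : c ^ 2 * laplace m r ≤ c ^ 2 * (1 + laplace m r) := by nlinarith [sq_nonneg c]
        have e : c ^ 2 * (1 + laplace m r) = c * laplace m1 r := by rw [← hcM]; ring
        linarith
      have h2 := mul_nonneg (zero_le_one.trans hM) h1
      have e2 : (1 + laplace m r) * (laplace m2 r - c * laplace m1 r)
        = (1 + laplace m r) * laplace m2 r - laplace m1 r ^ 2 := by
        rw [mul_sub, ← mul_assoc, mul_comm _ c, hcM]; ring
      rw [e2] at h2
      linarith [neg_sq (laplace m1 r)]
  · simpa using (tendsto_laplace_atTop hpb).const_add 1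
  · simpa using (tendsto_laplace_atTop p1).neg
  · exact tendsto_laplace_atTop p2

end Amplitude


/-! ### Logarithmic derivatives of outgoing solutions -/

section Comparison

theorem antitoneOn_of_hasDerivAt {f f' : ℝ → ℝ} (h : ∀ r > 0, HasDerivAt f (f' r) r)
    (h0 : ∀ r > 0, f' r ≤ 0) : AntitoneOn f (Set.Ioi 0) := by
  apply antitoneOn_of_deriv_nonpos (convex_Ioi 0)
  · exact fun r hr => (h r hr).continuousAt.continuousWithinAt
  · rw [interior_Ioi]
    exact fun r hr => (h r hr).differentiableAt.differentiableWithinAt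
  · rw [interior_Ioi]
    intro r hr
    rw [(h r hr).deriv]
    exact h0 r hr

theorem le_of_deriv_nonpos_of_tendsto {f f' : ℝ → ℝ} {c : ℝ}
    (h : ∀ r > 0, HasDerivAt f (f' r) r) (h0 : ∀ r > 0, f' r ≤ 0)
    (hlim : Tendsto f atTop (𝓝 c)) {r : ℝ} (hr : 0 < r) : c ≤ f r := by
  refine le_of_tendsto hlim ?_
  filter_upwards [eventually_ge_atTop r] with t ht
  exact antitoneOn_of_hasDerivAt h h0 hr (hr.trans_le ht) ht

theorem eq_of_deriv_zero_of_tendsto {f : ℝ → ℝ} {c : ℝ}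
    (h : ∀ r > 0, HasDerivAt f 0 r) (hlim : Tendsto f atTop (𝓝 c)) {r : ℝ} (hr : 0 < r) :
    f r = c := by
  refine le_antisymm ?_ (le_of_deriv_nonpos_of_tendsto h (fun _ _ => le_rfl) hlim hr)
  have := le_of_deriv_nonpos_of_tendsto (f := fun r => -f r) (f' := fun _ => 0) (c := -c)
    (fun r hr => (h r hr).neg.congr_deriv neg_zero) (fun _ _ => le_rfl) hlim.neg hr
  linarith

/-- `u` solves the radial equation `u'' = (A / r² + 2 α / r - ε) u` on the positive half line,
and `u'` is its derivative. -/
structure IsRadialSolution (A α ε : ℝ) (u u' : ℝ → ℂ) : Prop where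
  hasDerivAt : ∀ r > 0, HasDerivAt u (u' r) r
  hasDerivAt' : ∀ r > 0, HasDerivAt u' (((potential A α r - ε : ℝ) : ℂ) * u r) r

/-- An outgoing solution at the energy `k²`: the amplitude tends to a positive constant and
the radiation condition `u' - i k u → 0` holds. -/
structure IsOutgoing (A α k : ℝ) (u u' : ℝ → ℂ) : Prop extends
    IsRadialSolution A α (k ^ 2) u u' where
  radiation : Tendsto (fun r => u' r - Complex.I * k * u r) atTop (𝓝 0)
  amplitude : ∃ c > 0, Tendsto (fun r => ‖u r‖) atTop (𝓝 c)

theorem hasDerivAt_normSq {u : ℝ → ℂ} {u' : ℂ} {r : ℝ} (h : HasDerivAt u u' r) :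
    HasDerivAt (fun r => Complex.normSq (u r)) (2 * (u r * (starRingEnd ℂ) u').re) r := by
  have h1 : HasDerivAt (fun r => (u r).re) u'.re r :=
    (Complex.reCLM.hasFDerivAt.comp_hasDerivAt r h)
  have h2 : HasDerivAt (fun r => (u r).im) u'.im r :=
    (Complex.imCLM.hasFDerivAt.comp_hasDerivAt r h)
  refine ((h1.mul h1).add (h2.mul h2)).congr_deriv ?_
  simp
  ring

/-- An outgoing solution does not vanish, and its logarithmic derivative is `s + i P` with
`s = M' / 2M` and `P = k / M` in terms of the squared amplitude `M`. That `M` is decreasing and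
logarithmically convex means `s ≤ 0` and `s' ≥ 0`. -/
theorem IsOutgoing.exists_logDeriv {A α k : ℝ} (hA : 0 ≤ A) (hα : 0 ≤ α) (hk : 0 < k)
    {u u' : ℝ → ℂ} (h : IsOutgoing A α k u u') :
    ∃ s s' P : ℝ → ℝ, (∀ r > 0, u r ≠ 0 ∧ u' r = (s r + P r * Complex.I) * u r ∧
      HasDerivAt s (s' r) r ∧ HasDerivAt P (-2 * s r * P r) r ∧
      HasDerivAt (fun r => ‖u r‖) (s r * ‖u r‖) r ∧ s r ≤ 0 ∧ 0 ≤ s' r ∧ 0 < P r) ∧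
      Tendsto s atTop (𝓝 0) ∧ Tendsto P atTop (𝓝 k) := by
  obtain ⟨M, M₁, M₂, hM, lM, lM₁, lM₂⟩ := exists_amplitude hA hα (by positivity : 0 < k ^ 2)
  have hMpos : ∀ r > 0, 0 < M r := fun r hr => zero_lt_one.trans_le (hM r hr).2.2.2.1
  -- The first integral of Appell's equation.
  have hfirst : ∀ r > 0, 2 * M r * M₂ r - M₁ r ^ 2
      - 4 * (potential A α r - k ^ 2) * M r ^ 2 = 4 * k ^ 2 := by
    intro r hr
    refine eq_of_deriv_zero_of_tendsto (f := fun r => 2 * M r * M₂ r - M₁ r ^ 2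
      - 4 * (potential A α r - k ^ 2) * M r ^ 2) (fun r hr => ?_) ?_ hr
    · obtain ⟨d0, d1, d2, -⟩ := hM r hr
      have dV := (hasDerivAt_potential A α hr.ne')
      refine ((((d0.const_mul 2).mul d2).sub (d1.pow 2)).sub
        (((dV.sub_const (k ^ 2)).const_mul 4).mul (d0.pow 2))).congr_deriv ?_
      simp
      ring
    · have := ((lM.const_mul 2).mul lM₂).sub (lM₁.pow 2)
      have h2 := (((tendsto_potential_atTop A α).sub_const (k ^ 2)).const_mul 4).mul (lM.pow 2)
      have h3 := this.sub h2
      convert h3 using 2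
      ring
  set s : ℝ → ℝ := fun r => M₁ r / (2 * M r) with hs
  set P : ℝ → ℝ := fun r => k / M r with hP
  set s' : ℝ → ℝ := fun r => (M r * M₂ r - M₁ r ^ 2) / (2 * M r ^ 2) with hs'
  have ds : ∀ r > 0, HasDerivAt s (s' r) r := by
    intro r hr
    obtain ⟨d0, d1, d2, -⟩ := hM r hr
    have := (hMpos r hr).ne'
    refine (d1.div (d0.const_mul 2) (by positivity)).congr_deriv ?_
    simp only [hs']
    field_simp
  have dP : ∀ r > 0, HasDerivAt P (-2 * s r * P r) r := by
    intro r hr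
    obtain ⟨d0, d1, d2, -⟩ := hM r hr
    have := (hMpos r hr).ne'
    refine ((hasDerivAt_const r k).div d0 this).congr_deriv ?_
    simp only [hs, hP]
    field_simp
    ring
  have hric : ∀ r > 0, s' r = potential A α r - k ^ 2 - s r ^ 2 + P r ^ 2 := by
    intro r hr
    have h1 := hfirst r hr
    have := (hMpos r hr).ne'
    simp only [hs', hs, hP]
    field_simp
    linear_combination h1
  -- The defect `u' - (s + i P) u` has constant `‖·‖² M`, which vanishes at infinity.
  have hdef : ∀ r > 0, u' r = (s r + P r * Complex.I) * u r := by
    intro r hr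
    set D : ℝ → ℂ := fun r => u' r - (s r + P r * Complex.I) * u r with hD
    have dD : ∀ r > 0, HasDerivAt D (-(s r + P r * Complex.I) * D r) r := by
      intro r hr
      have e1 := (ds r hr).ofReal_comp
      have e2 := ((dP r hr).ofReal_comp).mul_const Complex.I
      have e3 := (h.hasDerivAt' r hr).sub ((e1.add e2).mul (h.hasDerivAt r hr))
      refine e3.congr_deriv ?_
      simp only [hD, Pi.add_apply]
      rw [hric r hr]
      push_cast
      linear_combination (-(P r : ℂ) ^ 2 * u r) * Complex.I_sq
    have hzero : Complex.normSq (D r) * M r = 0 := by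
      refine eq_of_deriv_zero_of_tendsto (f := fun r => Complex.normSq (D r) * M r)
        (fun r hr => ?_) ?_ hr
      · refine ((hasDerivAt_normSq (dD r hr)).mul (hM r hr).1).congr_deriv ?_
        have : (D r * (starRingEnd ℂ) (-(s r + P r * Complex.I) * D r)).re
            = -s r * Complex.normSq (D r) := by
          simp [Complex.normSq_apply]
          ring
        rw [this]
        have := (hMpos r hr).ne'
        simp only [hs]
        field_simp
        ring
      · have e1 : Tendsto (fun r => (s r : ℂ) + P r * Complex.I - Complex.I * k) atTop (𝓝 0) := by
          have t1 : Tendsto s atTop (𝓝 (0 / (2 * 1))) := lM₁.div (lM.const_mul 2) (by norm_num)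
          have t2 : Tendsto P atTop (𝓝 (k / 1)) := tendsto_const_nhds.div lM (by norm_num)
          have := (((Complex.continuous_ofReal.tendsto _).comp t1).add
            (((Complex.continuous_ofReal.tendsto _).comp t2).mul_const Complex.I)).sub_const
            (Complex.I * k)
          have e : ((0 / (2 * 1) : ℝ) : ℂ) + ((k / 1 : ℝ) : ℂ) * Complex.I - Complex.I * k = 0 := by
            push_cast; ring
          rw [e] at this
          exact this
        obtain ⟨c, -, hc⟩ := h.amplitude
        have e2 : Tendsto D atTop (𝓝 0) := by
          have := e1.norm.mul hc
          simp only [norm_zero, zero_mul, ← norm_mul] at this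
          have h3 := h.radiation.sub (tendsto_zero_iff_norm_tendsto_zero.2 this)
          rw [sub_zero] at h3
          refine h3.congr fun r => ?_
          simp only [hD]; ring
        have := (Complex.continuous_normSq.tendsto 0).comp e2
        have := this.mul lM
        simpa using this
    have := (mul_eq_zero.1 hzero).resolve_right (hMpos r hr).ne'
    rw [Complex.normSq_eq_zero] at this
    exact sub_eq_zero.1 this
  obtain ⟨c, hc0, hc⟩ := h.amplitude
  have hamp : ∀ r > 0, Complex.normSq (u r) / M r = c ^ 2 := by
    intro r hr
    refine eq_of_deriv_zero_of_tendsto (f := fun r => Complex.normSq (u r) / M r)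
      (fun r hr => ?_) ?_ hr
    · have := (hMpos r hr).ne'
      refine ((hasDerivAt_normSq (h.hasDerivAt r hr)).div (hM r hr).1 this).congr_deriv ?_
      rw [hdef r hr]
      have e : (u r * (starRingEnd ℂ) ((s r + P r * Complex.I) * u r)).re
          = s r * Complex.normSq (u r) := by
        simp [Complex.normSq_apply]
        ring
      rw [e]
      simp only [hs]
      field_simp
      ring
    · have := (hc.pow 2).div lM one_ne_zero
      rw [div_one] at this
      refine this.congr fun r => ?_
      simp only [Pi.div_apply, Complex.normSq_eq_norm_sq]
  have hnorm : ∀ r > 0, ‖u r‖ = c * Real.sqrt (M r) := by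
    intro r hr
    have h1 := hamp r hr
    rw [div_eq_iff (hMpos r hr).ne', Complex.normSq_eq_norm_sq] at h1
    rw [← Real.sqrt_sq (norm_nonneg (u r)), h1, Real.sqrt_mul (sq_nonneg c), Real.sqrt_sq hc0.le]
  refine ⟨s, s', P, fun r hr => ⟨?_, hdef r hr, ds r hr, dP r hr, ?_, ?_, ?_, ?_⟩, ?_, ?_⟩
  · have := Real.sqrt_pos.2 (hMpos r hr)
    rw [← norm_pos_iff, hnorm r hr]
    positivity
  · have h1 := (((hM r hr).1.sqrt (hMpos r hr).ne').const_mul c)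
    refine (h1.congr_deriv ?_).congr_of_eventuallyEq ?_
    · rw [hnorm r hr]
      simp only [hs]
      have hq := Real.sqrt_pos.2 (hMpos r hr)
      have hq2 := Real.sq_sqrt (hMpos r hr).le
      have := (hMpos r hr).ne'
      rw [div_mul_eq_mul_div, mul_div_assoc', div_eq_div_iff (by positivity) (by positivity)]
      linear_combination (-2 * c * M₁ r) * hq2
    · filter_upwards [Ioi_mem_nhds hr] with t ht using hnorm t ht
  · exact div_nonpos_of_nonpos_of_nonneg (hM r hr).2.2.2.2.1 (by linarith [hMpos r hr])
  · have := (hM r hr).2.2.2.2.2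
    exact div_nonneg (by linarith) (by positivity)
  · exact div_pos hk (hMpos r hr)
  · have := lM₁.div (lM.const_mul 2) (by norm_num)
    rw [zero_div] at this
    exact this
  · have := (tendsto_const_nhds (x := k)).div lM one_ne_zero
    rw [div_one] at this
    exact this

theorem IsOutgoing.ne_zero {A α k : ℝ} (hA : 0 ≤ A) (hα : 0 ≤ α) (hk : 0 < k)
    {u u' : ℝ → ℂ} (h : IsOutgoing A α k u u') {r : ℝ} (hr : 0 < r) : u r ≠ 0 := by
  obtain ⟨s, s', P, hs, -⟩ := h.exists_logDeriv hA hα hk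
  exact (hs r hr).1

theorem IsOutgoing.antitoneOn_norm {A α k : ℝ} (hA : 0 ≤ A) (hα : 0 ≤ α) (hk : 0 < k)
    {u u' : ℝ → ℂ} (h : IsOutgoing A α k u u') : AntitoneOn (fun r => ‖u r‖) (Set.Ioi 0) := by
  obtain ⟨s, s', P, hs, -⟩ := h.exists_logDeriv hA hα hk
  exact antitoneOn_of_hasDerivAt (fun r hr => (hs r hr).2.2.2.2.1) fun r hr =>
    mul_nonpos_of_nonpos_of_nonneg (hs r hr).2.2.2.2.2.1 (norm_nonneg _)

/-- For two outgoing solutions with logarithmic derivatives `sᵢ + i Pᵢ`, let `θ` be the phase of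
`u₁ u₂` and `h = 1 / (P₁ + P₂) = dr / dθ`. Then `h |u₁ u₂|` is a convex function of `θ`: its first
derivative is `h² β |u₁ u₂|`, and the expression here is its second derivative up to a positive
factor. -/
theorem phase_convexity {s₁ s₂ s₁' s₂' P₁ P₂ : ℝ} (h1 : s₁ ≤ 0) (h2 : s₂ ≤ 0) (h1' : 0 ≤ s₁')
    (h2' : 0 ≤ s₂') (hP1 : 0 < P₁) (hP2 : 0 < P₂) {h τ β : ℝ} (hh : h = 1 / (P₁ + P₂))
    (hτ : τ = s₁ * P₁ + s₂ * P₂) (hβ : β = s₁ + s₂ + 2 * (h * τ)) :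
    0 ≤ s₁' + s₂' + 2 * ((2 * h ^ 2 * τ) * τ + h * (s₁' * P₁ + s₁ * (-2 * s₁ * P₁) +
      (s₂' * P₂ + s₂ * (-2 * s₂ * P₂)))) + (s₁ + s₂ + 4 * (h * τ)) * β := by
  have hpos : 0 < h := by rw [hh]; positivity
  set w₁ := h * P₁ with hw1
  set w₂ := h * P₂ with hw2
  have hw : w₁ + w₂ = 1 := by rw [hw1, hw2, hh]; field_simp
  have p1 : 0 < w₁ := mul_pos hpos hP1
  have p2 : 0 < w₂ := mul_pos hpos hP2
  have hm : h * τ = w₁ * s₁ + w₂ * s₂ := by rw [hτ, hw1, hw2]; ring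
  have key : s₁' + s₂' + 2 * ((2 * h ^ 2 * τ) * τ + h * (s₁' * P₁ + s₁ * (-2 * s₁ * P₁) +
      (s₂' * P₂ + s₂ * (-2 * s₂ * P₂)))) + (s₁ + s₂ + 4 * (h * τ)) * β =
      s₁' * (1 + 2 * w₁) + s₂' * (1 + 2 * w₂) + ((s₁ + s₂) ^ 2 + 12 * (h * τ) ^ 2
        + 2 * (w₁ * s₁ ^ 2 + w₂ * s₂ ^ 2) + 6 * (s₁ * s₂)) := by
    rw [hβ]
    have e : (s₁ + s₂) * (h * τ) = w₁ * s₁ ^ 2 + w₂ * s₂ ^ 2 + s₁ * s₂ := by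
      rw [hm]; linear_combination (s₁ * s₂) * hw
    linear_combination 6 * e
  rw [key]
  have := mul_nonneg_of_nonpos_of_nonpos h1 h2
  positivity

/-- The real part of the logarithmic derivative of outgoing solutions increases with the energy.
The Wronskian `W = u₁ u₂' - u₁' u₂`, with the phase for which `u₁ u₂ > 0` at `r₀`, satisfies
`(Re W)' = -(ε₂ - ε₁) Re (u₁ u₂)`. Two integrations by parts with respect to the phase of
`u₁ u₂` turn `Re (u₁ u₂)` into the derivative of a function `B` plus a nonnegative term, because
`|u₁ u₂| dr / dθ` is a convex function of the phase `θ` (`phase_convexity`). -/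
theorem IsOutgoing.re_logDeriv_le {A α k₁ k₂ : ℝ} (hA : 0 ≤ A) (hα : 0 ≤ α) (hk₁ : 0 < k₁)
    (hk : k₁ ≤ k₂) {u₁ u₁' u₂ u₂' : ℝ → ℂ} (H₁ : IsOutgoing A α k₁ u₁ u₁')
    (H₂ : IsOutgoing A α k₂ u₂ u₂') {r₀ : ℝ} (hr₀ : 0 < r₀) :
    (u₁' r₀ / u₁ r₀).re ≤ (u₂' r₀ / u₂ r₀).re := by
  have hk₂ : 0 < k₂ := hk₁.trans_le hk
  obtain ⟨c₁, -, hc₁⟩ := H₁.amplitude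
  obtain ⟨c₂, -, hc₂⟩ := H₂.amplitude
  obtain ⟨s₁, s₁', P₁, h₁, ls₁, lP₁⟩ := H₁.exists_logDeriv hA hα hk₁
  obtain ⟨s₂, s₂', P₂, h₂, ls₂, lP₂⟩ := H₂.exists_logDeriv hA hα hk₂
  set w : ℂ := (starRingEnd ℂ) (u₁ r₀ * u₂ r₀) / ‖u₁ r₀ * u₂ r₀‖ with hw
  have hz0 : u₁ r₀ * u₂ r₀ ≠ 0 := mul_ne_zero (h₁ r₀ hr₀).1 (h₂ r₀ hr₀).1
  have hzw : w * (u₁ r₀ * u₂ r₀) = ‖u₁ r₀ * u₂ r₀‖ := by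
    rw [hw, div_mul_eq_mul_div, mul_comm, Complex.mul_conj, Complex.normSq_eq_norm_sq]
    have : (‖u₁ r₀ * u₂ r₀‖ : ℂ) ≠ 0 := by exact_mod_cast (norm_ne_zero_iff.2 hz0)
    field_simp
    push_cast
    ring
  have hwn : ‖w‖ = 1 := by
    rw [hw, norm_div, RCLike.norm_conj, Complex.norm_real, norm_norm,
      div_self (norm_ne_zero_iff.2 hz0)]
  set Δ : ℝ := k₂ ^ 2 - k₁ ^ 2 with hΔ
  have hΔ0 : 0 ≤ Δ := by
    rw [hΔ]; nlinarith
  set Z : ℝ → ℂ := fun r => w * (u₁ r * u₂ r) with hZ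
  set W : ℝ → ℂ := fun r => w * (u₁ r * u₂' r - u₁' r * u₂ r) with hW
  set a : ℝ → ℝ := fun r => ‖u₁ r‖ * ‖u₂ r‖ with ha
  set h : ℝ → ℝ := fun r => 1 / (P₁ r + P₂ r) with hh
  set τ : ℝ → ℝ := fun r => s₁ r * P₁ r + s₂ r * P₂ r with hτ
  set β : ℝ → ℝ := fun r => s₁ r + s₂ r + 2 * (h r * τ r) with hβ
  have hZn : ∀ r, ‖Z r‖ = a r := fun r => by
    simp only [hZ, ha, norm_mul, hwn, one_mul]
  have dZ : ∀ r > 0, HasDerivAt Z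
      (((s₁ r + s₂ r : ℝ) + (P₁ r + P₂ r : ℝ) * Complex.I) * Z r) r := by
    intro r hr
    refine (((H₁.hasDerivAt r hr).mul (H₂.hasDerivAt r hr)).const_mul w).congr_deriv ?_
    rw [(h₁ r hr).2.1, (h₂ r hr).2.1]
    simp only [hZ]
    push_cast
    ring
  have dX : ∀ r > 0, HasDerivAt (fun r => (Z r).re)
      ((s₁ r + s₂ r) * (Z r).re - (P₁ r + P₂ r) * (Z r).im) r := fun r hr => by
    refine (Complex.reCLM.hasFDerivAt.comp_hasDerivAt r (dZ r hr)).congr_deriv ?_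
    simp
  have dY : ∀ r > 0, HasDerivAt (fun r => (Z r).im)
      ((s₁ r + s₂ r) * (Z r).im + (P₁ r + P₂ r) * (Z r).re) r := fun r hr => by
    refine (Complex.imCLM.hasFDerivAt.comp_hasDerivAt r (dZ r hr)).congr_deriv ?_
    simp
  have da : ∀ r > 0, HasDerivAt a ((s₁ r + s₂ r) * a r) r := fun r hr => by
    refine ((h₁ r hr).2.2.2.2.1.mul (h₂ r hr).2.2.2.2.1).congr_deriv ?_
    simp only [ha]; ring
  have dW : ∀ r > 0, HasDerivAt (fun r => (W r).re) (-Δ * (Z r).re) r := by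
    intro r hr
    have e := (((H₁.hasDerivAt r hr).mul (H₂.hasDerivAt' r hr)).sub
      ((H₁.hasDerivAt' r hr).mul (H₂.hasDerivAt r hr))).const_mul w
    refine (Complex.reCLM.hasFDerivAt.comp_hasDerivAt r e).congr_deriv ?_
    have e2 : w * ((u₁' r * u₂' r + u₁ r * (((potential A α r - k₂ ^ 2 : ℝ) : ℂ) * u₂ r))
      - ((((potential A α r - k₁ ^ 2 : ℝ) : ℂ) * u₁ r) * u₂ r + u₁' r * u₂' r))
      = ((-Δ : ℝ) : ℂ) * Z r := by
      simp only [hΔ, hZ]; push_cast; ring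
    simp only [Complex.reCLM_apply, e2]
    exact Complex.re_ofReal_mul _ _
  have hWre : ∀ r > 0, (W r).re = (s₂ r - s₁ r) * (Z r).re - (P₂ r - P₁ r) * (Z r).im := by
    intro r hr
    have e : W r = ((s₂ r - s₁ r : ℝ) + (P₂ r - P₁ r : ℝ) * Complex.I) * Z r := by
      simp only [hW, hZ]
      rw [(h₁ r hr).2.1, (h₂ r hr).2.1]
      push_cast; ring
    rw [e]
    simp
  have dh : ∀ r > 0, HasDerivAt h (2 * h r ^ 2 * τ r) r := by
    intro r hr
    have hp : P₁ r + P₂ r ≠ 0 := by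
      have := (h₁ r hr).2.2.2.2.2.2.2
      have := (h₂ r hr).2.2.2.2.2.2.2
      positivity
    refine ((hasDerivAt_const r (1 : ℝ)).div ((h₁ r hr).2.2.2.1.add (h₂ r hr).2.2.2.1)
      hp).congr_deriv ?_
    simp only [hh, hτ, Pi.add_apply]
    field_simp
    ring
  have dτ : ∀ r > 0, HasDerivAt τ (s₁' r * P₁ r + s₁ r * (-2 * s₁ r * P₁ r) +
      (s₂' r * P₂ r + s₂ r * (-2 * s₂ r * P₂ r))) r := fun r hr =>
    ((h₁ r hr).2.2.1.mul (h₁ r hr).2.2.2.1).add ((h₂ r hr).2.2.1.mul (h₂ r hr).2.2.2.1)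
  set β' : ℝ → ℝ := fun r => s₁' r + s₂' r + 2 * ((2 * h r ^ 2 * τ r) * τ r +
    h r * (s₁' r * P₁ r + s₁ r * (-2 * s₁ r * P₁ r) +
      (s₂' r * P₂ r + s₂ r * (-2 * s₂ r * P₂ r)))) with hβ'
  have dβ : ∀ r > 0, HasDerivAt β (β' r) r := fun r hr =>
    ((h₁ r hr).2.2.1.add (h₂ r hr).2.2.1).add (((dh r hr).mul (dτ r hr)).const_mul 2)
  -- `X' = -Δ (|Z| - Re Z) · (nonnegative)` and `X → 0` at infinity, while `X = Re W` at `r₀`,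
  -- where `Z` is real and positive.
  set X : ℝ → ℝ := fun r => (W r).re +
    Δ * (h r * (Z r).im - h r ^ 2 * β r * (a r - (Z r).re)) with hX
  have hXnonneg : 0 ≤ X r₀ := by
    refine le_of_deriv_nonpos_of_tendsto (f := X) (f' := fun r => -(Δ * ((a r - (Z r).re) *
      (h r ^ 2 * (β' r + (s₁ r + s₂ r + 4 * (h r * τ r)) * β r))))) (fun r hr => ?_)
      (fun r hr => ?_) ?_ hr₀
    · have e := (dW r hr).add ((((dh r hr).mul (dY r hr)).sub
        ((((dh r hr).pow 2).mul (dβ r hr)).mul ((da r hr).sub (dX r hr)))).const_mul Δ)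
      refine e.congr_deriv ?_
      have hP : h r * (P₁ r + P₂ r) = 1 := by
        have := (h₁ r hr).2.2.2.2.2.2.2
        have := (h₂ r hr).2.2.2.2.2.2.2
        simp only [hh]; field_simp
      have hb : β r = s₁ r + s₂ r + 2 * (h r * τ r) := rfl
      simp only [Pi.mul_apply, Pi.sub_apply, Pi.pow_apply, Nat.cast_ofNat, Nat.add_one_sub_one,
        pow_one]
      linear_combination (Δ * (Z r).re - Δ * h r * β r * (Z r).im) * hP
        - Δ * h r * (Z r).im * hb
    · have h1 := phase_convexity (h₁ r hr).2.2.2.2.2.1 (h₂ r hr).2.2.2.2.2.1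
        (h₁ r hr).2.2.2.2.2.2.1 (h₂ r hr).2.2.2.2.2.2.1 (h₁ r hr).2.2.2.2.2.2.2
        (h₂ r hr).2.2.2.2.2.2.2 (rfl : h r = _) (rfl : τ r = _) (rfl : β r = _)
      have h2 : 0 ≤ a r - (Z r).re := by
        rw [← hZn]; linarith [Complex.re_le_norm (Z r)]
      have h3 := mul_nonneg hΔ0 (mul_nonneg h2 (mul_nonneg (sq_nonneg (h r)) h1))
      simpa only [neg_nonpos] using h3
    · have la : Tendsto a atTop (𝓝 (c₁ * c₂)) := hc₁.mul hc₂
      have lh : Tendsto h atTop (𝓝 (1 / (k₁ + k₂))) :=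
        tendsto_const_nhds.div (lP₁.add lP₂) (by positivity)
      have lτ : Tendsto τ atTop (𝓝 0) := by
        simpa using (ls₁.mul lP₁).add (ls₂.mul lP₂)
      have lβ : Tendsto β atTop (𝓝 0) := by
        simpa using (ls₁.add ls₂).add ((lh.mul lτ).const_mul 2)
      have lp : Tendsto (fun r => Δ * h r - (P₂ r - P₁ r)) atTop (𝓝 0) := by
        have := (lh.const_mul Δ).sub (lP₂.sub lP₁)
        have e : Δ * (1 / (k₁ + k₂)) - (k₂ - k₁) = 0 := by
          rw [hΔ]; field_simp; ring
        rwa [e] at this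
      have lσ : Tendsto (fun r => s₂ r - s₁ r) atTop (𝓝 0) := by simpa using ls₂.sub ls₁
      have lc : Tendsto (fun r => Δ * (h r ^ 2 * β r)) atTop (𝓝 0) := by
        simpa using ((lh.pow 2).mul lβ).const_mul Δ
      have hbd : IsBoundedUnder (· ≤ ·) atTop (fun r => ‖Z r‖) := by
        simp only [hZn]; exact la.isBoundedUnder_le
      have bX : IsBoundedUnder (· ≤ ·) atTop (norm ∘ fun r => (Z r).re) :=
        hbd.mono_le (Eventually.of_forall fun r => Complex.abs_re_le_norm (Z r))
      have bY : IsBoundedUnder (· ≤ ·) atTop (norm ∘ fun r => (Z r).im) :=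
        hbd.mono_le (Eventually.of_forall fun r => Complex.abs_im_le_norm (Z r))
      have t1 := lσ.zero_mul_isBoundedUnder_le bX
      have t2 := lp.zero_mul_isBoundedUnder_le bY
      have t3 := lc.zero_mul_isBoundedUnder_le bX
      have t4 := lc.mul la
      rw [zero_mul] at t4
      have t := ((t1.add t2).add t3).sub t4
      simp only [add_zero, sub_zero] at t
      refine t.congr' ?_
      filter_upwards [eventually_gt_atTop 0] with r hr
      simp only [hX]
      rw [hWre r hr]
      ring
  have hZr : Z r₀ = (a r₀ : ℂ) := by
    simp only [hZ, ha]; rw [hzw, norm_mul]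
  have hapos : 0 < a r₀ := by
    have : 0 < ‖Z r₀‖ := by
      rw [norm_pos_iff]
      simp only [hZ]
      rw [hzw]
      exact_mod_cast (norm_ne_zero_iff.2 hz0)
    rwa [hZn] at this
  simp only [hX] at hXnonneg
  rw [hWre r₀ hr₀, hZr] at hXnonneg
  simp only [Complex.ofReal_re, Complex.ofReal_im, mul_zero, sub_zero, sub_self, add_zero]
    at hXnonneg
  have hσ := nonneg_of_mul_nonneg_left hXnonneg hapos
  rw [(h₁ r₀ hr₀).2.1, (h₂ r₀ hr₀).2.1, mul_div_cancel_right₀ _ (h₁ r₀ hr₀).1,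
    mul_div_cancel_right₀ _ (h₂ r₀ hr₀).1]
  simp
  linarith

end Comparison


/-! ### Logarithmic derivatives of decaying solutions -/

section Decaying

/-- A positive solution of the radial equation at the energy `-κ²` which decays at infinity. -/
structure IsDecaying (A α κ : ℝ) (u u' : ℝ → ℝ) : Prop where
  hasDerivAt : ∀ r > 0, HasDerivAt u (u' r) r
  hasDerivAt' : ∀ r > 0, HasDerivAt u' ((potential A α r + κ ^ 2) * u r) r
  pos : ∀ r > 0, 0 < u r
  tendsto : Tendsto u atTop (𝓝 0)
  tendsto' : Tendsto u' atTop (𝓝 0)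

variable {A α κ : ℝ}

theorem potential_nonneg (hA : 0 ≤ A) (hα : 0 ≤ α) {r : ℝ} (hr : 0 < r) :
    0 ≤ potential A α r := by
  unfold potential; positivity

theorem IsDecaying.deriv_le (hA : 0 ≤ A) (hα : 0 ≤ α) (hκ : 0 ≤ κ) {u u' : ℝ → ℝ}
    (h : IsDecaying A α κ u u') {r : ℝ} (hr : 0 < r) : u' r ≤ -κ * u r := by
  have key := le_of_deriv_nonpos_of_tendsto (c := 0)
    (f := fun r => -(Real.exp (-(κ * r)) * (u' r + κ * u r)))
    (f' := fun r => -(Real.exp (-(κ * r)) * (potential A α r * u r))) ?_ ?_ ?_ hr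
  · have := Real.exp_pos (-(κ * r))
    by_contra hc
    have h1 : 0 < u' r + κ * u r := by linarith
    have := mul_pos this h1
    linarith
  · intro r hr
    have e1 : HasDerivAt (fun r : ℝ => Real.exp (-(κ * r))) (Real.exp (-(κ * r)) * (-(κ * 1))) r :=
      (((hasDerivAt_id r).const_mul κ).neg).exp
    refine ((e1.mul ((h.hasDerivAt' r hr).add ((h.hasDerivAt r hr).const_mul κ))).neg).congr_deriv ?_
    simp only [Pi.add_apply]
    ring
  · intro r hr
    have := potential_nonneg hA hα hr
    have := h.pos r hr
    have := Real.exp_pos (-(κ * r))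
    simp only [Left.neg_nonpos_iff]
    positivity
  · have h1 := (h.tendsto'.add (h.tendsto.const_mul κ))
    rw [mul_zero, add_zero] at h1
    have hb : IsBoundedUnder (· ≤ ·) atTop (norm ∘ fun r : ℝ => Real.exp (-(κ * r))) := by
      refine ⟨1, ?_⟩
      rw [eventually_map]
      filter_upwards [eventually_ge_atTop 0] with t ht
      simp only [Function.comp, Real.norm_eq_abs, Real.abs_exp]
      exact Real.exp_le_one_iff.2 (by have := mul_nonneg hκ ht; linarith)
    have := h1.zero_mul_isBoundedUnder_le hb
    rw [← neg_zero]
    exact (this.congr fun t => mul_comm _ _).neg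

theorem IsDecaying.antitoneOn (hA : 0 ≤ A) (hα : 0 ≤ α) (hκ : 0 ≤ κ) {u u' : ℝ → ℝ}
    (h : IsDecaying A α κ u u') : AntitoneOn u (Set.Ioi 0) :=
  antitoneOn_of_hasDerivAt h.hasDerivAt fun r hr => by
    have := h.deriv_le hA hα hκ hr
    have := mul_nonneg hκ (h.pos r hr).le
    linarith

/-- Below the threshold the logarithmic derivative increases with the energy. -/
theorem IsDecaying.logDeriv_le {κ₁ κ₂ : ℝ} (hκ₁ : 0 ≤ κ₁) (hκ : κ₁ ≤ κ₂) {u₁ u₁' u₂ u₂' : ℝ → ℝ}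
    (h₁ : IsDecaying A α κ₁ u₁ u₁') (h₂ : IsDecaying A α κ₂ u₂ u₂') {r : ℝ} (hr : 0 < r) :
    u₂' r / u₂ r ≤ u₁' r / u₁ r := by
  have key := le_of_deriv_nonpos_of_tendsto (c := 0)
    (f := fun r => u₁' r * u₂ r - u₁ r * u₂' r)
    (f' := fun r => -((κ₂ ^ 2 - κ₁ ^ 2) * (u₁ r * u₂ r))) ?_ ?_ ?_ hr
  · rw [div_le_div_iff₀ (h₂.pos r hr) (h₁.pos r hr)]
    linarith
  · intro r hr
    refine (((h₁.hasDerivAt' r hr).mul (h₂.hasDerivAt r hr)).sub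
      ((h₁.hasDerivAt r hr).mul (h₂.hasDerivAt' r hr))).congr_deriv ?_
    ring
  · intro r hr
    have := mul_pos (h₁.pos r hr) (h₂.pos r hr)
    have : 0 ≤ κ₂ ^ 2 - κ₁ ^ 2 := by nlinarith
    simp only [Left.neg_nonpos_iff]
    positivity
  · simpa using (h₁.tendsto'.mul h₂.tendsto).sub (h₁.tendsto.mul h₂.tendsto')

/-- Quantitative continuity of the logarithmic derivative in the energy, relative to a decaying
solution; the other solution may lie on either side of the threshold. -/
theorem IsDecaying.norm_logDeriv_sub_le (hA : 0 ≤ A) (hα : 0 ≤ α) (hκ : 0 < κ) {u₁ u₁' : ℝ → ℝ}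
    (h₁ : IsDecaying A α κ u₁ u₁') {ε : ℝ} {u₂ u₂' : ℝ → ℂ} (h₂ : IsRadialSolution A α ε u₂ u₂')
    (hanti : AntitoneOn (fun r => ‖u₂ r‖) (Set.Ioi 0))
    (hbdd : IsBoundedUnder (· ≤ ·) atTop (norm ∘ u₂'))
    {r : ℝ} (hr : 0 < r) (hne : u₂ r ≠ 0) :
    ‖u₂' r / u₂ r - ((u₁' r / u₁ r : ℝ) : ℂ)‖ ≤ |ε + κ ^ 2| / κ := by
  set F : ℝ → ℂ := fun t => u₁ t * u₂' t - u₁' t * u₂ t with hF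
  have dF : ∀ t > 0, HasDerivAt F (-((ε + κ ^ 2 : ℝ) : ℂ) * (u₁ t * u₂ t)) t := by
    intro t ht
    refine (((h₁.hasDerivAt t ht).ofReal_comp.mul (h₂.hasDerivAt' t ht)).sub
      ((h₁.hasDerivAt' t ht).ofReal_comp.mul (h₂.hasDerivAt t ht))).congr_deriv ?_
    push_cast
    ring
  set C : ℝ := |ε + κ ^ 2| / κ * ‖u₂ r‖ with hC
  have hC0 : 0 ≤ C := by positivity
  have hbound : ∀ T ≥ r, ‖F T - F r‖ ≤ C * (u₁ r - u₁ T) := by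
    intro T hT
    have hpos : ∀ t ∈ Set.Icc r T, 0 < t := fun t ht => hr.trans_le ht.1
    refine image_norm_le_of_norm_deriv_right_le_deriv_boundary' (a := r) (b := T)
      (f := fun t => F t - F r) (f' := fun t => -((ε + κ ^ 2 : ℝ) : ℂ) * (u₁ t * u₂ t))
      (B := fun t => C * (u₁ r - u₁ t)) (B' := fun t => C * (-u₁' t)) ?_ ?_ ?_ ?_ ?_ ?_
      (Set.right_mem_Icc.2 hT)
    · exact fun t ht => ((dF t (hpos t ht)).sub_const _).continuousAt.continuousWithinAt
    · exact fun t ht => ((dF t (hpos t (Set.Ico_subset_Icc_self ht))).sub_const _).hasDerivWithinAt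
    · simp
    · exact fun t ht => (((h₁.hasDerivAt t (hpos t ht)).const_sub _).const_mul
        C).continuousAt.continuousWithinAt
    · exact fun t ht => (((h₁.hasDerivAt t (hpos t (Set.Ico_subset_Icc_self ht))).const_sub
        _).const_mul C).hasDerivWithinAt
    · intro t ht
      have ht0 : 0 < t := hr.trans_le ht.1
      have hu := h₁.pos t ht0
      rw [norm_mul, norm_neg, norm_mul, Complex.norm_real, Complex.norm_real,
        Real.norm_of_nonneg hu.le, Real.norm_eq_abs]
      have e1 : ‖u₂ t‖ ≤ ‖u₂ r‖ := hanti hr ht0 ht.1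
      have e2 := h₁.deriv_le hA hα hκ.le ht0
      calc |ε + κ ^ 2| * (u₁ t * ‖u₂ t‖) ≤ |ε + κ ^ 2| * (u₁ t * ‖u₂ r‖) := by gcongr
        _ = C * (κ * u₁ t) := by rw [hC]; field_simp
        _ ≤ C * (-u₁' t) := by gcongr; linarith
  have hFlim : Tendsto F atTop (𝓝 0) := by
    have b2 : IsBoundedUnder (· ≤ ·) atTop (norm ∘ u₂) := by
      refine ⟨‖u₂ r‖, ?_⟩
      rw [eventually_map]
      filter_upwards [eventually_ge_atTop r] with t ht
      exact hanti hr (hr.trans_le ht : 0 < t) ht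
    have l1 : Tendsto (fun t => (u₁ t : ℂ)) atTop (𝓝 0) := by
      rw [← Complex.ofReal_zero]
      exact (Complex.continuous_ofReal.tendsto _).comp h₁.tendsto
    have l2 : Tendsto (fun t => (u₁' t : ℂ)) atTop (𝓝 0) := by
      rw [← Complex.ofReal_zero]
      exact (Complex.continuous_ofReal.tendsto _).comp h₁.tendsto'
    simpa using (l1.zero_mul_isBoundedUnder_le hbdd).sub (l2.zero_mul_isBoundedUnder_le b2)
  have hFr : ‖F r‖ ≤ C * u₁ r := by
    have l1 : Tendsto (fun T => ‖F T - F r‖) atTop (𝓝 ‖0 - F r‖) := (hFlim.sub_const _).norm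
    have l2 : Tendsto (fun T => C * (u₁ r - u₁ T)) atTop (𝓝 (C * (u₁ r - 0))) :=
      (h₁.tendsto.const_sub _).const_mul C
    have := le_of_tendsto_of_tendsto l1 l2
      (by filter_upwards [eventually_ge_atTop r] with T hT using hbound T hT)
    simpa using this
  have hu := h₁.pos r hr
  have hu0 : (u₁ r : ℂ) ≠ 0 := by exact_mod_cast hu.ne'
  have e : u₂' r / u₂ r - ((u₁' r / u₁ r : ℝ) : ℂ) = F r / (u₁ r * u₂ r) := by
    simp only [hF]
    push_cast
    field_simp
  rw [e, norm_div, norm_mul, Complex.norm_real, Real.norm_of_nonneg hu.le,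
    div_le_iff₀ (mul_pos hu (norm_pos_iff.2 hne))]
  refine hFr.trans (le_of_eq ?_)
  rw [hC]; ring

theorem IsDecaying.isRadialSolution {u u' : ℝ → ℝ} (h : IsDecaying A α κ u u') :
    IsRadialSolution A α (-κ ^ 2) (fun r => u r) (fun r => u' r) :=
  ⟨fun r hr => (h.hasDerivAt r hr).ofReal_comp, fun r hr => by
    refine (h.hasDerivAt' r hr).ofReal_comp.congr_deriv ?_
    push_cast; ring⟩

theorem IsDecaying.abs_logDeriv_sub_le (hA : 0 ≤ A) (hα : 0 ≤ α) {κ₁ κ₂ : ℝ} (hκ₁ : 0 < κ₁)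
    (hκ₂ : 0 < κ₂) {u₁ u₁' u₂ u₂' : ℝ → ℝ}
    (h₁ : IsDecaying A α κ₁ u₁ u₁') (h₂ : IsDecaying A α κ₂ u₂ u₂') {r : ℝ} (hr : 0 < r) :
    |u₂' r / u₂ r - u₁' r / u₁ r| ≤ |κ₁ ^ 2 - κ₂ ^ 2| / κ₁ := by
  have := h₁.norm_logDeriv_sub_le hA hα hκ₁ h₂.isRadialSolution ?_ ?_ hr ?_
  · rw [← Complex.ofReal_div, ← Complex.ofReal_sub, Complex.norm_real, Real.norm_eq_abs,
      neg_add_eq_sub] at this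
    exact this
  · intro a ha b hb hab
    simp only [Complex.norm_real]
    rw [Real.norm_of_nonneg (h₂.pos _ ha).le, Real.norm_of_nonneg (h₂.pos _ hb).le]
    exact h₂.antitoneOn hA hα hκ₂.le ha hb hab
  · have : Tendsto (fun r => (u₂' r : ℂ)) atTop (𝓝 ((0 : ℝ) : ℂ)) :=
      (Complex.continuous_ofReal.tendsto _).comp h₂.tendsto'
    exact this.norm.isBoundedUnder_le
  · exact_mod_cast (h₂.pos r hr).ne'

/-- The logarithmic derivatives at the energies `k²` and `-k²` become equal as `k → 0`. -/
theorem IsDecaying.norm_logDeriv_sub_outgoing_le (hA : 0 ≤ A) (hα : 0 ≤ α) {k : ℝ} (hk : 0 < k)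
    {u₁ u₁' : ℝ → ℝ} {u₂ u₂' : ℝ → ℂ} (h₁ : IsDecaying A α k u₁ u₁')
    (h₂ : IsOutgoing A α k u₂ u₂') {r : ℝ} (hr : 0 < r) :
    ‖u₂' r / u₂ r - ((u₁' r / u₁ r : ℝ) : ℂ)‖ ≤ 2 * k := by
  have := h₁.norm_logDeriv_sub_le hA hα hk h₂.toIsRadialSolution (h₂.antitoneOn_norm hA hα hk) ?_
    hr (h₂.ne_zero hA hα hk hr)
  · refine this.trans (le_of_eq ?_)
    rw [abs_of_pos (by positivity)]
    field_simp
    ring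
  · obtain ⟨c, -, hc⟩ := h₂.amplitude
    have l1 := h₂.radiation.norm.isBoundedUnder_le
    have l2 : IsBoundedUnder (· ≤ ·) atTop fun r => ‖Complex.I * k * u₂ r‖ := by
      simp only [norm_mul]
      exact (hc.const_mul _).isBoundedUnder_le
    refine (isBoundedUnder_le_add l1 l2).mono_le (Eventually.of_forall fun r => ?_)
    simp only [Function.comp, Pi.add_apply]
    calc ‖u₂' r‖ = ‖(u₂' r - Complex.I * k * u₂ r) + Complex.I * k * u₂ r‖ := by
          rw [sub_add_cancel]
      _ ≤ _ := norm_add_le _ _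

end Decaying


/-! ### The outgoing wave as a Laplace transform -/

section Wave

theorem laplace_deriv {F : Type*} [NormedAddCommGroup F] [NormedSpace ℝ F] [CompleteSpace F]
    {f f' : ℝ → F} (hf : PolyBounded f) (hf' : PolyBounded f')
    (hd : ∀ y > 0, HasDerivAt f (f' y) y) (hc : ContinuousWithinAt f (Set.Ici 0) 0)
    (h0 : f 0 = 0) {r : ℝ} (hr : 0 < r) : laplace f' r = r • laplace f r := by
  have dexp : ∀ y : ℝ, HasDerivAt (fun y : ℝ => Real.exp (-(r * y)))
      (Real.exp (-(r * y)) * (-(r * 1))) y := fun y =>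
    (((hasDerivAt_id y).const_mul r).neg).exp
  have h1 := integral_Ioi_of_hasDerivAt_of_tendsto (a := 0) (m := (0 : F))
    (f := fun y => Real.exp (-(r * y)) • f y)
    (f' := fun y => Real.exp (-(r * y)) • f' y - r • (Real.exp (-(r * y)) • f y)) ?_ ?_ ?_ ?_
  · have hi : Integrable (fun y => r • (Real.exp (-(r * y)) • f y))
        (volume.restrict (Set.Ioi 0)) := (hf.integrableOn hr).smul r
    rw [integral_sub (hf'.integrableOn hr) hi, integral_smul] at h1
    simp only [h0, smul_zero, sub_zero] at h1
    exact sub_eq_zero.1 h1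
  · exact (Continuous.continuousWithinAt (by fun_prop)).smul hc
  · intro y hy
    refine ((dexp y).smul (hd y hy)).congr_deriv ?_
    rw [smul_smul, mul_one, mul_neg, neg_smul, mul_comm r (Real.exp _),
      sub_eq_add_neg]
  · exact (hf'.integrableOn hr).sub ((hf.integrableOn hr).smul r)
  · obtain ⟨K, N, hK, hb⟩ := hf.bound
    rw [tendsto_zero_iff_norm_tendsto_zero]
    have hlim : Tendsto (fun y : ℝ => K * 2 ^ N * (y ^ N * Real.exp (-(r * y)))) atTop (𝓝 0) := by
      have h2 := (isLittleO_pow_exp_pos_mul_atTop N hr).tendsto_div_nhds_zero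
      have := h2.const_mul (K * 2 ^ N)
      rw [mul_zero] at this
      refine this.congr fun y => ?_
      rw [Real.exp_neg, div_eq_mul_inv]
    refine squeeze_zero' (Eventually.of_forall fun y => norm_nonneg _) ?_ hlim
    filter_upwards [eventually_ge_atTop 1] with y hy
    rw [norm_smul, Real.norm_of_nonneg (Real.exp_pos _).le]
    have e : (1 + y) ^ N ≤ (2 * y) ^ N := by gcongr; linarith
    calc Real.exp (-(r * y)) * ‖f y‖ ≤ Real.exp (-(r * y)) * (K * (2 * y) ^ N) := by
          gcongr
          exact (hb y (by linarith)).trans (by gcongr)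
      _ = _ := by rw [mul_pow]; ring

/-- A function that vanishes to order `p` at the origin has a Laplace transform of order
`r⁻ᵖ⁻¹`. -/
theorem norm_laplace_le {F : Type*} [NormedAddCommGroup F] [NormedSpace ℝ F]
    {f : ℝ → F} {K : ℝ} (hK : 0 ≤ K) {p N : ℕ}
    (hb : ∀ y > 0, ‖f y‖ ≤ K * (y ^ p * (1 + y) ^ N)) :
    ∃ C : ℝ, ∀ r ≥ 1, ‖laplace f r‖ ≤ C / r ^ (p + 1) := by
  refine ⟨K * 2 ^ N * (p.factorial + (p + N).factorial), fun r hr => ?_⟩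
  have hr0 : 0 < r := by linarith
  have hpow : ∀ n : ℕ, IntegrableOn (fun y : ℝ => Real.exp (-(r * y)) * y ^ n) (Set.Ioi 0) := by
    intro n
    have : PolyBounded (fun y : ℝ => y ^ n) := by
      refine ⟨by fun_prop, 1, n, zero_le_one, fun y hy => ?_⟩
      rw [Real.norm_of_nonneg (by positivity), one_mul]
      gcongr; linarith
    exact this.integrableOn hr0
  have h1 : ‖laplace f r‖ ≤ ∫ y in Set.Ioi (0 : ℝ), K * 2 ^ N * (Real.exp (-(r * y)) * y ^ p +
      Real.exp (-(r * y)) * y ^ (p + N)) := by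
    refine norm_integral_le_of_norm_le (((hpow p).add (hpow (p + N))).const_mul _) ?_
    filter_upwards [ae_restrict_mem measurableSet_Ioi] with y hy
    have hy : 0 < y := hy
    rw [norm_smul, Real.norm_of_nonneg (Real.exp_pos _).le]
    have e : (1 + y) ^ N ≤ 2 ^ N * (1 + y ^ N) := by
      rcases le_total y 1 with h | h
      · calc (1 + y) ^ N ≤ 2 ^ N := by gcongr; linarith
          _ ≤ 2 ^ N * (1 + y ^ N) := le_mul_of_one_le_right (by positivity)
              (by linarith [pow_pos hy N])
      · calc (1 + y) ^ N ≤ (2 * y) ^ N := by gcongr; linarith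
          _ = 2 ^ N * y ^ N := mul_pow _ _ _
          _ ≤ 2 ^ N * (1 + y ^ N) := by gcongr; linarith
    calc Real.exp (-(r * y)) * ‖f y‖
        ≤ Real.exp (-(r * y)) * (K * (y ^ p * (2 ^ N * (1 + y ^ N)))) := by
          gcongr
          exact (hb y hy).trans (by gcongr)
      _ = _ := by rw [pow_add]; ring
  refine h1.trans ?_
  rw [integral_const_mul, integral_add (hpow p) (hpow (p + N))]
  have e1 : (∫ y in Set.Ioi (0 : ℝ), Real.exp (-(r * y)) * y ^ p) = p.factorial / r ^ (p + 1) :=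
    laplace_pow p hr0
  have e2 : (∫ y in Set.Ioi (0 : ℝ), Real.exp (-(r * y)) * y ^ (p + N))
      = (p + N).factorial / r ^ (p + N + 1) := laplace_pow (p + N) hr0
  rw [e1, e2]
  have e3 : r ^ (p + 1) ≤ r ^ (p + N + 1) := pow_le_pow_right₀ hr (by omega)
  calc _ ≤ K * 2 ^ N * (p.factorial / r ^ (p + 1) + (p + N).factorial / r ^ (p + 1)) := by gcongr
    _ = _ := by ring

variable (ℓ : ℕ) (α : ℝ) (z : ℂ)

/-- The density `y^(ℓ + c) (1 + y / z)^(ℓ - c)`, `c = 2 α / z`, whose Laplace transform is the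
outgoing wave up to elementary factors; here `z = -2 i ρ`, so that `c = i η`. -/
noncomputable def waveDensity (y : ℝ) : ℂ :=
  (y : ℂ) ^ ((ℓ : ℂ) + 2 * α / z) * (1 + y / z) ^ ((ℓ : ℂ) - 2 * α / z)

/-- The factor `v` of the outgoing wave `e^{-zr/2} v(r)`. -/
noncomputable def waveFactor (r : ℝ) : ℂ := (r : ℂ) ^ (ℓ + 1) * laplace (waveDensity ℓ α z) r

/-- The derivative of `waveFactor`. -/
noncomputable def waveFactor' (r : ℝ) : ℂ :=
  (ℓ + 1) * (r : ℂ) ^ ℓ * laplace (waveDensity ℓ α z) r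
    - (r : ℂ) ^ (ℓ + 1) * laplace (fun y => y • waveDensity ℓ α z y) r

/-- The outgoing wave, as a function of the radius in units of the channel radius. -/
noncomputable def wave (r : ℝ) : ℂ := Complex.exp (-(z * r / 2)) * waveFactor ℓ α z r

/-- The radial derivative of `wave`. -/
noncomputable def wave' (r : ℝ) : ℂ :=
  Complex.exp (-(z * r / 2)) * (waveFactor' ℓ α z r - z / 2 * waveFactor ℓ α z r)

variable {ℓ α z}

theorem one_le_re_one_add_div (hz : 0 ≤ z.re) {y : ℝ} (hy : 0 ≤ y) : 1 ≤ (1 + (y : ℂ) / z).re := by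
  have : 0 ≤ ((y : ℂ) / z).re := by
    rw [div_eq_mul_inv, Complex.re_ofReal_mul, Complex.inv_re]
    exact mul_nonneg hy (div_nonneg hz (Complex.normSq_nonneg z))
  simp only [Complex.add_re, Complex.one_re]
  linarith

theorem coulombExponent_re_nonneg (hα : 0 ≤ α) (hz : 0 ≤ z.re) : 0 ≤ (2 * α / z : ℂ).re := by
  rw [div_eq_mul_inv, show (2 * α : ℂ) = ((2 * α : ℝ) : ℂ) by push_cast; ring,
    Complex.re_ofReal_mul, Complex.inv_re]
  exact mul_nonneg (by positivity) (div_nonneg hz (Complex.normSq_nonneg z))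

/-- A bound on the density which is locally uniform in `z`. -/
theorem norm_waveDensity_le (hα : 0 ≤ α) (hz : 0 ≤ z.re) {n : ℕ} (h1 : ‖z⁻¹‖ ≤ n)
    (h2 : ‖(2 * α / z : ℂ)‖ ≤ n) {y : ℝ} (hy : 0 < y) :
    ‖waveDensity ℓ α z y‖ ≤
      ((1 + n) ^ ℓ * Real.exp (Real.pi * n)) * (y ^ ℓ * (1 + y) ^ (n + ℓ)) := by
  set c : ℂ := 2 * α / z with hc
  have hcre : 0 ≤ c.re := coulombExponent_re_nonneg hα hz
  have hcn : c.re ≤ n := (Complex.re_le_norm c).trans h2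
  have hcim : |c.im| ≤ n := (Complex.abs_im_le_norm c).trans h2
  have hre := one_le_re_one_add_div hz hy.le
  have hnorm1 : 1 ≤ ‖1 + (y : ℂ) / z‖ := hre.trans (Complex.re_le_norm _)
  have hne : 1 + (y : ℂ) / z ≠ 0 := by
    rw [← norm_pos_iff]; linarith
  unfold waveDensity
  rw [← hc, norm_mul, Complex.norm_cpow_eq_rpow_re_of_pos hy, Complex.norm_cpow_of_ne_zero hne]
  have e1 : y ^ ((ℓ : ℂ) + c).re ≤ y ^ ℓ * (1 + y) ^ n := by
    rw [Complex.add_re, Complex.natCast_re, Real.rpow_add hy, Real.rpow_natCast]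
    gcongr
    calc y ^ c.re ≤ (1 + y) ^ c.re := Real.rpow_le_rpow hy.le (by linarith) hcre
      _ ≤ (1 + y) ^ (n : ℝ) := Real.rpow_le_rpow_of_exponent_le (by linarith) hcn
      _ = (1 + y) ^ n := Real.rpow_natCast _ _
  have e2 : ‖1 + (y : ℂ) / z‖ ^ ((ℓ : ℂ) - c).re ≤ ((1 + n) * (1 + y)) ^ ℓ := by
    calc ‖1 + (y : ℂ) / z‖ ^ ((ℓ : ℂ) - c).re ≤ ‖1 + (y : ℂ) / z‖ ^ (ℓ : ℝ) := by
          apply Real.rpow_le_rpow_of_exponent_le hnorm1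
          simp only [Complex.sub_re, Complex.natCast_re]
          linarith
      _ = ‖1 + (y : ℂ) / z‖ ^ ℓ := Real.rpow_natCast _ _
      _ ≤ ((1 + n) * (1 + y)) ^ ℓ := by
          gcongr
          calc ‖1 + (y : ℂ) / z‖ ≤ ‖(1 : ℂ)‖ + ‖(y : ℂ) / z‖ := norm_add_le _ _
            _ = 1 + y * ‖z⁻¹‖ := by
              rw [norm_one, div_eq_mul_inv, norm_mul, Complex.norm_real, Real.norm_of_nonneg hy.le]
            _ ≤ 1 + y * n := by gcongr
            _ ≤ (1 + n) * (1 + y) := by nlinarith [(Nat.cast_nonneg n : (0 : ℝ) ≤ n)]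
  have e3 : (Real.exp ((1 + (y : ℂ) / z).arg * ((ℓ : ℂ) - c).im))⁻¹ ≤ Real.exp (Real.pi * n) := by
    rw [← Real.exp_neg]
    apply Real.exp_le_exp.2
    refine (neg_le_abs _).trans ?_
    rw [abs_mul]
    simp only [Complex.sub_im, Complex.natCast_im, zero_sub, abs_neg]
    exact mul_le_mul (Complex.abs_arg_le_pi _) hcim (abs_nonneg _) Real.pi_pos.le
  have e4 := mul_le_mul e2 e3 (inv_nonneg.2 (Real.exp_pos _).le) (by positivity)
  rw [← div_eq_mul_inv] at e4
  calc _ ≤ (y ^ ℓ * (1 + y) ^ n) * (((1 + n) * (1 + y)) ^ ℓ * Real.exp (Real.pi * n)) := by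
        gcongr
    _ = _ := by rw [mul_pow, pow_add]; ring

theorem hasDerivAt_waveDensity (hz : 0 ≤ z.re) {y : ℝ} (hy : 0 < y) :
    HasDerivAt (waveDensity ℓ α z)
      (((ℓ : ℂ) + 2 * α / z) * (waveDensity ℓ α z y / y)
        + ((ℓ : ℂ) - 2 * α / z) * (waveDensity ℓ α z y / (1 + y / z) / z)) y := by
  have hre := one_le_re_one_add_div hz hy.le
  have hslit : 1 + (y : ℂ) / z ∈ Complex.slitPlane := Or.inl (by linarith)
  have hne := Complex.slitPlane_ne_zero hslit
  have hy0 : (y : ℂ) ≠ 0 := by exact_mod_cast hy.ne'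
  have d1 := ((hasDerivAt_id (y : ℂ)).cpow_const (c := (ℓ : ℂ) + 2 * α / z)
    (Complex.ofReal_mem_slitPlane.2 hy)).comp_ofReal
  have d2 := ((((hasDerivAt_id (y : ℂ)).div_const z).const_add 1).cpow_const
    (c := (ℓ : ℂ) - 2 * α / z) hslit).comp_ofReal
  refine (d1.mul d2).congr_deriv ?_
  simp only [id]
  rw [Complex.cpow_sub _ 1 hy0, Complex.cpow_sub _ 1 hne, Complex.cpow_one, Complex.cpow_one]
  unfold waveDensity
  ring

theorem polyBounded_waveDensity (hα : 0 ≤ α) (hz : 0 ≤ z.re) : PolyBounded (waveDensity ℓ α z) := by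
  obtain ⟨n, hn⟩ := exists_nat_ge (max ‖z⁻¹‖ ‖(2 * α / z : ℂ)‖)
  refine ⟨?_, (1 + n) ^ ℓ * Real.exp (Real.pi * n), ℓ + (n + ℓ), by positivity, fun y hy => ?_⟩
  · refine ContinuousOn.aestronglyMeasurable (fun y hy => ?_) measurableSet_Ioi
    exact (hasDerivAt_waveDensity hz hy).continuousAt.continuousWithinAt
  · refine (norm_waveDensity_le hα hz ((le_max_left _ _).trans hn) ((le_max_right _ _).trans hn)
      hy).trans ?_
    rw [pow_add (1 + y) ℓ]
    gcongr
    linarith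

theorem exists_norm_waveDensity_le (ℓ : ℕ) (hα : 0 ≤ α) (hz : 0 ≤ z.re) : ∃ K ≥ 0, ∃ N : ℕ,
    ∀ y > 0, ‖waveDensity ℓ α z y‖ ≤ K * (y ^ ℓ * (1 + y) ^ N) := by
  obtain ⟨n, hn⟩ := exists_nat_ge (max ‖z⁻¹‖ ‖(2 * α / z : ℂ)‖)
  exact ⟨_, by positivity, n + ℓ, fun y hy => norm_waveDensity_le hα hz
    ((le_max_left _ _).trans hn) ((le_max_right _ _).trans hn) hy⟩

/-- The confluent hypergeometric equation for the Laplace transform of the density. -/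
theorem laplace_waveDensity_ode (hα : 0 ≤ α) (hz : 0 ≤ z.re) (hz0 : z ≠ 0) {r : ℝ} (hr : 0 < r) :
    r * (laplace (fun y => y • y • waveDensity ℓ α z y) r
        + z * laplace (fun y => y • waveDensity ℓ α z y) r)
      = (2 * ℓ + 2) * laplace (fun y => y • waveDensity ℓ α z y) r
        + (z * (ℓ + 1) + 2 * α) * laplace (waveDensity ℓ α z) r := by
  set g := waveDensity ℓ α z with hg
  have pg : PolyBounded g := polyBounded_waveDensity hα hz
  have pyg : PolyBounded fun y => y • g y := pg.id_smul
  have pyyg : PolyBounded fun y => y • y • g y := pyg.id_smul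
  have pmul : ∀ (w : ℂ) {f : ℝ → ℂ}, PolyBounded f → PolyBounded fun y => w * f y := by
    intro w f hf
    obtain ⟨K, N, hK, hb⟩ := hf.bound
    refine ⟨hf.meas.const_mul w, ‖w‖ * K, N, by positivity, fun y hy => ?_⟩
    rw [norm_mul, mul_assoc]
    exact mul_le_mul_of_nonneg_left (hb y hy) (norm_nonneg w)
  have lmul : ∀ (w : ℂ) (f : ℝ → ℂ), laplace (fun y => w * f y) r = w * laplace f r := by
    intro w f
    unfold laplace
    rw [← integral_const_mul]
    exact integral_congr_ae (Eventually.of_forall fun y => by simp only [mul_smul_comm])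
  have key := laplace_deriv (f := fun y => y • y • g y + z * (y • g y))
    (f' := fun y => (2 * ℓ + 2 : ℂ) * (y • g y) + (z * (ℓ + 1) + 2 * α) * g y)
    (pyyg.add (pmul z pyg)) ((pmul _ pyg).add (pmul _ pg)) ?_ ?_ ?_ hr
  · rw [laplace_add pyyg (pmul z pyg) hr, laplace_add (pmul _ pyg) (pmul _ pg) hr, lmul, lmul,
      lmul, Complex.real_smul] at key
    exact key.symm
  · intro y hy
    have hy0 : (y : ℂ) ≠ 0 := by exact_mod_cast ne_of_gt hy
    have hne : 1 + (y : ℂ) / z ≠ 0 := by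
      have := one_le_re_one_add_div hz (le_of_lt hy)
      intro h0
      rw [h0, Complex.zero_re] at this
      linarith
    have hne' : z + y ≠ 0 := by
      have e : z + y = z * (1 + y / z) := by field_simp
      rw [e]
      exact mul_ne_zero hz0 hne
    have d0 : HasDerivAt (fun w : ℝ => (w : ℂ)) 1 y := Complex.ofRealCLM.hasDerivAt
    have d1 := hasDerivAt_waveDensity (ℓ := ℓ) (α := α) hz hy
    have d2 := ((d0.mul d0).mul d1).add ((d0.mul d1).const_mul z)
    refine (d2.congr_deriv ?_).congr_of_eventuallyEq (Eventually.of_forall fun y => ?_)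
    · simp only [Complex.real_smul, Pi.mul_apply]
      rw [← hg]
      field_simp
      ring
    · simp only [Complex.real_smul, Pi.mul_apply, Pi.add_apply, mul_assoc]
      rfl
  · obtain ⟨K, hK, N, hb⟩ := exists_norm_waveDensity_le ℓ hα hz
    rw [ContinuousWithinAt]
    simp only [zero_smul, mul_zero, add_zero]
    rw [tendsto_zero_iff_norm_tendsto_zero]
    have hlim : Tendsto (fun y : ℝ => (y + ‖z‖) * y * (K * (y ^ ℓ * (1 + y) ^ N)))
        (𝓝[Set.Ici 0] 0) (𝓝 0) := by
      have : Continuous fun y : ℝ => (y + ‖z‖) * y * (K * (y ^ ℓ * (1 + y) ^ N)) := by fun_prop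
      have := this.continuousWithinAt (s := Set.Ici 0) (x := 0)
      rw [ContinuousWithinAt] at this
      simpa using this
    refine squeeze_zero' (Eventually.of_forall fun y => norm_nonneg _) ?_ hlim
    filter_upwards [self_mem_nhdsWithin] with y hy
    rcases eq_or_lt_of_le (show (0 : ℝ) ≤ y from hy) with h | h
    · simp [← h]
    · have hb' := hb y h
      have e : y • y • g y + z * (y • g y) = ((y : ℂ) + z) * y * g y := by
        simp only [Complex.real_smul]; ring
      rw [e, norm_mul, norm_mul, Complex.norm_real, Real.norm_of_nonneg h.le]
      have e2 : ‖(y : ℂ) + z‖ ≤ y + ‖z‖ := by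
        refine (norm_add_le _ _).trans ?_
        rw [Complex.norm_real, Real.norm_of_nonneg h.le]
      gcongr
  · simp

theorem hasDerivAt_waveFactor (hα : 0 ≤ α) (hz : 0 ≤ z.re) {r : ℝ} (hr : 0 < r) :
    HasDerivAt (waveFactor ℓ α z) (waveFactor' ℓ α z r) r := by
  have d0 : HasDerivAt (fun w : ℝ => (w : ℂ)) 1 r := Complex.ofRealCLM.hasDerivAt
  refine ((d0.pow (ℓ + 1)).mul (hasDerivAt_laplace (polyBounded_waveDensity hα hz) hr)).congr_deriv ?_
  unfold waveFactor'
  simp only [Pi.pow_apply, Nat.add_sub_cancel]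
  push_cast
  ring

theorem hasDerivAt_waveFactor' (hα : 0 ≤ α) (hz : 0 ≤ z.re) (hz0 : z ≠ 0) {r : ℝ} (hr : 0 < r) :
    HasDerivAt (waveFactor' ℓ α z) (z * waveFactor' ℓ α z r
      + (potential (ℓ * (ℓ + 1)) α r : ℝ) * waveFactor ℓ α z r) r := by
  have d0 : HasDerivAt (fun w : ℝ => (w : ℂ)) 1 r := Complex.ofRealCLM.hasDerivAt
  have pg := polyBounded_waveDensity (ℓ := ℓ) hα hz
  have hr0 : (r : ℂ) ≠ 0 := by exact_mod_cast hr.ne'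
  have dp : HasDerivAt (fun w : ℝ => (w : ℂ) ^ ℓ) (ℓ * (r : ℂ) ^ ℓ / r) r := by
    refine (d0.pow ℓ).congr_deriv ?_
    cases ℓ with
    | zero => simp
    | succ n =>
      rw [Nat.add_sub_cancel, pow_succ]
      field_simp
  have dp1 : HasDerivAt (fun w : ℝ => (w : ℂ) ^ (ℓ + 1)) ((ℓ + 1) * (r : ℂ) ^ ℓ) r := by
    refine (d0.pow (ℓ + 1)).congr_deriv ?_
    simp
  have e := ((dp.const_mul ((ℓ : ℂ) + 1)).mul (hasDerivAt_laplace pg hr)).sub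
    (dp1.mul (hasDerivAt_laplace pg.id_smul hr))
  refine e.congr_deriv ?_
  have ode := laplace_waveDensity_ode (ℓ := ℓ) hα hz hz0 hr
  unfold waveFactor waveFactor' potential
  push_cast
  rw [pow_succ]
  have hr2 : (r : ℂ) ^ 2 * ((ℓ : ℂ) * (ℓ + 1) / r ^ 2 + 2 * α / r)
      = (ℓ : ℂ) * (ℓ + 1) + 2 * α * r := by field_simp
  field_simp
  linear_combination (r : ℂ) * ode

theorem isRadialSolution_wave (hα : 0 ≤ α) (hz : 0 ≤ z.re) (hz0 : z ≠ 0) {ε : ℝ}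
    (hε : (ε : ℂ) = -z ^ 2 / 4) :
    IsRadialSolution (ℓ * (ℓ + 1)) α ε (wave ℓ α z) (wave' ℓ α z) := by
  have dexp : ∀ r : ℝ, HasDerivAt (fun r : ℝ => Complex.exp (-(z * r / 2)))
      (Complex.exp (-(z * r / 2)) * (-(z / 2))) r := by
    intro r
    have d0 : HasDerivAt (fun w : ℝ => (w : ℂ)) 1 r := Complex.ofRealCLM.hasDerivAt
    refine (((d0.const_mul z).div_const 2).neg.cexp).congr_deriv ?_
    simp only [Pi.neg_apply]
    ring
  refine ⟨fun r hr => ?_, fun r hr => ?_⟩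
  · refine ((dexp r).mul (hasDerivAt_waveFactor hα hz hr)).congr_deriv ?_
    unfold wave'
    ring
  · refine ((dexp r).mul ((hasDerivAt_waveFactor' hα hz hz0 hr).sub
      ((hasDerivAt_waveFactor hα hz hr).const_mul (z / 2)))).congr_deriv ?_
    push_cast
    rw [hε]
    unfold wave
    simp only [Pi.sub_apply]
    ring

theorem exists_waveFactor_bounds (ℓ : ℕ) (hα : 0 ≤ α) (hz : 0 ≤ z.re) :
    ∃ C : ℝ, ∀ r ≥ 1, ‖waveFactor ℓ α z r‖ ≤ C ∧ ‖waveFactor' ℓ α z r‖ ≤ C / r := by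
  obtain ⟨K, hK, N, hb⟩ := exists_norm_waveDensity_le ℓ hα hz
  obtain ⟨C₁, h₁⟩ := norm_laplace_le hK hb
  have hb' : ∀ y > 0, ‖y • waveDensity ℓ α z y‖ ≤ K * (y ^ (ℓ + 1) * (1 + y) ^ N) := by
    intro y hy
    rw [norm_smul, Real.norm_of_nonneg (le_of_lt hy)]
    have := mul_le_mul_of_nonneg_left (hb y hy) (le_of_lt hy)
    refine this.trans (le_of_eq ?_)
    ring
  obtain ⟨C₂, h₂⟩ := norm_laplace_le hK hb'
  have hC₁ : 0 ≤ C₁ := by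
    have := (norm_nonneg _).trans (h₁ 1 le_rfl)
    simpa using this
  have hC₂ : 0 ≤ C₂ := by
    have := (norm_nonneg _).trans (h₂ 1 le_rfl)
    simpa using this
  refine ⟨(ℓ + 1) * C₁ + C₂, fun r hr => ?_⟩
  have hr0 : 0 < r := by linarith
  have e1 := h₁ r hr
  have e2 := h₂ r hr
  have hn : ∀ n : ℕ, ‖(r : ℂ) ^ n‖ = r ^ n := fun n => by
    rw [norm_pow, Complex.norm_real, Real.norm_of_nonneg hr0.le]
  constructor
  · unfold waveFactor
    rw [norm_mul, hn]
    calc r ^ (ℓ + 1) * ‖laplace (waveDensity ℓ α z) r‖ ≤ r ^ (ℓ + 1) * (C₁ / r ^ (ℓ + 1)) := by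
          gcongr
      _ = C₁ := by field_simp
      _ ≤ _ := by nlinarith [(Nat.cast_nonneg ℓ : (0 : ℝ) ≤ ℓ)]
  · unfold waveFactor'
    refine (norm_sub_le _ _).trans ?_
    rw [norm_mul, norm_mul, norm_mul, hn, hn,
      show ‖(ℓ : ℂ) + 1‖ = ℓ + 1 by
        rw [show (ℓ : ℂ) + 1 = ((ℓ + 1 : ℝ) : ℂ) by push_cast; ring, Complex.norm_real,
          Real.norm_of_nonneg (by positivity)]]
    calc _ ≤ (ℓ + 1) * r ^ ℓ * (C₁ / r ^ (ℓ + 1)) + r ^ (ℓ + 1) * (C₂ / r ^ (ℓ + 1 + 1)) := by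
          gcongr
      _ = _ := by field_simp; ring

theorem tendsto_waveFactor' (hα : 0 ≤ α) (hz : 0 ≤ z.re) :
    Tendsto (waveFactor' ℓ α z) atTop (𝓝 0) := by
  obtain ⟨C, hC⟩ := exists_waveFactor_bounds ℓ hα hz
  rw [tendsto_zero_iff_norm_tendsto_zero]
  refine squeeze_zero' (Eventually.of_forall fun y => norm_nonneg _) ?_
    (tendsto_const_nhds.div_atTop tendsto_id : Tendsto (fun r : ℝ => C / r) atTop (𝓝 0))
  filter_upwards [eventually_ge_atTop 1] with r hr using (hC r hr).2

end Wave


/-! ### Tricomi's integral and the radiation condition -/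

section Outgoing

variable {ℓ : ℕ} {α : ℝ} {z : ℂ}

theorem ofReal_mul_cpow {r : ℝ} (hr : 0 < r) (hz0 : z ≠ 0) (s : ℂ) :
    ((r : ℂ) * z) ^ s = (r : ℂ) ^ s * z ^ s := by
  have hr0 : (r : ℂ) ≠ 0 := by exact_mod_cast hr.ne'
  rw [Complex.cpow_def_of_ne_zero (mul_ne_zero hr0 hz0), Complex.cpow_def_of_ne_zero hr0,
    Complex.cpow_def_of_ne_zero hz0, ← Complex.exp_add, Complex.log_ofReal_mul hr hz0,
    Complex.ofReal_log hr.le]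
  ring_nf

/-- The substitution `u = r y` in the integral for Tricomi's function. -/
theorem integral_tricomi_eq {r : ℝ} (hr : 0 < r) :
    (∫ u in Set.Ioi (0 : ℝ), Complex.exp (-(u : ℂ)) * (u : ℂ) ^ ((ℓ : ℂ) + 2 * α / z) *
      (1 + (u : ℂ) / (r * z)) ^ ((ℓ : ℂ) - 2 * α / z))
      = (r : ℂ) ^ ((ℓ : ℂ) + 2 * α / z + 1) * laplace (waveDensity ℓ α z) r := by
  have hr0 : (r : ℂ) ≠ 0 := by exact_mod_cast hr.ne'
  have h := integral_comp_mul_left_Ioi (fun u : ℝ => Complex.exp (-(u : ℂ)) *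
    (u : ℂ) ^ ((ℓ : ℂ) + 2 * α / z) * (1 + (u : ℂ) / (r * z)) ^ ((ℓ : ℂ) - 2 * α / z)) 0 hr
  rw [mul_zero] at h
  have h2 : (∫ u in Set.Ioi (0 : ℝ), Complex.exp (-(u : ℂ)) * (u : ℂ) ^ ((ℓ : ℂ) + 2 * α / z) *
      (1 + (u : ℂ) / (r * z)) ^ ((ℓ : ℂ) - 2 * α / z)) = r • (r⁻¹ •
      ∫ u in Set.Ioi (0 : ℝ), Complex.exp (-(u : ℂ)) * (u : ℂ) ^ ((ℓ : ℂ) + 2 * α / z) *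
      (1 + (u : ℂ) / (r * z)) ^ ((ℓ : ℂ) - 2 * α / z)) := by
    rw [smul_smul, mul_inv_cancel₀ hr.ne', one_smul]
  rw [h2, ← h, Complex.cpow_add _ _ hr0, Complex.cpow_one, mul_comm (_ ^ _) (r : ℂ), mul_assoc,
    Complex.real_smul]
  congr 1
  unfold laplace waveDensity
  rw [← integral_const_mul]
  refine setIntegral_congr_fun measurableSet_Ioi fun y hy => ?_
  simp only [Complex.real_smul]
  push_cast
  rw [← Complex.ofReal_mul r y, Complex.ofReal_mul, Complex.mul_cpow_ofReal_nonneg hr.le (le_of_lt hy),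
    mul_div_mul_left _ _ hr0]
  ring

/-- The power `r^(ℓ + 1 + c)` times the Laplace transform of the density tends to
`Γ(ℓ + 1 + c)`. -/
theorem tendsto_cpow_mul_laplace (hα : 0 ≤ α) (hz : 0 ≤ z.re) :
    Tendsto (fun r : ℝ => (r : ℂ) ^ ((ℓ : ℂ) + 2 * α / z + 1) * laplace (waveDensity ℓ α z) r)
      atTop (𝓝 (Complex.Gamma ((ℓ : ℂ) + 2 * α / z + 1))) := by
  have hc := coulombExponent_re_nonneg hα hz
  have hre : 0 < ((ℓ : ℂ) + 2 * α / z + 1).re := by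
    simp only [Complex.add_re, Complex.natCast_re, Complex.one_re]
    positivity
  rw [Complex.Gamma_eq_integral hre, Complex.GammaIntegral]
  obtain ⟨n, hn⟩ := exists_nat_ge (max ‖z⁻¹‖ ‖(2 * α / z : ℂ)‖)
  have hn1 := (le_max_left _ _).trans hn
  have hn2 := (le_max_right _ _).trans hn
  have hzr : ∀ r : ℝ, 0 ≤ r → 0 ≤ ((r : ℂ) * z).re := fun r hr => by
    rw [Complex.re_ofReal_mul]; exact mul_nonneg hr hz
  have hcr : ∀ r : ℝ, 0 < r → (2 * ((r * α : ℝ) : ℂ) / (r * z) : ℂ) = 2 * α / z := by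
    intro r hr
    have : (r : ℂ) ≠ 0 := by exact_mod_cast hr.ne'
    push_cast
    rw [mul_left_comm, mul_div_mul_left _ _ this]
  -- The integrand at `r` is the density with parameters `r α` and `r z`, which have the same `c`.
  have hF : ∀ r : ℝ, 0 < r → ∀ u : ℝ, Complex.exp (-(u : ℂ)) * (u : ℂ) ^ ((ℓ : ℂ) + 2 * α / z) *
      (1 + (u : ℂ) / (r * z)) ^ ((ℓ : ℂ) - 2 * α / z)
      = Complex.exp (-(u : ℂ)) * waveDensity ℓ (r * α) (r * z) u := by
    intro r hr u
    unfold waveDensity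
    rw [hcr r hr, mul_assoc]
  have key := tendsto_integral_filter_of_dominated_convergence (l := atTop)
    (μ := volume.restrict (Set.Ioi (0 : ℝ)))
    (F := fun (r u : ℝ) => Complex.exp (-(u : ℂ)) * (u : ℂ) ^ ((ℓ : ℂ) + 2 * α / z) *
      (1 + (u : ℂ) / (r * z)) ^ ((ℓ : ℂ) - 2 * α / z))
    (f := fun u => (Real.exp (-u) : ℂ) * (u : ℂ) ^ ((ℓ : ℂ) + 2 * α / z + 1 - 1))
    (bound := fun u => ((1 + n) ^ ℓ * Real.exp (Real.pi * n)) *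
      (Real.exp (-(1 * u)) * (1 + u) ^ (ℓ + (n + ℓ)))) ?_ ?_
    ((integrableOn_exp_mul_one_add_pow one_pos _).const_mul _) ?_
  · refine key.congr' ?_
    filter_upwards [eventually_gt_atTop 0] with r hr
    exact integral_tricomi_eq hr
  · filter_upwards [eventually_gt_atTop 0] with r hr
    have h := (polyBounded_waveDensity (ℓ := ℓ) (α := r * α) (z := r * z) (by positivity)
      (hzr r hr.le)).meas
    have h2 := (Continuous.aestronglyMeasurable (by fun_prop) : AEStronglyMeasurable
      (fun u : ℝ => Complex.exp (-(u : ℂ))) (volume.restrict (Set.Ioi 0))).mul h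
    refine h2.congr (Eventually.of_forall fun u => ?_)
    exact (hF r hr u).symm
  · filter_upwards [eventually_ge_atTop 1] with r hr
    filter_upwards [ae_restrict_mem measurableSet_Ioi] with u hu
    have hr0 : 0 < r := by linarith
    have hu : 0 < u := hu
    rw [hF r hr0 u, norm_mul, Complex.norm_exp]
    have h1 : ‖((r : ℂ) * z)⁻¹‖ ≤ n := by
      rw [mul_inv, norm_mul, ← Complex.ofReal_inv, Complex.norm_real,
        Real.norm_of_nonneg (inv_nonneg.2 hr0.le)]
      exact (mul_le_of_le_one_left (norm_nonneg _) (inv_le_one_of_one_le₀ hr)).trans hn1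
    have h2 : ‖(2 * ((r * α : ℝ) : ℂ) / (r * z) : ℂ)‖ ≤ n := by
      rw [hcr r hr0]; exact hn2
    have h3 := norm_waveDensity_le (ℓ := ℓ) (by positivity : 0 ≤ r * α) (hzr r hr0.le) h1 h2 hu
    have h4 : u ^ ℓ * (1 + u) ^ (n + ℓ) ≤ (1 + u) ^ (ℓ + (n + ℓ)) := by
      rw [pow_add (1 + u) ℓ]
      gcongr
      linarith
    calc _ ≤ Real.exp (-(1 * u)) * (((1 + n) ^ ℓ * Real.exp (Real.pi * n)) *
          (1 + u) ^ (ℓ + (n + ℓ))) := by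
          gcongr
          · simp
          · exact h3.trans (by gcongr)
      _ = _ := by ring
  · filter_upwards [ae_restrict_mem measurableSet_Ioi] with u hu
    have h1 : Tendsto (fun r : ℝ => 1 + (u : ℂ) / (r * z)) atTop (𝓝 1) := by
      have h2 : Tendsto (fun r : ℝ => ((r⁻¹ : ℝ) : ℂ) * (u / z)) atTop (𝓝 (((0 : ℝ) : ℂ) * (u / z))) :=
        ((Complex.continuous_ofReal.tendsto _).comp tendsto_inv_atTop_zero).mul_const _
      rw [Complex.ofReal_zero, zero_mul] at h2
      have h3 := h2.const_add 1
      rw [add_zero] at h3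
      refine h3.congr fun r => ?_
      push_cast
      rw [div_mul_eq_div_div_swap, div_eq_mul_inv (u / z : ℂ)]
      ring
    have h4 := h1.cpow (tendsto_const_nhds (x := (ℓ : ℂ) - 2 * α / z)) Complex.one_mem_slitPlane
    rw [Complex.one_cpow] at h4
    have h5 := h4.const_mul (Complex.exp (-(u : ℂ)) * (u : ℂ) ^ ((ℓ : ℂ) + 2 * α / z))
    rw [mul_one] at h5
    convert h5 using 2
    push_cast
    ring_nf

theorem isOutgoing_wave (hα : 0 ≤ α) {k : ℝ} (hk : 0 < k) :
    IsOutgoing (ℓ * (ℓ + 1)) α k (wave ℓ α (-2 * Complex.I * k)) (wave' ℓ α (-2 * Complex.I * k)) := by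
  set z : ℂ := -2 * Complex.I * k with hzdef
  have hz : 0 ≤ z.re := by simp [hzdef]
  have hz0 : z ≠ 0 := by
    have : (k : ℂ) ≠ 0 := by exact_mod_cast hk.ne'
    simp [hzdef, this]
  have hrad := isRadialSolution_wave (ℓ := ℓ) hα hz hz0 (ε := k ^ 2) (by
    rw [hzdef]; push_cast; linear_combination (k : ℂ) ^ 2 * Complex.I_sq)
  have hexp : ∀ r : ℝ, ‖Complex.exp (-(z * r / 2))‖ = 1 := by
    intro r
    rw [show -(z * r / 2) = ((k * r : ℝ) : ℂ) * Complex.I by rw [hzdef]; push_cast; ring]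
    exact Complex.norm_exp_ofReal_mul_I _
  refine ⟨hrad, ?_, ?_⟩
  · rw [tendsto_zero_iff_norm_tendsto_zero]
    refine (tendsto_zero_iff_norm_tendsto_zero.1 (tendsto_waveFactor' (ℓ := ℓ) hα hz)).congr
      fun r => ?_
    have e : wave' ℓ α z r - Complex.I * k * wave ℓ α z r
        = Complex.exp (-(z * r / 2)) * waveFactor' ℓ α z r := by
      unfold wave' wave
      rw [show Complex.I * (k : ℂ) = -(z / 2) by rw [hzdef]; ring]
      ring
    rw [e, norm_mul, hexp, one_mul]
  · have hcre : (2 * α / z : ℂ).re = 0 := by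
      have : (2 * α / z : ℂ) = ((α / k : ℝ) : ℂ) * Complex.I := by
        have : (k : ℂ) ≠ 0 := by exact_mod_cast hk.ne'
        rw [hzdef]
        push_cast
        field_simp
        rw [Complex.I_sq]
        ring
      rw [this]; simp
    have hre : 0 < ((ℓ : ℂ) + 2 * α / z + 1).re := by
      simp only [Complex.add_re, Complex.natCast_re, Complex.one_re, hcre]
      positivity
    refine ⟨‖Complex.Gamma ((ℓ : ℂ) + 2 * α / z + 1)‖,
      norm_pos_iff.2 (Complex.Gamma_ne_zero_of_re_pos hre), ?_⟩
    refine (tendsto_cpow_mul_laplace (ℓ := ℓ) hα hz).norm.congr' ?_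
    filter_upwards [eventually_gt_atTop 0] with r hr
    unfold wave waveFactor
    rw [norm_mul, norm_mul, hexp, one_mul, norm_mul, Complex.norm_cpow_eq_rpow_re_of_pos hr,
      norm_pow, Complex.norm_real, Real.norm_of_nonneg hr.le]
    simp only [Complex.add_re, Complex.natCast_re, Complex.one_re, hcre, add_zero]
    rw [show (ℓ : ℝ) + 1 = ((ℓ + 1 : ℕ) : ℝ) by push_cast; ring, Real.rpow_natCast]

/-! ### The logarithmic derivative of the outgoing wave on the closed upper half plane -/

/-- Differentiation of Tricomi's integral with respect to its argument, in a neighbourhood of the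
closed right half plane. -/
theorem differentiableAt_tricomi_integral (hz : 0 ≤ z.re) (hz0 : z ≠ 0) {p d : ℂ} (hp : 0 ≤ p.re) :
    DifferentiableAt ℂ (fun w : ℂ => ∫ u in Set.Ioi (0 : ℝ),
      Complex.exp (-(u : ℂ)) * (u : ℂ) ^ p * (1 + (u : ℂ) / w) ^ d) z := by
  have hzn : 0 < ‖z‖ := norm_pos_iff.2 hz0
  -- On the ball of radius `‖z‖ / 4` the base `1 + u / w` stays off the branch cut.
  have hw0 : ∀ w ∈ Metric.ball z (‖z‖ / 4), 3 / 4 * ‖z‖ ≤ ‖w‖ ∧ ‖w‖ ≤ 5 / 4 * ‖z‖ := by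
    intro w hw
    rw [mem_ball_iff_norm] at hw
    have h1 := norm_sub_norm_le z w
    have h2 := norm_sub_norm_le w z
    rw [norm_sub_rev] at h1
    constructor <;> linarith
  have hne : ∀ w ∈ Metric.ball z (‖z‖ / 4), w ≠ 0 := fun w hw => by
    rw [← norm_pos_iff]
    linarith [(hw0 w hw).1]
  have hlow : ∀ w ∈ Metric.ball z (‖z‖ / 4), ∀ u > (0 : ℝ), 1 / 2 ≤ ‖1 + (u : ℂ) / w‖ := by
    intro w hw u hu
    have e : 1 + (u : ℂ) / w = (w + u) / w := by
      have := hne w hw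
      field_simp
    rw [e, norm_div, le_div_iff₀ (norm_pos_iff.2 (hne w hw))]
    have h1 : ‖z‖ ≤ ‖z + u‖ := by
      rw [Complex.norm_def, Complex.norm_def]
      apply Real.sqrt_le_sqrt
      simp only [Complex.normSq_apply, Complex.add_re, Complex.ofReal_re, Complex.add_im,
        Complex.ofReal_im, add_zero]
      nlinarith [mul_nonneg hz hu.le]
    have h2 : ‖z + u‖ - ‖w + u‖ ≤ ‖w - z‖ := by
      refine (norm_sub_norm_le _ _).trans (le_of_eq ?_)
      rw [add_sub_add_right_eq_sub, norm_sub_rev]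
    rw [mem_ball_iff_norm] at hw
    linarith [(hw0 w (mem_ball_iff_norm.2 hw)).2]
  have hslit : ∀ w ∈ Metric.ball z (‖z‖ / 4), ∀ u > (0 : ℝ), 1 + (u : ℂ) / w ∈ Complex.slitPlane := by
    intro w hw u hu
    by_contra hc
    rw [Complex.mem_slitPlane_iff] at hc
    push Not at hc
    have hwne := hne w hw
    have him : w.im = 0 := by
      have := hc.2
      rw [div_eq_mul_inv] at this
      simp only [Complex.add_im, Complex.one_im, Complex.im_ofReal_mul, zero_add, Complex.inv_im,
        mul_eq_zero, hu.ne', false_or, div_eq_zero_iff, neg_eq_zero, Complex.normSq_eq_zero,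
        hwne, or_false] at this
      exact this
    have hre : w.re ≤ 0 := by
      have h1 := hc.1
      rw [div_eq_mul_inv] at h1
      simp only [Complex.add_re, Complex.one_re, Complex.re_ofReal_mul, Complex.inv_re] at h1
      by_contra hpos
      push Not at hpos
      have : 0 ≤ u * (w.re / Complex.normSq w) :=
        mul_nonneg hu.le (div_nonneg hpos.le (Complex.normSq_nonneg w))
      linarith
    have : ‖z‖ ≤ ‖w - z‖ := by
      rw [Complex.norm_def, Complex.norm_def]
      apply Real.sqrt_le_sqrt
      simp only [Complex.normSq_apply, Complex.sub_re, Complex.sub_im, him]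
      nlinarith [mul_nonneg hz (neg_nonneg.2 hre), sq_nonneg w.re]
    rw [mem_ball_iff_norm] at hw
    linarith
  obtain ⟨n, hn⟩ := exists_nat_ge p.re
  obtain ⟨m, hm⟩ := exists_nat_ge |(d - 1).re|
  set C : ℝ := 1 + 2 / ‖z‖ with hC
  have hup : ∀ w ∈ Metric.ball z (‖z‖ / 4), ∀ u > (0 : ℝ), ‖1 + (u : ℂ) / w‖ ≤ C * (1 + u) := by
    intro w hw u hu
    calc ‖1 + (u : ℂ) / w‖ ≤ ‖(1 : ℂ)‖ + ‖(u : ℂ) / w‖ := norm_add_le _ _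
      _ = 1 + u / ‖w‖ := by rw [norm_one, norm_div, Complex.norm_real, Real.norm_of_nonneg hu.le]
      _ ≤ 1 + u * (2 / ‖z‖) := by
        gcongr 1 + ?_
        rw [mul_div_assoc', div_le_div_iff₀ (norm_pos_iff.2 (hne w hw)) hzn]
        nlinarith [(hw0 w hw).1]
      _ ≤ C * (1 + u) := by
        rw [hC]
        have : 0 ≤ 2 / ‖z‖ := by positivity
        nlinarith
  have hub : ∀ u > (0 : ℝ), ‖(u : ℂ) ^ p‖ ≤ (1 + u) ^ n := by
    intro u hu
    rw [Complex.norm_cpow_eq_rpow_re_of_pos hu]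
    calc u ^ p.re ≤ (1 + u) ^ p.re := Real.rpow_le_rpow hu.le (by linarith) hp
      _ ≤ (1 + u) ^ (n : ℝ) := Real.rpow_le_rpow_of_exponent_le (by linarith) hn
      _ = (1 + u) ^ n := Real.rpow_natCast _ _
  have hcp : ∀ w ∈ Metric.ball z (‖z‖ / 4), ∀ u > (0 : ℝ),
      ‖(1 + (u : ℂ) / w) ^ (d - 1)‖ ≤ (4 * (C * (1 + u))) ^ m * Real.exp (Real.pi * |(d - 1).im|) := by
    intro w hw u hu
    have hb0 := Complex.slitPlane_ne_zero (hslit w hw u hu)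
    rw [Complex.norm_cpow_of_ne_zero hb0, div_eq_mul_inv]
    set x := ‖1 + (u : ℂ) / w‖ with hx
    have hx1 : 1 / 2 ≤ x := hlow w hw u hu
    have e1 : x ^ (d - 1).re ≤ (4 * (C * (1 + u))) ^ m := by
      have f1 : x ^ (d - 1).re = (2 * x) ^ (d - 1).re * 2 ^ (-(d - 1).re) := by
        rw [Real.mul_rpow zero_le_two (by linarith), Real.rpow_neg zero_le_two]
        have := (Real.rpow_pos_of_pos two_pos (d - 1).re).ne'
        field_simp
      rw [f1]
      calc (2 * x) ^ (d - 1).re * 2 ^ (-(d - 1).re) ≤ (2 * x) ^ (m : ℝ) * 2 ^ (m : ℝ) := by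
            gcongr
            · linarith
            · exact (le_abs_self _).trans hm
            · exact one_le_two
            · exact (neg_le_abs _).trans hm
        _ = (4 * x) ^ m := by
            rw [Real.rpow_natCast, Real.rpow_natCast, ← mul_pow]; ring
        _ ≤ _ := by
            gcongr
            exact hup w hw u hu
    refine mul_le_mul e1 ?_ (inv_nonneg.2 (Real.exp_pos _).le) ?_
    · rw [← Real.exp_neg]
      apply Real.exp_le_exp.2
      refine (neg_le_abs _).trans ?_
      rw [abs_mul]
      exact mul_le_mul_of_nonneg_right (Complex.abs_arg_le_pi _) (abs_nonneg _)
    · have : 0 ≤ C := by rw [hC]; positivity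
      positivity
  have hmeas : ∀ w ∈ Metric.ball z (‖z‖ / 4), ∀ q : ℂ, ContinuousOn (fun u : ℝ =>
      Complex.exp (-(u : ℂ)) * (u : ℂ) ^ p * (1 + (u : ℂ) / w) ^ q) (Set.Ioi 0) := by
    intro w hw q u hu
    have c0 : ContinuousAt (fun u : ℝ => (u : ℂ)) u := Complex.continuous_ofReal.continuousAt
    have c1 : ContinuousAt (fun u : ℝ => (u : ℂ) ^ p) u :=
      c0.cpow continuousAt_const (Complex.ofReal_mem_slitPlane.2 hu)
    have c2 : ContinuousAt (fun u : ℝ => (1 + (u : ℂ) / w) ^ q) u :=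
      (continuousAt_const.add (c0.div_const w)).cpow continuousAt_const (hslit w hw u hu)
    exact ((c0.neg.cexp.mul c1).mul c2).continuousWithinAt
  have hzb : z ∈ Metric.ball z (‖z‖ / 4) := Metric.mem_ball_self (by positivity)
  have hCpos : 1 ≤ C := by rw [hC]; have : 0 ≤ 2 / ‖z‖ := by positivity
                           linarith
  have hexpn : ∀ u : ℝ, ‖Complex.exp (-(u : ℂ))‖ = Real.exp (-(1 * u)) := fun u => by
    rw [Complex.norm_exp]; simp
  have key := hasDerivAt_integral_of_dominated_loc_of_deriv_le
    (μ := volume.restrict (Set.Ioi (0 : ℝ))) (x₀ := z) (s := Metric.ball z (‖z‖ / 4))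
    (F := fun w u => Complex.exp (-(u : ℂ)) * (u : ℂ) ^ p * (1 + (u : ℂ) / w) ^ d)
    (F' := fun w u => Complex.exp (-(u : ℂ)) * (u : ℂ) ^ p * (1 + (u : ℂ) / w) ^ (d - 1) *
      (d * (-(u : ℂ) / w ^ 2)))
    (bound := fun u => ((4 * C) ^ m * Real.exp (Real.pi * |(d - 1).im|) *
      (‖d‖ / (3 / 4 * ‖z‖) ^ 2)) * (Real.exp (-(1 * u)) * (1 + u) ^ (n + m + 1)))
    (Metric.ball_mem_nhds z (by positivity)) ?_ ?_ ?_ ?_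
    ((integrableOn_exp_mul_one_add_pow one_pos _).const_mul _) ?_
  · exact key.2.differentiableAt
  · filter_upwards [Metric.ball_mem_nhds z (by positivity : 0 < ‖z‖ / 4)] with w hw
    exact (hmeas w hw d).aestronglyMeasurable measurableSet_Ioi
  · refine Integrable.mono' (g := fun u => (4 * C) ^ m * Real.exp (Real.pi * |(d - 1).im|) * C *
      (Real.exp (-(1 * u)) * (1 + u) ^ (n + m + 1)))
      ((integrableOn_exp_mul_one_add_pow one_pos _).const_mul _)
      ((hmeas z hzb d).aestronglyMeasurable measurableSet_Ioi) ?_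
    filter_upwards [ae_restrict_mem measurableSet_Ioi] with u hu
    have hu : 0 < u := hu
    have hb0 := Complex.slitPlane_ne_zero (hslit z hzb u hu)
    have e : (1 + (u : ℂ) / z) ^ d = (1 + (u : ℂ) / z) ^ (d - 1) * (1 + (u : ℂ) / z) := by
      rw [Complex.cpow_sub _ _ hb0, Complex.cpow_one, div_mul_cancel₀ _ hb0]
    rw [e, norm_mul, norm_mul, norm_mul, hexpn]
    calc _ ≤ Real.exp (-(1 * u)) * (1 + u) ^ n * (((4 * (C * (1 + u))) ^ m *
          Real.exp (Real.pi * |(d - 1).im|)) * (C * (1 + u))) := by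
          gcongr
          · exact hub u hu
          · exact hcp z hzb u hu
          · exact hup z hzb u hu
      _ = _ := by rw [← mul_assoc 4 C, mul_pow (4 * C)]; ring
  · refine ContinuousOn.aestronglyMeasurable ((hmeas z hzb (d - 1)).mul ?_) measurableSet_Ioi
    exact Continuous.continuousOn (by fun_prop)
  · filter_upwards [ae_restrict_mem measurableSet_Ioi] with u hu w hw
    have hu : 0 < u := hu
    rw [norm_mul, norm_mul, norm_mul, hexpn, norm_mul, norm_div, norm_neg, Complex.norm_real,
      Real.norm_of_nonneg hu.le, norm_pow]
    calc _ ≤ Real.exp (-(1 * u)) * (1 + u) ^ n * ((4 * (C * (1 + u))) ^ m *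
          Real.exp (Real.pi * |(d - 1).im|)) * (‖d‖ * ((1 + u) / (3 / 4 * ‖z‖) ^ 2)) := by
          gcongr
          · exact hub u hu
          · exact hcp w hw u hu
          · linarith
          · exact (hw0 w hw).1
      _ = _ := by rw [← mul_assoc 4 C, mul_pow (4 * C)]; ring
  · filter_upwards [ae_restrict_mem measurableSet_Ioi] with u hu w hw
    have d1 : HasDerivAt (fun w : ℂ => 1 + (u : ℂ) / w) (-(u : ℂ) / w ^ 2) w := by
      have := ((hasDerivAt_inv (hne w hw)).const_mul (u : ℂ)).const_add 1
      refine this.congr_deriv ?_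
      ring
    refine ((d1.cpow_const (c := d) (hslit w hw u hu)).const_mul
      (Complex.exp (-(u : ℂ)) * (u : ℂ) ^ p)).congr_deriv ?_
    ring

end Outgoing


section LogDeriv

variable {ℓ : ℕ} {α : ℝ} {z ρ : ℂ}

theorem tricomiU_eq (ℓ : ℕ) (c w : ℂ) :
    tricomiU (ℓ + 1 + c) (2 * ℓ + 2) w =
      w ^ (-((ℓ : ℂ) + c + 1)) / Complex.Gamma ((ℓ : ℂ) + c + 1) *
        ∫ u in Set.Ioi (0 : ℝ), Complex.exp (-(u : ℂ)) * (u : ℂ) ^ ((ℓ : ℂ) + c) *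
          (1 + (u : ℂ) / w) ^ ((ℓ : ℂ) - c) := by
  unfold tricomiU
  rw [show (ℓ : ℂ) + 1 + c = ℓ + c + 1 by ring, show (ℓ : ℂ) + c + 1 - 1 = ℓ + c by ring,
    show (2 * ℓ + 2 : ℂ) - (ℓ + c + 1) - 1 = ℓ - c by ring]

theorem outgoingWave_of_re_nonneg (ℓ : ℕ) {η : ℂ} (h : 0 ≤ (Complex.I * η).re) (ρ : ℂ) :
    outgoingWave ℓ η ρ = Complex.exp (Complex.I * ρ) * ρ ^ (ℓ + 1) *
      tricomiU (ℓ + 1 + Complex.I * η) (2 * ℓ + 2) (-2 * Complex.I * ρ) := by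
  unfold outgoingWave
  simp only
  rw [if_pos h]

theorem I_mul_coulomb (α : ℝ) (hρ : ρ ≠ 0) :
    Complex.I * (α / ρ) = 2 * α / (-2 * Complex.I * ρ) := by
  have := Complex.I_ne_zero
  field_simp
  rw [Complex.I_sq]
  ring

theorem neg_two_I_mul_re (ρ : ℂ) : (-2 * Complex.I * ρ).re = 2 * ρ.im := by
  simp

theorem neg_two_I_mul_ne_zero (hρ : ρ ≠ 0) : -2 * Complex.I * ρ ≠ 0 :=
  mul_ne_zero (mul_ne_zero (by norm_num) Complex.I_ne_zero) hρ

/-- On the closed upper half plane the outgoing wave along a ray is a multiple of `wave`. -/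
theorem exists_outgoingWave_eq (ℓ : ℕ) (hα : 0 ≤ α) (hρ : ρ ≠ 0) (him : 0 ≤ ρ.im) :
    ∃ K : ℂ, K ≠ 0 ∧ ∀ r : ℝ, 0 < r →
      outgoingWave ℓ (α / ρ) (r * ρ) = K * wave ℓ α (-2 * Complex.I * ρ) r := by
  set z : ℂ := -2 * Complex.I * ρ with hzdef
  have hz : 0 ≤ z.re := by rw [hzdef, neg_two_I_mul_re]; positivity
  have hz0 : z ≠ 0 := neg_two_I_mul_ne_zero hρ
  have hc := I_mul_coulomb α hρ
  rw [← hzdef] at hc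
  have hcre := coulombExponent_re_nonneg hα hz
  have hre : 0 < ((ℓ : ℂ) + 2 * α / z + 1).re := by
    simp only [Complex.add_re, Complex.natCast_re, Complex.one_re]
    positivity
  refine ⟨ρ ^ (ℓ + 1) * (z ^ (-((ℓ : ℂ) + 2 * α / z + 1)) /
    Complex.Gamma ((ℓ : ℂ) + 2 * α / z + 1)), ?_, fun r hr => ?_⟩
  · refine mul_ne_zero (pow_ne_zero _ hρ) (div_ne_zero ?_ (Complex.Gamma_ne_zero_of_re_pos hre))
    rw [Complex.cpow_def_of_ne_zero hz0]
    exact Complex.exp_ne_zero _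
  · have hr0 : (r : ℂ) ≠ 0 := by exact_mod_cast hr.ne'
    rw [outgoingWave_of_re_nonneg ℓ (by rw [hc]; exact hcre), hc, tricomiU_eq,
      show -2 * Complex.I * (r * ρ) = r * z by rw [hzdef]; ring, integral_tricomi_eq hr,
      ofReal_mul_cpow hr hz0, Complex.cpow_neg (r : ℂ)]
    have hrp : (r : ℂ) ^ ((ℓ : ℂ) + 2 * α / z + 1) ≠ 0 := by
      rw [Complex.cpow_def_of_ne_zero hr0]
      exact Complex.exp_ne_zero _
    unfold wave waveFactor
    rw [show -(z * r / 2) = Complex.I * (r * ρ) by rw [hzdef]; ring, mul_pow]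
    generalize (r : ℂ) ^ ((ℓ : ℂ) + 2 * α / z + 1) = R at hrp ⊢
    field_simp

theorem differentiableAt_outgoingWave (ℓ : ℕ) (hα : 0 ≤ α) (hρ : ρ ≠ 0) (him : 0 ≤ ρ.im) :
    DifferentiableAt ℂ (outgoingWave ℓ (α / ρ)) ρ := by
  set z : ℂ := -2 * Complex.I * ρ with hzdef
  have hz : 0 ≤ z.re := by rw [hzdef, neg_two_I_mul_re]; positivity
  have hz0 : z ≠ 0 := neg_two_I_mul_ne_zero hρ
  have hc := I_mul_coulomb α hρ
  rw [← hzdef] at hc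
  have hcre := coulombExponent_re_nonneg hα hz
  have hslit : z ∈ Complex.slitPlane := by
    rw [Complex.mem_slitPlane_iff]
    rcases hz.lt_or_eq with h | h
    · exact Or.inl h
    · exact Or.inr fun h2 => hz0 (Complex.ext h.symm h2)
  have hint := differentiableAt_tricomi_integral hz hz0 (p := (ℓ : ℂ) + 2 * α / z)
    (d := (ℓ : ℂ) - 2 * α / z) (by
      simp only [Complex.add_re, Complex.natCast_re]; positivity)
  have hw : DifferentiableAt ℂ (fun w : ℂ => -2 * Complex.I * w) ρ := by fun_prop
  have e : outgoingWave ℓ (α / ρ) = fun w => Complex.exp (Complex.I * w) * w ^ (ℓ + 1) *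
      ((-2 * Complex.I * w) ^ (-((ℓ : ℂ) + 2 * α / z + 1)) /
        Complex.Gamma ((ℓ : ℂ) + 2 * α / z + 1) *
      ∫ u in Set.Ioi (0 : ℝ), Complex.exp (-(u : ℂ)) * (u : ℂ) ^ ((ℓ : ℂ) + 2 * α / z) *
          (1 + (u : ℂ) / (-2 * Complex.I * w)) ^ ((ℓ : ℂ) - 2 * α / z)) := by
    ext w
    rw [outgoingWave_of_re_nonneg ℓ (by rw [hc]; exact hcre), hc, tricomiU_eq]
  rw [e]
  have h1 : DifferentiableAt ℂ (fun w : ℂ => (-2 * Complex.I * w) ^ (-((ℓ : ℂ) + 2 * α / z + 1))) ρ :=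
    hw.cpow_const hslit
  have h2 := DifferentiableAt.comp (x := ρ) (f := fun w : ℂ => -2 * Complex.I * w) hint hw
  exact DifferentiableAt.mul (by fun_prop) ((h1.div_const _).mul h2)

theorem outgoingWave_ne_zero_iff (ℓ : ℕ) (hα : 0 ≤ α) (hρ : ρ ≠ 0) (him : 0 ≤ ρ.im) :
    outgoingWave ℓ (α / ρ) ρ ≠ 0 ↔ wave ℓ α (-2 * Complex.I * ρ) 1 ≠ 0 := by
  obtain ⟨K, hK, h⟩ := exists_outgoingWave_eq ℓ hα hρ him
  have h1 := h 1 one_pos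
  rw [Complex.ofReal_one, one_mul] at h1
  rw [h1, mul_ne_zero_iff]
  exact and_iff_right hK

theorem hasDerivAt_wave (hα : 0 ≤ α) (hz : 0 ≤ z.re) {r : ℝ} (hr : 0 < r) :
    HasDerivAt (wave ℓ α z) (wave' ℓ α z r) r := by
  have d0 : HasDerivAt (fun w : ℝ => (w : ℂ)) 1 r := Complex.ofRealCLM.hasDerivAt
  refine ((((d0.const_mul z).div_const 2).neg.cexp).mul
    (hasDerivAt_waveFactor hα hz hr)).congr_deriv ?_
  unfold wave'
  simp only [Pi.neg_apply]
  ring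

/-- On the closed upper half plane `L` is the radial logarithmic derivative of `wave` at the
channel radius. -/
theorem reducedLogDerivAux_eq (ℓ : ℕ) (hα : 0 ≤ α) (hρ : ρ ≠ 0) (him : 0 ≤ ρ.im) :
    reducedLogDerivAux ℓ α ρ =
      wave' ℓ α (-2 * Complex.I * ρ) 1 / wave ℓ α (-2 * Complex.I * ρ) 1 := by
  obtain ⟨K, hK, h⟩ := exists_outgoingWave_eq ℓ hα hρ him
  have h1 := h 1 one_pos
  rw [Complex.ofReal_one, one_mul] at h1
  have hz : 0 ≤ (-2 * Complex.I * ρ).re := by rw [neg_two_I_mul_re]; positivity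
  have hd : HasDerivAt (fun s : ℂ => outgoingWave ℓ (α / ρ) (s * ρ))
      (deriv (outgoingWave ℓ (α / ρ)) ρ * ρ) ((1 : ℝ) : ℂ) := by
    have e : HasDerivAt (outgoingWave ℓ (α / ρ)) (deriv (outgoingWave ℓ (α / ρ)) ρ)
        ((fun s : ℂ => s * ρ) ((1 : ℝ) : ℂ)) := by
      simpa using (differentiableAt_outgoingWave ℓ hα hρ him).hasDerivAt
    exact HasDerivAt.comp _ (h := fun s : ℂ => s * ρ) e (hasDerivAt_mul_const ρ)
  have hd2 := hd.comp_ofReal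
  have hd3 : HasDerivAt (fun r : ℝ => outgoingWave ℓ (α / ρ) (r * ρ))
      (K * wave' ℓ α (-2 * Complex.I * ρ) 1) 1 := by
    refine ((hasDerivAt_wave hα hz one_pos).const_mul K).congr_of_eventuallyEq ?_
    filter_upwards [Ioi_mem_nhds one_pos] with r hr using h r hr
  have e := hd2.unique hd3
  unfold reducedLogDerivAux
  rw [mul_comm ρ, e, h1, mul_div_mul_left _ _ hK]

/-! ### Complex conjugation and positivity on the imaginary axis -/

theorem laplace_conj (f : ℝ → ℂ) (r : ℝ) :
    laplace (fun y => (starRingEnd ℂ) (f y)) r = (starRingEnd ℂ) (laplace f r) := by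
  unfold laplace
  rw [← integral_conj]
  simp only [Complex.real_smul, map_mul, Complex.conj_ofReal]

theorem conj_two : (starRingEnd ℂ) 2 = 2 := map_ofNat _ 2

theorem waveDensity_conj (hz : 0 ≤ z.re) {y : ℝ} (hy : 0 < y) :
    waveDensity ℓ α ((starRingEnd ℂ) z) y = (starRingEnd ℂ) (waveDensity ℓ α z y) := by
  have hre := one_le_re_one_add_div hz hy.le
  have h1 : (1 + (y : ℂ) / z).arg ≠ Real.pi :=
    (Complex.mem_slitPlane_iff_arg.1 (Or.inl (by linarith))).1
  have h2 : (y : ℂ).arg ≠ Real.pi := by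
    rw [Complex.arg_ofReal_of_nonneg hy.le]; exact Real.pi_pos.ne
  have e1 : (ℓ : ℂ) + 2 * α / (starRingEnd ℂ) z = (starRingEnd ℂ) (ℓ + 2 * α / z) := by
    simp [conj_two]
  have e2 : (ℓ : ℂ) - 2 * α / (starRingEnd ℂ) z = (starRingEnd ℂ) (ℓ - 2 * α / z) := by
    simp [conj_two]
  have e3 : 1 + (y : ℂ) / (starRingEnd ℂ) z = (starRingEnd ℂ) (1 + y / z) := by simp
  unfold waveDensity
  rw [e1, e2, e3, map_mul, Complex.cpow_conj _ _ h2, Complex.conj_ofReal,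
    Complex.conj_cpow _ _ h1, Complex.conj_conj]

theorem laplace_waveDensity_conj (hz : 0 ≤ z.re) (r : ℝ) :
    laplace (waveDensity ℓ α ((starRingEnd ℂ) z)) r
      = (starRingEnd ℂ) (laplace (waveDensity ℓ α z) r) ∧
    laplace (fun y => y • waveDensity ℓ α ((starRingEnd ℂ) z) y) r
      = (starRingEnd ℂ) (laplace (fun y => y • waveDensity ℓ α z y) r) := by
  rw [← laplace_conj, ← laplace_conj]
  constructor <;> refine laplace_congr (fun y hy => ?_) r
  · exact waveDensity_conj hz hy
  · rw [waveDensity_conj hz hy]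
    simp only [Complex.real_smul, map_mul, Complex.conj_ofReal]

theorem wave_conj (hz : 0 ≤ z.re) (r : ℝ) :
    wave ℓ α ((starRingEnd ℂ) z) r = (starRingEnd ℂ) (wave ℓ α z r) ∧
    wave' ℓ α ((starRingEnd ℂ) z) r = (starRingEnd ℂ) (wave' ℓ α z r) := by
  obtain ⟨h1, h2⟩ := laplace_waveDensity_conj (ℓ := ℓ) (α := α) hz r
  have e : Complex.exp (-((starRingEnd ℂ) z * r / 2))
      = (starRingEnd ℂ) (Complex.exp (-(z * r / 2))) := by
    rw [← Complex.exp_conj]; simp [conj_two]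
  unfold wave wave' waveFactor waveFactor'
  rw [h1, h2, e]
  constructor <;> simp [conj_two]

theorem waveDensity_ofReal {κ : ℝ} (hκ : 0 < κ) {y : ℝ} (hy : 0 < y) :
    waveDensity ℓ α ((2 * κ : ℝ) : ℂ) y =
      ((y ^ ((ℓ : ℝ) + 2 * α / (2 * κ)) *
        (1 + y / (2 * κ)) ^ ((ℓ : ℝ) - 2 * α / (2 * κ)) : ℝ) : ℂ) := by
  unfold waveDensity
  rw [Complex.ofReal_mul (_ ^ _), Complex.ofReal_cpow hy.le, Complex.ofReal_cpow (by positivity)]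
  push_cast
  rfl

theorem wave_eq_ofReal (hα : 0 ≤ α) {κ : ℝ} (hκ : 0 < κ) {r : ℝ} (hr : 0 < r) :
    ∃ x : ℝ, 0 < x ∧ wave ℓ α ((2 * κ : ℝ) : ℂ) r = x := by
  set g : ℝ → ℝ := fun y => y ^ ((ℓ : ℝ) + 2 * α / (2 * κ)) *
    (1 + y / (2 * κ)) ^ ((ℓ : ℝ) - 2 * α / (2 * κ)) with hg
  have hgpos : ∀ y > 0, 0 < g y := fun y hy => by
    have : 0 < 1 + y / (2 * κ) := by positivity
    exact mul_pos (Real.rpow_pos_of_pos hy _) (Real.rpow_pos_of_pos this _)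
  have hre : 0 ≤ ((2 * κ : ℝ) : ℂ).re := by simp only [Complex.ofReal_re]; positivity
  have hint := (polyBounded_waveDensity (ℓ := ℓ) hα hre).integrableOn hr
  have e : laplace (waveDensity ℓ α ((2 * κ : ℝ) : ℂ)) r = ((laplace g r : ℝ) : ℂ) := by
    rw [laplace_congr (g := fun y => ((g y : ℝ) : ℂ)) (fun y hy => waveDensity_ofReal hκ hy)]
    unfold laplace
    rw [← integral_complex_ofReal]
    simp
  have hgint : IntegrableOn (fun y => Real.exp (-(r * y)) • g y) (Set.Ioi 0) := by
    refine IntegrableOn.congr_fun hint.re (fun y hy => ?_) measurableSet_Ioi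
    simp only [waveDensity_ofReal hκ hy, Complex.real_smul, ← Complex.ofReal_mul]
    exact Complex.ofReal_re _
  have hpos : 0 < laplace g r := by
    unfold laplace
    rw [setIntegral_pos_iff_support_of_nonneg_ae ?_ hgint]
    · have : Set.Ioi (0 : ℝ) ⊆ (Function.support fun y => Real.exp (-(r * y)) • g y) ∩ Set.Ioi 0 := by
        intro y hy
        refine ⟨?_, hy⟩
        exact (mul_pos (Real.exp_pos _) (hgpos y hy)).ne'
      refine lt_of_lt_of_le ?_ (measure_mono this)
      simp
    · filter_upwards [ae_restrict_mem measurableSet_Ioi] with y hy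
      exact (mul_pos (Real.exp_pos _) (hgpos y hy)).le
  refine ⟨Real.exp (-(2 * κ * r / 2)) * (r ^ (ℓ + 1) * laplace g r), by positivity, ?_⟩
  unfold wave waveFactor
  rw [e]
  push_cast
  ring

/-- On the positive imaginary axis the outgoing wave is a positive decaying solution. -/
theorem isDecaying_wave (ℓ : ℕ) (hα : 0 ≤ α) {κ : ℝ} (hκ : 0 < κ) :
    IsDecaying (ℓ * (ℓ + 1)) α κ (fun r => (wave ℓ α ((2 * κ : ℝ) : ℂ) r).re)
      (fun r => (wave' ℓ α ((2 * κ : ℝ) : ℂ) r).re) := by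
  set z : ℂ := ((2 * κ : ℝ) : ℂ) with hzdef
  have hz : 0 ≤ z.re := by simp only [hzdef, Complex.ofReal_re]; positivity
  have hz0 : z ≠ 0 := by rw [hzdef]; exact_mod_cast (by positivity : 2 * κ ≠ 0)
  have hrad := isRadialSolution_wave (ℓ := ℓ) hα hz hz0 (ε := -κ ^ 2) (by
    rw [hzdef]; push_cast; ring)
  obtain ⟨C, hC⟩ := exists_waveFactor_bounds ℓ hα hz
  have hexp : Tendsto (fun r : ℝ => Complex.exp (-(z * r / 2))) atTop (𝓝 0) := by
    rw [tendsto_zero_iff_norm_tendsto_zero]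
    have : Tendsto (fun r : ℝ => Real.exp (-(r * κ))) atTop (𝓝 0) :=
      Real.tendsto_exp_neg_atTop_nhds_zero.comp (tendsto_id.atTop_mul_const hκ)
    refine this.congr fun r => ?_
    rw [show -(z * r / 2) = ((-(r * κ) : ℝ) : ℂ) by rw [hzdef]; push_cast; ring,
      Complex.norm_exp_ofReal]
  have hb : IsBoundedUnder (· ≤ ·) atTop (norm ∘ waveFactor ℓ α z) := by
    refine ⟨C, ?_⟩
    rw [eventually_map]
    filter_upwards [eventually_ge_atTop 1] with r hr using (hC r hr).1
  have hu : Tendsto (wave ℓ α z) atTop (𝓝 0) := hexp.zero_mul_isBoundedUnder_le hb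
  have hu' : Tendsto (wave' ℓ α z) atTop (𝓝 0) := by
    have h1 := (hexp.mul (tendsto_waveFactor' (ℓ := ℓ) hα hz)).sub (hu.const_mul (z / 2))
    simp only [mul_zero, sub_zero] at h1
    refine h1.congr fun r => ?_
    unfold wave' wave
    ring
  refine ⟨fun r hr => ?_, fun r hr => ?_, fun r hr => ?_, ?_, ?_⟩
  · exact Complex.reCLM.hasFDerivAt.comp_hasDerivAt r (hrad.hasDerivAt r hr)
  · refine (Complex.reCLM.hasFDerivAt.comp_hasDerivAt r (hrad.hasDerivAt' r hr)).congr_deriv ?_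
    simp only [Complex.reCLM_apply, Complex.re_ofReal_mul]
    ring
  · obtain ⟨x, hx, e⟩ := wave_eq_ofReal (ℓ := ℓ) hα hκ hr
    simp only [hzdef, e, Complex.ofReal_re]
    exact hx
  · rw [← Complex.zero_re]
    exact (Complex.continuous_re.tendsto _).comp hu
  · rw [← Complex.zero_re]
    exact (Complex.continuous_re.tendsto _).comp hu'

/-- The logarithmic derivative is real on the positive imaginary axis. -/
theorem wave_logDeriv_ofReal (ℓ : ℕ) (hα : 0 ≤ α) {κ : ℝ} (hκ : 0 < κ) :
    wave' ℓ α ((2 * κ : ℝ) : ℂ) 1 / wave ℓ α ((2 * κ : ℝ) : ℂ) 1 =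
      (((wave' ℓ α ((2 * κ : ℝ) : ℂ) 1).re / (wave ℓ α ((2 * κ : ℝ) : ℂ) 1).re : ℝ) : ℂ) := by
  have hz : 0 ≤ ((2 * κ : ℝ) : ℂ).re := by simp only [Complex.ofReal_re]; positivity
  have hre : ∀ r > 0, wave ℓ α ((2 * κ : ℝ) : ℂ) r = ((wave ℓ α ((2 * κ : ℝ) : ℂ) r).re : ℂ) := by
    intro r hr
    obtain ⟨x, -, e⟩ := wave_eq_ofReal (ℓ := ℓ) hα hκ hr
    rw [e, Complex.ofReal_re]
  have d1 := hasDerivAt_wave (ℓ := ℓ) hα hz one_pos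
  have d2 : HasDerivAt (fun r => ((wave ℓ α ((2 * κ : ℝ) : ℂ) r).re : ℂ))
      ((wave' ℓ α ((2 * κ : ℝ) : ℂ) 1).re : ℂ) 1 :=
    ((isDecaying_wave ℓ hα hκ).hasDerivAt 1 one_pos).ofReal_comp
  have d3 := d2.congr_of_eventuallyEq (f₁ := wave ℓ α ((2 * κ : ℝ) : ℂ)) (by
    filter_upwards [Ioi_mem_nhds one_pos] with r hr using hre r hr)
  rw [Complex.ofReal_div, ← hre 1 one_pos, ← d1.unique d3]

end LogDeriv


/-! ### The shift function on the physical sheet -/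

section Shift

variable {ℓ : ℕ} {α : ℝ}

theorem continuousAt_laplace_waveDensity (hα : 0 ≤ α) (j : ℕ) {k₀ : ℝ} (hk₀ : 0 < k₀) :
    ContinuousAt (fun k : ℝ =>
      laplace (fun y => y ^ j • waveDensity ℓ α (-2 * Complex.I * k) y) 1) k₀ := by
  obtain ⟨n, hn⟩ := exists_nat_ge (max (1 / k₀) (2 * α / k₀))
  have hz : ∀ k : ℝ, 0 ≤ (-2 * Complex.I * k).re := fun k => by simp
  unfold laplace
  refine continuousAt_of_dominated (bound := fun y => ((1 + n) ^ ℓ * Real.exp (Real.pi * n)) *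
    (Real.exp (-(1 * y)) * (1 + y) ^ (j + (ℓ + (n + ℓ))))) ?_ ?_
    ((integrableOn_exp_mul_one_add_pow one_pos _).const_mul _) ?_
  · refine Eventually.of_forall fun k => ?_
    have m1 : Continuous fun y : ℝ => Real.exp (-(1 * y)) := by fun_prop
    have m2 : Continuous fun y : ℝ => y ^ j := by fun_prop
    exact m1.aestronglyMeasurable.smul
      (m2.aestronglyMeasurable.smul (polyBounded_waveDensity hα (hz k)).meas)
  · filter_upwards [Ioi_mem_nhds (half_lt_self hk₀)] with k hk
    have hk : k₀ / 2 < k := hk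
    have hk0 : 0 < k := by linarith
    filter_upwards [ae_restrict_mem measurableSet_Ioi] with y hy
    have hy : 0 < y := hy
    have hzn : ‖(-2 * Complex.I * k : ℂ)‖ = 2 * k := by
      rw [norm_mul, norm_mul, norm_neg, Complex.norm_I, Complex.norm_real,
        Real.norm_of_nonneg hk0.le]
      simp
    have h1 : ‖(-2 * Complex.I * k : ℂ)⁻¹‖ ≤ n := by
      refine le_trans ?_ ((le_max_left _ _).trans hn)
      rw [norm_inv, hzn, ← one_div]
      exact one_div_le_one_div_of_le hk₀ (by linarith)
    have h2 : ‖(2 * α / (-2 * Complex.I * k) : ℂ)‖ ≤ n := by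
      refine le_trans ?_ ((le_max_right _ _).trans hn)
      rw [norm_div, hzn, norm_mul, Complex.norm_real, Real.norm_of_nonneg hα]
      simp only [Complex.norm_ofNat]
      exact div_le_div_of_nonneg_left (by positivity) hk₀ (by linarith)
    have h3 := norm_waveDensity_le (ℓ := ℓ) hα (hz k) h1 h2 hy
    rw [norm_smul, norm_smul, Real.norm_of_nonneg (Real.exp_pos _).le,
      Real.norm_of_nonneg (by positivity)]
    have e1 : y ^ j ≤ (1 + y) ^ j := by gcongr; linarith
    have e2 : y ^ ℓ ≤ (1 + y) ^ ℓ := by gcongr; linarith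
    calc _ ≤ Real.exp (-(1 * y)) * ((1 + y) ^ j * (((1 + n) ^ ℓ * Real.exp (Real.pi * n)) *
          ((1 + y) ^ ℓ * (1 + y) ^ (n + ℓ)))) := by
          gcongr
          exact h3.trans (by gcongr)
      _ = _ := by rw [pow_add (1 + y) j, pow_add (1 + y) ℓ]; ring
  · filter_upwards [ae_restrict_mem measurableSet_Ioi] with y hy
    have hy : 0 < y := hy
    have hk0 : (-2 * Complex.I * k₀ : ℂ) ≠ 0 :=
      neg_two_I_mul_ne_zero (by exact_mod_cast hk₀.ne')
    have c0 : ContinuousAt (fun k : ℝ => (-2 * Complex.I * k : ℂ)) k₀ :=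
      (continuous_const.mul Complex.continuous_ofReal).continuousAt
    have c1 : ContinuousAt (fun k : ℝ => (y : ℂ) ^ ((ℓ : ℂ) + 2 * α / (-2 * Complex.I * k))) k₀ :=
      ContinuousAt.cpow continuousAt_const
        (continuousAt_const.add (continuousAt_const.div c0 hk0)) (Complex.ofReal_mem_slitPlane.2 hy)
    have c2 : ContinuousAt (fun k : ℝ => (1 + (y : ℂ) / (-2 * Complex.I * k)) ^
        ((ℓ : ℂ) - 2 * α / (-2 * Complex.I * k))) k₀ :=
      ContinuousAt.cpow (continuousAt_const.add (continuousAt_const.div c0 hk0))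
        (continuousAt_const.sub (continuousAt_const.div c0 hk0))
        (Or.inl (by linarith [one_le_re_one_add_div (hz k₀) hy.le]))
    exact ((c1.mul c2).const_smul (y ^ j)).const_smul (Real.exp (-(1 * y)))

/-- The shift function at real `ρ = k > 0`. -/
noncomputable def shiftAbove (ℓ : ℕ) (α k : ℝ) : ℝ :=
  (wave' ℓ α (-2 * Complex.I * k) 1 / wave ℓ α (-2 * Complex.I * k) 1).re

/-- The shift function at imaginary `ρ = i κ`, `κ > 0`. -/
noncomputable def shiftBelow (ℓ : ℕ) (α κ : ℝ) : ℝ :=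
  (wave' ℓ α ((2 * κ : ℝ) : ℂ) 1).re / (wave ℓ α ((2 * κ : ℝ) : ℂ) 1).re

theorem wave_ne_zero (ℓ : ℕ) (hα : 0 ≤ α) {k : ℝ} (hk : 0 < k) :
    wave ℓ α (-2 * Complex.I * k) 1 ≠ 0 :=
  (isOutgoing_wave hα hk).ne_zero (by positivity) hα hk one_pos

theorem continuousAt_shiftAbove (ℓ : ℕ) (hα : 0 ≤ α) {k₀ : ℝ} (hk₀ : 0 < k₀) :
    ContinuousAt (shiftAbove ℓ α) k₀ := by
  have h0 := continuousAt_laplace_waveDensity (ℓ := ℓ) hα 0 hk₀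
  have h1 := continuousAt_laplace_waveDensity (ℓ := ℓ) hα 1 hk₀
  simp only [pow_zero, one_smul, pow_one] at h0 h1
  have hne := wave_ne_zero ℓ hα hk₀
  unfold shiftAbove
  refine Complex.continuous_re.continuousAt.comp (ContinuousAt.div ?_ ?_ hne)
  · unfold wave' waveFactor' waveFactor
    fun_prop
  · unfold wave waveFactor
    fun_prop

theorem monotoneOn_shiftAbove (ℓ : ℕ) (hα : 0 ≤ α) : MonotoneOn (shiftAbove ℓ α) (Set.Ioi 0) :=
  fun _ h₁ _ h₂ h => IsOutgoing.re_logDeriv_le (by positivity) hα h₁ h (isOutgoing_wave hα h₁)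
    (isOutgoing_wave hα h₂) one_pos

theorem antitoneOn_shiftBelow (ℓ : ℕ) (hα : 0 ≤ α) : AntitoneOn (shiftBelow ℓ α) (Set.Ioi 0) :=
  fun _ h₁ _ h₂ h => IsDecaying.logDeriv_le (le_of_lt h₁) h (isDecaying_wave ℓ hα h₁)
    (isDecaying_wave ℓ hα h₂) one_pos

theorem shiftBelow_nonpos (ℓ : ℕ) (hα : 0 ≤ α) {κ : ℝ} (hκ : 0 < κ) : shiftBelow ℓ α κ ≤ 0 := by
  have h := isDecaying_wave ℓ hα hκ
  have h1 := h.deriv_le (by positivity) hα hκ.le one_pos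
  have h2 := h.pos 1 one_pos
  refine div_nonpos_of_nonpos_of_nonneg (h1.trans ?_) h2.le
  nlinarith

theorem continuousAt_shiftBelow (ℓ : ℕ) (hα : 0 ≤ α) {κ₀ : ℝ} (hκ₀ : 0 < κ₀) :
    ContinuousAt (shiftBelow ℓ α) κ₀ := by
  have hlim : Tendsto (fun κ : ℝ => |κ₀ ^ 2 - κ ^ 2| / κ₀) (𝓝 κ₀) (𝓝 0) := by
    have : ContinuousAt (fun κ : ℝ => |κ₀ ^ 2 - κ ^ 2| / κ₀) κ₀ := by fun_prop
    simpa [ContinuousAt] using this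
  rw [ContinuousAt, tendsto_iff_dist_tendsto_zero]
  refine squeeze_zero' (Eventually.of_forall fun _ => dist_nonneg) ?_ hlim
  filter_upwards [Ioi_mem_nhds hκ₀] with κ hκ
  rw [Real.dist_eq]
  exact IsDecaying.abs_logDeriv_sub_le (by positivity) hα hκ₀ hκ (isDecaying_wave ℓ hα hκ₀)
    (isDecaying_wave ℓ hα hκ) one_pos

/-- The shift functions at `ρ = k` and `ρ = i k` have the same limit as `k → 0`, so that the
shift function is continuous across the threshold. -/
theorem abs_shiftAbove_sub_shiftBelow_le (ℓ : ℕ) (hα : 0 ≤ α) {k : ℝ} (hk : 0 < k) :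
    |shiftAbove ℓ α k - shiftBelow ℓ α k| ≤ 2 * k := by
  have h := IsDecaying.norm_logDeriv_sub_outgoing_le (by positivity) hα hk
    (isDecaying_wave ℓ hα hk) (isOutgoing_wave (ℓ := ℓ) hα hk) one_pos
  refine le_trans ?_ h
  have := Complex.abs_re_le_norm (wave' ℓ α (-2 * Complex.I * k) 1 /
    wave ℓ α (-2 * Complex.I * k) 1 - ((shiftBelow ℓ α k : ℝ) : ℂ))
  rw [Complex.sub_re, Complex.ofReal_re] at this
  exact this

/-- The shift function at the threshold: the supremum of its values below the threshold, which is
their limit because `shiftBelow` is antitone in `κ`. -/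
noncomputable def shiftZero (ℓ : ℕ) (α : ℝ) : ℝ := sSup (shiftBelow ℓ α '' Set.Ioi 0)

theorem tendsto_shiftBelow (ℓ : ℕ) (hα : 0 ≤ α) :
    Tendsto (shiftBelow ℓ α) (𝓝[>] 0) (𝓝 (shiftZero ℓ α)) := by
  refine (antitoneOn_shiftBelow ℓ hα).tendsto_nhdsGT ⟨0, ?_⟩
  rintro _ ⟨κ, hκ, rfl⟩
  exact shiftBelow_nonpos ℓ hα hκ

theorem shiftBelow_le_shiftZero (ℓ : ℕ) (hα : 0 ≤ α) {κ : ℝ} (hκ : 0 < κ) :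
    shiftBelow ℓ α κ ≤ shiftZero ℓ α := by
  refine le_csSup ⟨0, ?_⟩ (Set.mem_image_of_mem _ hκ)
  rintro _ ⟨κ, hκ, rfl⟩
  exact shiftBelow_nonpos ℓ hα hκ

theorem tendsto_shiftAbove (ℓ : ℕ) (hα : 0 ≤ α) :
    Tendsto (shiftAbove ℓ α) (𝓝[>] 0) (𝓝 (shiftZero ℓ α)) := by
  have h2 : Tendsto (fun k => shiftAbove ℓ α k - shiftBelow ℓ α k) (𝓝[>] 0) (𝓝 0) := by
    have hlim : Tendsto (fun k : ℝ => 2 * k) (𝓝[>] 0) (𝓝 0) := by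
      have : Tendsto (fun k : ℝ => 2 * k) (𝓝 0) (𝓝 (2 * 0)) := by
        exact (continuous_const.mul continuous_id).tendsto 0
      rw [mul_zero] at this
      exact this.mono_left nhdsWithin_le_nhds
    refine squeeze_zero_norm' ?_ hlim
    filter_upwards [self_mem_nhdsWithin] with k hk
    exact abs_shiftAbove_sub_shiftBelow_le ℓ hα hk
  simpa using h2.add (tendsto_shiftBelow ℓ hα)

theorem shiftZero_le_shiftAbove (ℓ : ℕ) (hα : 0 ≤ α) {k : ℝ} (hk : 0 < k) :
    shiftZero ℓ α ≤ shiftAbove ℓ α k := by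
  refine le_of_tendsto (tendsto_shiftAbove ℓ hα) ?_
  filter_upwards [self_mem_nhdsWithin, nhdsWithin_le_nhds (Iio_mem_nhds hk)] with t ht ht2
  exact monotoneOn_shiftAbove ℓ hα ht hk (le_of_lt ht2)

/-- The shift function on the physical sheet as a function of `ε = ρ²`. -/
noncomputable def physicalShift (ℓ : ℕ) (α ε : ℝ) : ℝ :=
  if ε < 0 then shiftBelow ℓ α (Real.sqrt (-ε))
  else if ε = 0 then shiftZero ℓ α else shiftAbove ℓ α (Real.sqrt ε)

theorem physicalShift_of_neg {ε : ℝ} (h : ε < 0) :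
    physicalShift ℓ α ε = shiftBelow ℓ α (Real.sqrt (-ε)) := if_pos h

theorem physicalShift_zero : physicalShift ℓ α 0 = shiftZero ℓ α := by
  simp [physicalShift]

theorem physicalShift_of_pos {ε : ℝ} (h : 0 < ε) :
    physicalShift ℓ α ε = shiftAbove ℓ α (Real.sqrt ε) := by
  rw [physicalShift, if_neg h.not_gt, if_neg h.ne']

theorem monotone_physicalShift (ℓ : ℕ) (hα : 0 ≤ α) : Monotone (physicalShift ℓ α) := by
  have hneg : ∀ ε < 0, physicalShift ℓ α ε ≤ shiftZero ℓ α := fun ε h => by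
    rw [physicalShift_of_neg h]
    exact shiftBelow_le_shiftZero ℓ hα (Real.sqrt_pos.2 (by linarith))
  have hpos : ∀ ε > 0, shiftZero ℓ α ≤ physicalShift ℓ α ε := fun ε h => by
    rw [physicalShift_of_pos h]
    exact shiftZero_le_shiftAbove ℓ hα (Real.sqrt_pos.2 h)
  intro ε₁ ε₂ h
  rcases lt_trichotomy ε₁ 0 with h1 | h1 | h1
  · rcases lt_trichotomy ε₂ 0 with h2 | h2 | h2
    · rw [physicalShift_of_neg h1, physicalShift_of_neg h2]
      exact antitoneOn_shiftBelow ℓ hα (Real.sqrt_pos.2 (by linarith))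
        (Real.sqrt_pos.2 (by linarith)) (Real.sqrt_le_sqrt (by linarith))
    · rw [h2, physicalShift_zero]
      exact hneg ε₁ h1
    · exact (hneg ε₁ h1).trans (hpos ε₂ h2)
  · rcases (h1 ▸ h).lt_or_eq with h2 | h2
    · rw [h1, physicalShift_zero]
      exact hpos ε₂ h2
    · rw [h1, h2]
  · have h2 := h1.trans_le h
    rw [physicalShift_of_pos h1, physicalShift_of_pos h2]
    exact monotoneOn_shiftAbove ℓ hα (Real.sqrt_pos.2 h1) (Real.sqrt_pos.2 h2)
      (Real.sqrt_le_sqrt h)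

theorem continuous_physicalShift (ℓ : ℕ) (hα : 0 ≤ α) : Continuous (physicalShift ℓ α) := by
  rw [continuous_iff_continuousAt]
  intro ε
  rcases lt_trichotomy ε 0 with h | h | h
  · have h1 : ContinuousAt (fun ε => shiftBelow ℓ α (Real.sqrt (-ε))) ε := by
      refine ContinuousAt.comp (g := shiftBelow ℓ α) (continuousAt_shiftBelow ℓ hα
        (Real.sqrt_pos.2 (by linarith))) ?_
      fun_prop
    refine h1.congr ?_
    filter_upwards [Iio_mem_nhds h] with t ht using (physicalShift_of_neg ht).symm
  · subst h
    have hs : Tendsto Real.sqrt (𝓝[>] 0) (𝓝[>] 0) := by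
      refine tendsto_nhdsWithin_iff.2 ⟨?_, ?_⟩
      · have := Real.continuous_sqrt.tendsto 0
        rw [Real.sqrt_zero] at this
        exact this.mono_left nhdsWithin_le_nhds
      · filter_upwards [self_mem_nhdsWithin] with t ht using Real.sqrt_pos.2 ht
    rw [continuousAt_iff_continuous_left'_right', ContinuousWithinAt, ContinuousWithinAt,
      physicalShift_zero]
    constructor
    · have hn : Tendsto (fun t : ℝ => -t) (𝓝[<] 0) (𝓝[>] 0) := by
        have := tendsto_neg_nhdsLT (a := (0 : ℝ))
        rwa [neg_zero] at this
      refine ((tendsto_shiftBelow ℓ hα).comp (hs.comp hn)).congr' ?_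
      filter_upwards [self_mem_nhdsWithin] with t ht using (physicalShift_of_neg ht).symm
    · refine ((tendsto_shiftAbove ℓ hα).comp hs).congr' ?_
      filter_upwards [self_mem_nhdsWithin] with t ht using (physicalShift_of_pos ht).symm
  · have h1 : ContinuousAt (fun ε => shiftAbove ℓ α (Real.sqrt ε)) ε := by
      refine ContinuousAt.comp (g := shiftAbove ℓ α) (continuousAt_shiftAbove ℓ hα
        (Real.sqrt_pos.2 h)) ?_
      fun_prop
    refine h1.congr ?_
    filter_upwards [Ioi_mem_nhds h] with t ht using (physicalShift_of_pos ht).symm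

theorem neg_two_I_mul_I (κ : ℝ) : -2 * Complex.I * (Complex.I * κ) = ((2 * κ : ℝ) : ℂ) := by
  push_cast
  linear_combination (-2 * (κ : ℂ)) * Complex.I_sq

theorem reducedLogDerivAux_I_mul (ℓ : ℕ) (hα : 0 ≤ α) {κ : ℝ} (hκ : 0 < κ) :
    reducedLogDerivAux ℓ α (Complex.I * κ) = ((shiftBelow ℓ α κ : ℝ) : ℂ) := by
  rw [reducedLogDerivAux_eq ℓ hα
    (mul_ne_zero Complex.I_ne_zero (by exact_mod_cast hκ.ne')) (by simpa using hκ.le),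
    neg_two_I_mul_I, wave_logDeriv_ofReal ℓ hα hκ]
  rfl

theorem reducedLogDeriv_zero (ℓ : ℕ) (hα : 0 ≤ α) :
    reducedLogDeriv ℓ α 0 = ((shiftZero ℓ α : ℝ) : ℂ) := by
  rw [reducedLogDeriv, if_pos rfl]
  refine Tendsto.limUnder_eq ?_
  refine ((Complex.continuous_ofReal.tendsto _).comp (tendsto_shiftBelow ℓ hα)).congr' ?_
  filter_upwards [self_mem_nhdsWithin] with κ hκ using (reducedLogDerivAux_I_mul ℓ hα hκ).symm

theorem outgoingWave_I_mul_ne_zero (ℓ : ℕ) (hα : 0 ≤ α) {κ : ℝ} (hκ : 0 < κ) :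
    outgoingWave ℓ (α / (Complex.I * κ)) (Complex.I * κ) ≠ 0 := by
  rw [outgoingWave_ne_zero_iff ℓ hα
    (mul_ne_zero Complex.I_ne_zero (by exact_mod_cast hκ.ne')) (by simpa using hκ.le),
    neg_two_I_mul_I]
  obtain ⟨x, hx, e⟩ := wave_eq_ofReal (ℓ := ℓ) hα hκ one_pos
  rw [e]
  exact_mod_cast hx.ne'

/-- Above the threshold the two sheets of a channel carry complex conjugate waves. -/
theorem wave_sign (hα : 0 ≤ α) {k : ℝ} (hk : 0 < k) (σ : ℤˣ) :
    outgoingWave ℓ (α / ((σ : ℤ) * k)) ((σ : ℤ) * k) ≠ 0 ∧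
      (reducedLogDeriv ℓ α ((σ : ℤ) * k)).re = shiftAbove ℓ α k := by
  have hk0 : (k : ℂ) ≠ 0 := by exact_mod_cast hk.ne'
  have hρ : (((σ : ℤ) : ℂ) * k) ≠ 0 := mul_ne_zero (by exact_mod_cast σ.ne_zero) hk0
  have him : (((σ : ℤ) : ℂ) * k).im = 0 := by
    have : (((σ : ℤ) : ℂ) * k) = ((((σ : ℤ) : ℝ) * k : ℝ) : ℂ) := by push_cast; rfl
    rw [this, Complex.ofReal_im]
  have hw := wave_ne_zero ℓ hα hk
  rw [outgoingWave_ne_zero_iff ℓ hα hρ him.ge, reducedLogDeriv, if_neg hρ,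
    reducedLogDerivAux_eq ℓ hα hρ him.ge]
  rcases Int.units_eq_one_or σ with h | h
  · subst h
    simp only [Units.val_one, Int.cast_one, one_mul]
    exact ⟨hw, rfl⟩
  · subst h
    have hz : -2 * Complex.I * ((((-1 : ℤˣ) : ℤ) : ℂ) * k)
        = (starRingEnd ℂ) (-2 * Complex.I * k) := by
      simp [conj_two]
    obtain ⟨e1, e2⟩ := wave_conj (ℓ := ℓ) (α := α) (z := -2 * Complex.I * k) (by simp) 1
    rw [hz, e1, e2, ← map_div₀, Complex.conj_re]
    exact ⟨(map_ne_zero _).2 hw, rfl⟩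

end Shift


/-! ### Channels at real energies -/

namespace Channel

variable (u : Constants) (ch : Channel)

theorem mass_pos : 0 < ch.mass :=
  div_pos (mul_pos ch.m₁_pos ch.m₂_pos) (add_pos ch.m₁_pos ch.m₂_pos)

theorem rho0_pos : 0 < ch.rho0 u := by
  have := ch.mass_pos
  have := u.hbar_pos
  exact mul_pos ch.radius_pos (Real.sqrt_pos.2 (by positivity))

theorem coulomb_nonneg : 0 ≤ ch.coulomb u := by
  have := ch.mass_pos
  have := u.hbar_pos
  have := u.esq_pos
  have := ch.radius_pos
  unfold coulomb
  positivity

theorem IsNeutral.coulomb_eq_zero {ch : Channel} (h : ch.IsNeutral) : ch.coulomb u = 0 := by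
  have h' : (ch.Z₁ : ℝ) * ch.Z₂ = 0 := by exact_mod_cast h
  simp [coulomb, h']

theorem rho_of_lt (s : ℤˣ) {E : ℝ} (h : E < ch.threshold) :
    ch.rho u s E =
      ((s : ℤ) : ℂ) * (Complex.I * ((ch.rho0 u * Real.sqrt (ch.threshold - E) : ℝ) : ℂ)) := by
  have e : (E : ℂ) - ch.threshold = ((E - ch.threshold : ℝ) : ℂ) := by push_cast; rfl
  rw [rho, e, Complex.ofReal_cpow_of_nonpos (by linarith), Real.sqrt_eq_rpow, Complex.ofReal_mul,
    Complex.ofReal_cpow (by linarith)]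
  have hI : Complex.exp (Real.pi * Complex.I * (1 / 2 : ℂ)) = Complex.I := by
    rw [show (Real.pi * Complex.I * (1 / 2 : ℂ)) = Real.pi / 2 * Complex.I by ring,
      Complex.exp_pi_div_two_mul_I]
  rw [hI]
  push_cast
  rw [neg_sub]
  ring

theorem rho_threshold (s : ℤˣ) : ch.rho u s ch.threshold = 0 := by
  simp [rho]

theorem rho_of_gt (s : ℤˣ) {E : ℝ} (h : ch.threshold < E) :
    ch.rho u s E = ((s : ℤ) : ℂ) * ((ch.rho0 u * Real.sqrt (E - ch.threshold) : ℝ) : ℂ) := by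
  have e : (E : ℂ) - ch.threshold = ((E - ch.threshold : ℝ) : ℂ) := by push_cast; rfl
  rw [rho, e, Real.sqrt_eq_rpow, Complex.ofReal_mul, Complex.ofReal_cpow (by linarith)]
  push_cast
  ring

theorem shift_rho_one (E : ℝ) :
    ch.shift u (ch.rho u 1 E) =
      physicalShift ch.ℓ (ch.coulomb u) (ch.rho0 u ^ 2 * (E - ch.threshold)) := by
  have h0 := ch.rho0_pos u
  have hα := ch.coulomb_nonneg u
  rcases lt_trichotomy E ch.threshold with h | h | h
  · have hκ : 0 < ch.rho0 u * Real.sqrt (ch.threshold - E) :=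
      mul_pos h0 (Real.sqrt_pos.2 (by linarith))
    have hne : Complex.I * ((ch.rho0 u * Real.sqrt (ch.threshold - E) : ℝ) : ℂ) ≠ 0 :=
      mul_ne_zero Complex.I_ne_zero (by exact_mod_cast hκ.ne')
    rw [rho_of_lt u ch 1 h, shift, Units.val_one, Int.cast_one, one_mul, reducedLogDeriv,
      if_neg hne, reducedLogDerivAux_I_mul _ hα hκ, Complex.ofReal_re,
      physicalShift_of_neg (mul_neg_of_pos_of_neg (by positivity) (by linarith)), ← mul_neg,
      neg_sub, Real.sqrt_mul (by positivity), Real.sqrt_sq h0.le]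
  · subst h
    rw [rho_threshold, shift, reducedLogDeriv_zero _ hα, sub_self, mul_zero, physicalShift_zero,
      Complex.ofReal_re]
  · have hk : 0 < ch.rho0 u * Real.sqrt (E - ch.threshold) :=
      mul_pos h0 (Real.sqrt_pos.2 (by linarith))
    rw [rho_of_gt u ch 1 h, shift, (wave_sign hα hk 1).2,
      physicalShift_of_pos (mul_pos (by positivity) (by linarith)),
      Real.sqrt_mul (by positivity), Real.sqrt_sq h0.le]

theorem monotone_shift_rho_one : Monotone fun E : ℝ => ch.shift u (ch.rho u 1 E) := by
  have h0 := ch.rho0_pos u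
  intro E₁ E₂ h
  simp only [shift_rho_one]
  refine monotone_physicalShift _ (ch.coulomb_nonneg u) ?_
  gcongr

theorem continuous_shift_rho_one : Continuous fun E : ℝ => ch.shift u (ch.rho u 1 E) := by
  simp only [shift_rho_one]
  exact (continuous_physicalShift _ (ch.coulomb_nonneg u)).comp (by fun_prop)

theorem isRegular_rho_of_le (s : ℤˣ) {E : ℝ} (h : ch.threshold ≤ E) :
    ch.IsRegular u (ch.rho u s E) := by
  rcases h.lt_or_eq with h | h
  · rw [rho_of_gt u ch s h]
    exact Or.inr (wave_sign (ch.coulomb_nonneg u)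
      (mul_pos (ch.rho0_pos u) (Real.sqrt_pos.2 (by linarith))) s).1
  · subst h
    exact Or.inl (rho_threshold u ch s)

theorem isRegular_rho_one (E : ℝ) : ch.IsRegular u (ch.rho u 1 E) := by
  rcases lt_or_ge E ch.threshold with h | h
  · rw [rho_of_lt u ch 1 h, Units.val_one, Int.cast_one, one_mul]
    exact Or.inr (outgoingWave_I_mul_ne_zero _ (ch.coulomb_nonneg u)
      (mul_pos (ch.rho0_pos u) (Real.sqrt_pos.2 (by linarith))))
  · exact isRegular_rho_of_le u ch 1 h

/-- At and above the threshold, the shift function does not depend on the branch. -/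
theorem shift_rho_of_le (s : ℤˣ) {E : ℝ} (h : ch.threshold ≤ E) :
    ch.shift u (ch.rho u s E) = ch.shift u (ch.rho u 1 E) := by
  rcases h.lt_or_eq with h | h
  · have hk : 0 < ch.rho0 u * Real.sqrt (E - ch.threshold) :=
      mul_pos (ch.rho0_pos u) (Real.sqrt_pos.2 (by linarith))
    rw [rho_of_gt u ch s h, rho_of_gt u ch 1 h, shift, shift,
      (wave_sign (ch.coulomb_nonneg u) hk s).2, (wave_sign (ch.coulomb_nonneg u) hk 1).2]
  · subst h
    rw [rho_threshold, rho_threshold]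

end Channel


/-! ### Neutral channels: the outgoing wave is elementary -/

section Neutral

open Polynomial

/-- The polynomial `∑ⱼ (ℓ choose j) (2ℓ - j)! zʲ = ∫₀^∞ e⁻ᵘ uˡ (z + u)ˡ du`, a reverse Bessel
polynomial. -/
noncomputable def besselPoly (ℓ : ℕ) : ℝ[X] :=
  ∑ j ∈ Finset.range (ℓ + 1), C ((ℓ.choose j : ℝ) * (2 * ℓ - j).factorial) * X ^ j

theorem eval_besselPoly (ℓ : ℕ) (x : ℝ) : (besselPoly ℓ).eval x =
    ∑ j ∈ Finset.range (ℓ + 1), (ℓ.choose j : ℝ) * (2 * ℓ - j).factorial * x ^ j := by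
  simp [besselPoly, eval_finsetSum]

theorem aeval_besselPoly (ℓ : ℕ) (z : ℂ) : aeval z (besselPoly ℓ) =
    ∑ j ∈ Finset.range (ℓ + 1), (ℓ.choose j : ℂ) * (2 * ℓ - j).factorial * z ^ j := by
  simp [besselPoly, map_sum]

theorem eval_zero_besselPoly (ℓ : ℕ) : 0 < (besselPoly ℓ).eval 0 := by
  rw [eval_besselPoly, Finset.sum_eq_single 0]
  · simp
    positivity
  · intro j _ hj
    simp [hj]
  · simp

theorem coeff_besselPoly (ℓ : ℕ) : (besselPoly ℓ).coeff ℓ = ℓ.factorial := by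
  rw [besselPoly, finsetSum_coeff, Finset.sum_eq_single ℓ]
  · rw [coeff_C_mul, coeff_X_pow_self, Nat.choose_self, two_mul, Nat.add_sub_cancel]
    simp
  · intro j _ hj
    rw [coeff_C_mul, coeff_X_pow, if_neg hj.symm, mul_zero]
  · simp

theorem natDegree_besselPoly (ℓ : ℕ) : (besselPoly ℓ).natDegree = ℓ := by
  refine natDegree_eq_of_le_of_coeff_ne_zero ?_ ?_
  · refine natDegree_sum_le_of_forall_le _ _ fun j hj => ?_
    exact (natDegree_C_mul_X_pow_le _ _).trans (by have := Finset.mem_range.1 hj; omega)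
  · rw [coeff_besselPoly]
    positivity

theorem leadingCoeff_besselPoly (ℓ : ℕ) : (besselPoly ℓ).leadingCoeff = ℓ.factorial := by
  rw [leadingCoeff, natDegree_besselPoly, coeff_besselPoly]

theorem besselPoly_ne_zero (ℓ : ℕ) : besselPoly ℓ ≠ 0 := by
  intro h
  have := eval_zero_besselPoly ℓ
  simp [h] at this

theorem integral_exp_neg_mul_pow (n : ℕ) :
    ∫ u in Set.Ioi (0 : ℝ), Complex.exp (-(u : ℂ)) * (u : ℂ) ^ n = n.factorial := by
  have h := Complex.Gamma_nat_eq_factorial n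
  rw [Complex.Gamma_eq_integral (by simp; positivity), Complex.GammaIntegral] at h
  rw [← h]
  refine setIntegral_congr_fun measurableSet_Ioi fun u _ => ?_
  simp

theorem integrableOn_exp_neg_mul_pow (n : ℕ) :
    IntegrableOn (fun u : ℝ => Complex.exp (-(u : ℂ)) * (u : ℂ) ^ n) (Set.Ioi 0) := by
  have h := Complex.GammaIntegral_convergent (s := n + 1) (by simp; positivity)
  refine h.congr_fun (fun u _ => ?_) measurableSet_Ioi
  simp

theorem exp_mul_pow_mul_add_pow (ℓ : ℕ) (z : ℂ) (u : ℝ) :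
    Complex.exp (-(u : ℂ)) * (u : ℂ) ^ ℓ * (z + u) ^ ℓ =
      ∑ j ∈ Finset.range (ℓ + 1), ((ℓ.choose j : ℂ) * z ^ j) *
        (Complex.exp (-(u : ℂ)) * (u : ℂ) ^ (2 * ℓ - j)) := by
  rw [add_pow, Finset.mul_sum]
  refine Finset.sum_congr rfl fun j hj => ?_
  have hj := Finset.mem_range.1 hj
  rw [show 2 * ℓ - j = ℓ + (ℓ - j) by omega, pow_add]
  ring

theorem integral_eq_aeval_besselPoly (ℓ : ℕ) (z : ℂ) :
    ∫ u in Set.Ioi (0 : ℝ), Complex.exp (-(u : ℂ)) * (u : ℂ) ^ ℓ * (z + u) ^ ℓ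
      = aeval z (besselPoly ℓ) := by
  rw [aeval_besselPoly]
  simp only [exp_mul_pow_mul_add_pow]
  rw [integral_finsetSum _ fun j _ => (integrableOn_exp_neg_mul_pow _).const_mul _]
  refine Finset.sum_congr rfl fun j _ => ?_
  rw [integral_const_mul, integral_exp_neg_mul_pow]
  ring

theorem aeval_ofReal_besselPoly (ℓ : ℕ) (x : ℝ) :
    aeval (x : ℂ) (besselPoly ℓ) = (((besselPoly ℓ).eval x : ℝ) : ℂ) := by
  rw [aeval_besselPoly, eval_besselPoly]
  push_cast
  rfl

/-- For even `ℓ` the integrand of the integral representation is nonnegative. -/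
theorem eval_besselPoly_pos_of_even {ℓ : ℕ} (hℓ : Even ℓ) (x : ℝ) : 0 < (besselPoly ℓ).eval x := by
  have hc : ((∫ u in Set.Ioi (0 : ℝ), Real.exp (-u) * u ^ ℓ * (x + u) ^ ℓ : ℝ) : ℂ) =
      (((besselPoly ℓ).eval x : ℝ) : ℂ) := by
    rw [← aeval_ofReal_besselPoly, ← integral_eq_aeval_besselPoly, ← integral_complex_ofReal]
    push_cast
    rfl
  rw [← Complex.ofReal_injective hc]
  have hint : IntegrableOn (fun u : ℝ => Real.exp (-u) * u ^ ℓ * (x + u) ^ ℓ) (Set.Ioi 0) := by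
    have h : IntegrableOn (fun u : ℝ => Complex.exp (-(u : ℂ)) * (u : ℂ) ^ ℓ * (x + u) ^ ℓ)
        (Set.Ioi 0) := by
      simp only [exp_mul_pow_mul_add_pow]
      exact integrable_finsetSum _ fun j _ => (integrableOn_exp_neg_mul_pow _).const_mul _
    refine IntegrableOn.congr_fun h.re (fun u _ => ?_) measurableSet_Ioi
    have e : Complex.exp (-(u : ℂ)) * (u : ℂ) ^ ℓ * (x + u) ^ ℓ =
        ((Real.exp (-u) * u ^ ℓ * (x + u) ^ ℓ : ℝ) : ℂ) := by
      push_cast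
      rfl
    simp only [e]
    exact Complex.ofReal_re _
  rw [setIntegral_pos_iff_support_of_nonneg_ae ?_ hint]
  · have : Set.Ioi |x| ⊆ (Function.support fun u : ℝ => Real.exp (-u) * u ^ ℓ * (x + u) ^ ℓ) ∩
        Set.Ioi 0 := by
      intro u hu
      have hu : |x| < u := hu
      have h0 : 0 < u := (abs_nonneg x).trans_lt hu
      have h1 : 0 < x + u := by linarith [neg_abs_le x]
      exact ⟨(by positivity : Real.exp (-u) * u ^ ℓ * (x + u) ^ ℓ ≠ 0), h0⟩
    refine lt_of_lt_of_le ?_ (measure_mono this)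
    simp
  · filter_upwards [ae_restrict_mem measurableSet_Ioi] with u hu
    have hu : 0 < u := hu
    have := hℓ.pow_nonneg (x + u)
    simp only [Pi.zero_apply]
    positivity

/-- For neutral particles Tricomi's integral is a polynomial in `1 / ρ`, on both sheets. -/
theorem outgoingWave_zero_eq (ℓ : ℕ) {ρ : ℂ} (hρ : ρ ≠ 0) :
    outgoingWave ℓ 0 ρ = (-2 * Complex.I) ^ (-(ℓ + 1 : ℤ)) / ℓ.factorial *
      (Complex.exp (Complex.I * ρ) * (aeval (-2 * Complex.I * ρ) (besselPoly ℓ) /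
        (-2 * Complex.I * ρ) ^ ℓ)) := by
  set z : ℂ := -2 * Complex.I * ρ with hz
  have hz0 : z ≠ 0 := neg_two_I_mul_ne_zero hρ
  have h2 : (-2 * Complex.I : ℂ) ≠ 0 := mul_ne_zero (by norm_num) Complex.I_ne_zero
  have hI : ∫ u in Set.Ioi (0 : ℝ), Complex.exp (-(u : ℂ)) * (u : ℂ) ^ ((ℓ : ℂ) + 0) *
      (1 + (u : ℂ) / z) ^ ((ℓ : ℂ) - 0) = aeval z (besselPoly ℓ) / z ^ ℓ := by
    rw [← integral_eq_aeval_besselPoly, ← integral_div]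
    refine setIntegral_congr_fun measurableSet_Ioi fun u _ => ?_
    simp only [add_zero, sub_zero, Complex.cpow_natCast]
    rw [one_add_div hz0, div_pow]
    ring
  rw [outgoingWave_of_re_nonneg ℓ (by simp), mul_zero, tricomiU_eq, ← hz, hI, add_zero,
    Complex.Gamma_nat_eq_factorial, show (-((ℓ : ℂ) + 1)) = ((-(ℓ + 1 : ℤ) : ℤ) : ℂ) by push_cast; ring,
    Complex.cpow_intCast, hz, mul_zpow]
  have : ρ ^ (ℓ + 1) * ρ ^ (-(ℓ + 1 : ℤ)) = 1 := by
    rw [zpow_neg, ← Nat.cast_succ, zpow_natCast]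
    exact mul_inv_cancel₀ (pow_ne_zero _ hρ)
  linear_combination ((-2 * Complex.I) ^ (-(ℓ + 1 : ℤ)) / ℓ.factorial *
      (Complex.exp (Complex.I * ρ) * (aeval (-2 * Complex.I * ρ) (besselPoly ℓ) /
        (-2 * Complex.I * ρ) ^ ℓ))) * this

/-- The logarithmic derivative of a neutral channel at `ρ = i x / 2`. -/
noncomputable def neutralLogDeriv (ℓ : ℕ) (x : ℝ) : ℝ :=
  -(x / 2) - ℓ + x * (derivative (besselPoly ℓ)).eval x / (besselPoly ℓ).eval x

theorem outgoingWave_zero_ne_zero_iff (ℓ : ℕ) {x : ℝ} (hx : x ≠ 0) :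
    outgoingWave ℓ 0 (Complex.I * ((x / 2 : ℝ) : ℂ)) ≠ 0 ↔ (besselPoly ℓ).eval x ≠ 0 := by
  have hxc : ((x / 2 : ℝ) : ℂ) ≠ 0 := by exact_mod_cast (by positivity : x / 2 ≠ 0)
  have hρ : Complex.I * ((x / 2 : ℝ) : ℂ) ≠ 0 := mul_ne_zero Complex.I_ne_zero hxc
  have h2 : (-2 * Complex.I : ℂ) ≠ 0 := mul_ne_zero (by norm_num) Complex.I_ne_zero
  have hf : (ℓ.factorial : ℂ) ≠ 0 := by exact_mod_cast ℓ.factorial_ne_zero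
  rw [outgoingWave_zero_eq ℓ hρ, neg_two_I_mul_I, mul_div_cancel₀ _ two_ne_zero,
    aeval_ofReal_besselPoly]
  have hx' : (x : ℂ) ≠ 0 := by exact_mod_cast hx
  simp [Complex.exp_ne_zero, hx', hf, zpow_ne_zero]

theorem reducedLogDerivAux_neutral (ℓ : ℕ) {x : ℝ} (hx : x ≠ 0) (hQ : (besselPoly ℓ).eval x ≠ 0) :
    reducedLogDerivAux ℓ 0 (Complex.I * ((x / 2 : ℝ) : ℂ)) = ((neutralLogDeriv ℓ x : ℝ) : ℂ) := by
  have hxc : ((x / 2 : ℝ) : ℂ) ≠ 0 := by exact_mod_cast (by positivity : x / 2 ≠ 0)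
  have hx' : (x : ℂ) ≠ 0 := by exact_mod_cast hx
  set ρ : ℂ := Complex.I * ((x / 2 : ℝ) : ℂ) with hρdef
  have hρ : ρ ≠ 0 := mul_ne_zero Complex.I_ne_zero hxc
  have hz : -2 * Complex.I * ρ = x := by
    rw [hρdef, neg_two_I_mul_I, mul_div_cancel₀ _ two_ne_zero]
  have h2 : (-2 * Complex.I : ℂ) ≠ 0 := mul_ne_zero (by norm_num) Complex.I_ne_zero
  have hf : (ℓ.factorial : ℂ) ≠ 0 := by exact_mod_cast ℓ.factorial_ne_zero
  have hQc : (((besselPoly ℓ).eval x : ℝ) : ℂ) ≠ 0 := by exact_mod_cast hQ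
  have hQ' : aeval (x : ℂ) (derivative (besselPoly ℓ)) =
      (((derivative (besselPoly ℓ)).eval x : ℝ) : ℂ) := by
    simpa using aeval_algebraMap_apply ℂ x (derivative (besselPoly ℓ))
  have dz : HasDerivAt (fun w : ℂ => -2 * Complex.I * w) (-2 * Complex.I) ρ := by
    simpa using (hasDerivAt_id ρ).const_mul (-2 * Complex.I)
  have dI : HasDerivAt (fun w : ℂ => Complex.I * w) Complex.I ρ := by
    simpa using (hasDerivAt_id ρ).const_mul Complex.I
  have dQ : HasDerivAt (fun w : ℂ => aeval (-2 * Complex.I * w) (besselPoly ℓ))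
      (aeval (-2 * Complex.I * ρ) (derivative (besselPoly ℓ)) * (-2 * Complex.I)) ρ :=
    HasDerivAt.comp ρ ((besselPoly ℓ).hasDerivAt_aeval (-2 * Complex.I * ρ)) dz
  have dO := ((dI.cexp).mul (dQ.div (dz.pow ℓ) (pow_ne_zero ℓ (hz.trans_ne hx')))).const_mul
    ((-2 * Complex.I) ^ (-(ℓ + 1 : ℤ)) / (ℓ.factorial : ℂ))
  have dO' := dO.congr_of_eventuallyEq (f₁ := outgoingWave ℓ 0) (by
    filter_upwards [isOpen_ne.mem_nhds hρ] with w hw using outgoingWave_zero_eq ℓ hw)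
  have hK : (-2 * Complex.I) ^ (-(ℓ + 1 : ℤ)) / (ℓ.factorial : ℂ) ≠ 0 :=
    div_ne_zero (zpow_ne_zero _ h2) hf
  have hO := outgoingWave_zero_eq ℓ hρ
  generalize (-2 * Complex.I) ^ (-(ℓ + 1 : ℤ)) / (ℓ.factorial : ℂ) = K at hK dO' hO
  rw [reducedLogDerivAux, Complex.ofReal_zero, zero_div, dO'.deriv, hO, hz, aeval_ofReal_besselPoly,
    hQ']
  have hxρ : Complex.I * ρ = -(x / 2 : ℂ) := by
    linear_combination (-1 / 2 : ℂ) * hz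
  have hexp : Complex.exp (Complex.I * ρ) ≠ 0 := Complex.exp_ne_zero _
  have hn : (ℓ : ℂ) * (x : ℂ) ^ (ℓ - 1) * x = ℓ * (x : ℂ) ^ ℓ := by
    rcases ℓ with _ | n
    · simp
    · rw [Nat.add_sub_cancel, pow_succ]
      ring
  rw [neutralLogDeriv]
  push_cast
  simp only [Pi.pow_apply, Pi.div_apply, hz, aeval_ofReal_besselPoly]
  generalize (((besselPoly ℓ).eval x : ℝ) : ℂ) = Q at *
  generalize (((derivative (besselPoly ℓ)).eval x : ℝ) : ℂ) = Q1 at *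
  generalize Complex.exp (Complex.I * ρ) = X at *
  clear dO dO' hO dQ
  field_simp
  linear_combination
    (-(Q * (x : ℂ) ^ ℓ + 2 * (-((x : ℂ) ^ ℓ * Q1) - -(Q * ℓ * (x : ℂ) ^ (ℓ - 1))))) * hz
    - 2 * Q * hn

theorem continuousAt_neutralLogDeriv (ℓ : ℕ) {x : ℝ} (hQ : (besselPoly ℓ).eval x ≠ 0) :
    ContinuousAt (neutralLogDeriv ℓ) x := by
  unfold neutralLogDeriv
  refine ContinuousAt.add (by fun_prop) (ContinuousAt.div ?_ ?_ hQ)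
  · exact (continuous_id.mul (derivative (besselPoly ℓ)).continuous).continuousAt
  · exact (besselPoly ℓ).continuous.continuousAt

theorem shiftZero_neutral (ℓ : ℕ) : shiftZero ℓ 0 = neutralLogDeriv ℓ 0 := by
  refine tendsto_nhds_unique (tendsto_shiftBelow ℓ le_rfl) ?_
  have h1 : Tendsto (fun κ : ℝ => 2 * κ) (𝓝[>] 0) (𝓝 0) := by
    have : Tendsto (fun κ : ℝ => 2 * κ) (𝓝 0) (𝓝 (2 * 0)) :=
      (continuous_const.mul continuous_id).tendsto 0
    rw [mul_zero] at this
    exact this.mono_left nhdsWithin_le_nhds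
  refine ((continuousAt_neutralLogDeriv ℓ (eval_zero_besselPoly ℓ).ne').tendsto.comp h1).congr' ?_
  filter_upwards [self_mem_nhdsWithin] with κ hκ
  have hκ : 0 < κ := hκ
  have hx : 2 * κ ≠ 0 := by positivity
  have hpos : 0 < (besselPoly ℓ).eval (2 * κ) := by
    rw [eval_besselPoly]
    exact Finset.sum_pos (fun j hj => by
      have := Nat.choose_pos (Nat.lt_succ_iff.1 (Finset.mem_range.1 hj))
      positivity) (by simp)
  have h2 := reducedLogDerivAux_neutral ℓ hx hpos.ne'
  rw [mul_div_cancel_left₀ _ two_ne_zero, reducedLogDerivAux_I_mul ℓ le_rfl hκ] at h2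
  exact (Complex.ofReal_injective h2).symm

theorem reducedLogDeriv_neutral (ℓ : ℕ) {x : ℝ} (hQ : (besselPoly ℓ).eval x ≠ 0) :
    reducedLogDeriv ℓ 0 (Complex.I * ((x / 2 : ℝ) : ℂ)) = ((neutralLogDeriv ℓ x : ℝ) : ℂ) := by
  rcases eq_or_ne x 0 with rfl | hx
  · rw [zero_div, Complex.ofReal_zero, mul_zero, reducedLogDeriv_zero ℓ le_rfl, shiftZero_neutral]
  · have hxc : ((x / 2 : ℝ) : ℂ) ≠ 0 := by exact_mod_cast (by positivity : x / 2 ≠ 0)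
    rw [reducedLogDeriv, if_neg (mul_ne_zero Complex.I_ne_zero hxc),
      reducedLogDerivAux_neutral ℓ hx hQ]

/-- At infinity on the `-` sheet, `L ≤ κ` up to a constant, `x = -2κ`. -/
theorem exists_neutralLogDeriv_le (ℓ : ℕ) :
    ∃ c : ℝ, ∀ᶠ x in atBot, neutralLogDeriv ℓ x ≤ -(x / 2) + c := by
  have hdeg : (X * derivative (besselPoly ℓ)).degree ≤ (besselPoly ℓ).degree := by
    rw [degree_eq_natDegree (besselPoly_ne_zero ℓ), natDegree_besselPoly]
    refine degree_le_of_natDegree_le ?_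
    rcases Nat.eq_zero_or_pos ℓ with rfl | hℓ
    · have : derivative (besselPoly 0) = 0 := by simp [besselPoly]
      simp [this]
    · refine natDegree_mul_le.trans ?_
      have := natDegree_derivative_le (besselPoly ℓ)
      rw [natDegree_besselPoly] at this
      rw [natDegree_X]
      omega
  obtain ⟨c, hc⟩ := (isBigO_atBot_of_degree_le _ _ hdeg).bound
  refine ⟨|c|, ?_⟩
  filter_upwards [hc] with x hx
  simp only [eval_X, eval_mul, Real.norm_eq_abs] at hx
  have h2 : x * (derivative (besselPoly ℓ)).eval x / (besselPoly ℓ).eval x ≤ |c| := by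
    refine (le_abs_self _).trans ?_
    rw [abs_div]
    refine div_le_of_le_mul₀ (abs_nonneg _) (abs_nonneg _) (hx.trans ?_)
    exact mul_le_mul_of_nonneg_right (le_abs_self c) (abs_nonneg _)
  have := (Nat.cast_nonneg ℓ : (0 : ℝ) ≤ ℓ)
  unfold neutralLogDeriv
  linarith

/-- In odd angular momentum the outgoing wave has a zero on the `-` sheet below the threshold, and
`L` is unbounded from above below the lowest of them. -/
theorem exists_tendsto_neutralLogDeriv_atTop {ℓ : ℕ} (hℓ : Odd ℓ) :
    ∃ x₀ < 0, (∀ x < x₀, (besselPoly ℓ).eval x ≠ 0) ∧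
      Tendsto (neutralLogDeriv ℓ) (𝓝[<] x₀) atTop := by
  have hQ0 := besselPoly_ne_zero ℓ
  have hneg : ∃ x < 0, (besselPoly ℓ).eval x < 0 := by
    have hlim : Tendsto (fun x => (besselPoly ℓ).eval x) atBot atBot := by
      suffices h : Tendsto (fun x => ((besselPoly ℓ).comp (-X)).eval x) atTop atBot by
        refine (h.comp tendsto_neg_atBot_atTop).congr fun x => ?_
        simp
      refine tendsto_atBot_of_leadingCoeff_nonpos _ ?_ ?_
      · rw [← natDegree_pos_iff_degree_pos, natDegree_comp, natDegree_neg, natDegree_X, mul_one,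
          natDegree_besselPoly]
        exact hℓ.pos
      · rw [leadingCoeff_comp (by simp), leadingCoeff_besselPoly, natDegree_besselPoly,
          leadingCoeff_neg, leadingCoeff_X, hℓ.neg_one_pow]
        have : (0 : ℝ) < ℓ.factorial := by positivity
        linarith
    obtain ⟨x, h1, h2⟩ := ((eventually_lt_atBot 0).and
      (hlim.eventually (eventually_lt_atBot 0))).exists
    exact ⟨x, h1, h2⟩
  obtain ⟨y, hy, hy0⟩ : ∃ y < 0, (besselPoly ℓ).IsRoot y := by
    obtain ⟨x, hx, hxn⟩ := hneg
    obtain ⟨y, hy, h⟩ := intermediate_value_Icc hx.le (besselPoly ℓ).continuous.continuousOn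
      ⟨hxn.le, (eval_zero_besselPoly ℓ).le⟩
    refine ⟨y, lt_of_le_of_ne hy.2 ?_, h⟩
    rintro rfl
    exact (eval_zero_besselPoly ℓ).ne' h
  have hne : (besselPoly ℓ).roots.toFinset.Nonempty := ⟨y, by simpa [hQ0] using hy0⟩
  set x₀ := (besselPoly ℓ).roots.toFinset.min' hne with hx₀
  have hx₀neg : x₀ < 0 := (Finset.min'_le _ y (by simpa [hQ0] using hy0)).trans_lt hy
  have hroot : (besselPoly ℓ).IsRoot x₀ := by
    have := Finset.min'_mem _ hne
    rw [← hx₀] at this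
    simpa [hQ0] using this
  refine ⟨x₀, hx₀neg, fun x hx h => ?_, ?_⟩
  · exact absurd (Finset.min'_le _ x (by simpa [hQ0] using h)) (not_le.2 hx)
  -- With `Q = (x - x₀)ᵐ R`, the pole of `x Q' / Q` at `x₀` has the residue `m x₀ < 0`.
  obtain ⟨R, hR, hnd⟩ := exists_eq_pow_rootMultiplicity_mul_and_not_dvd (besselPoly ℓ) hQ0 x₀
  have hm : 0 < (besselPoly ℓ).rootMultiplicity x₀ := (rootMultiplicity_pos hQ0).2 hroot
  generalize (besselPoly ℓ).rootMultiplicity x₀ = m at hR hm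
  have hR0 : R.eval x₀ ≠ 0 := fun h => hnd (dvd_iff_isRoot.2 h)
  have hdiv : ∀ᶠ x in 𝓝[<] x₀, neutralLogDeriv ℓ x =
      (m * x) * (x - x₀)⁻¹ + (-(x / 2) - ℓ + x * (derivative R).eval x / R.eval x) := by
    filter_upwards [self_mem_nhdsWithin, nhdsWithin_le_nhds
      (R.continuous.continuousAt.eventually_ne hR0)] with x hx hRx
    have hx : x - x₀ ≠ 0 := sub_ne_zero.2 (ne_of_lt hx)
    obtain ⟨n, rfl⟩ : ∃ n, m = n + 1 := ⟨m - 1, by omega⟩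
    rw [neutralLogDeriv, hR]
    simp only [derivative_mul, derivative_X_sub_C_pow, eval_add, eval_mul, eval_pow, eval_sub,
      eval_X, eval_C, Nat.add_sub_cancel]
    field_simp
    push_cast
    ring
  refine Tendsto.congr' (hdiv.mono fun _ h => h.symm) ?_
  have hc : ContinuousAt (fun x => -(x / 2) - ℓ + x * (derivative R).eval x / R.eval x) x₀ :=
    ContinuousAt.add (by fun_prop) (ContinuousAt.div
      (continuous_id.mul (derivative R).continuous).continuousAt R.continuous.continuousAt hR0)
  refine Tendsto.atTop_add ?_ (hc.tendsto.mono_left nhdsWithin_le_nhds)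
  have h1 : Tendsto (fun x : ℝ => m * x) (𝓝[<] x₀) (𝓝 (m * x₀)) :=
    ((continuous_const.mul continuous_id).tendsto x₀).mono_left nhdsWithin_le_nhds
  refine h1.neg_mul_atBot (mul_neg_of_pos_of_neg (by exact_mod_cast hm) hx₀neg) ?_
  have h2 : Tendsto (fun x : ℝ => x - x₀) (𝓝[<] x₀) (𝓝[<] 0) := by
    refine tendsto_nhdsWithin_iff.2 ⟨?_, ?_⟩
    · have hcont : Continuous fun x : ℝ => x - x₀ := by fun_prop
      have := hcont.tendsto x₀
      rw [sub_self] at this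
      exact this.mono_left nhdsWithin_le_nhds
    · filter_upwards [self_mem_nhdsWithin] with x hx using Set.mem_Iio.2 (sub_neg.2 hx)
  exact tendsto_inv_nhdsLT_zero.comp h2

end Neutral


/-! ### Sorted eigenvalues of families of symmetric operators -/

section Eigenvalues

open Module InnerProductSpace

variable {V : Type*} [NormedAddCommGroup V] [InnerProductSpace ℂ V] [FiniteDimensional ℂ V] {n : ℕ}

theorem re_inner_apply_eq_sum {T : V →ₗ[ℂ] V} (hT : T.IsSymmetric) (hn : finrank ℂ V = n) (x : V) :
    (inner ℂ (T x) x).re =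
      ∑ i, hT.eigenvalues hn i * ‖(hT.eigenvectorBasis hn).repr x i‖ ^ 2 := by
  rw [← (hT.eigenvectorBasis hn).repr.inner_map_map, PiLp.inner_apply, Complex.re_sum]
  refine Finset.sum_congr rfl fun i _ => ?_
  rw [hT.eigenvectorBasis_apply_self_apply hn, RCLike.inner_apply, map_mul, mul_comm, mul_assoc,
    RCLike.conj_mul]
  simp [← Complex.ofReal_pow]

theorem norm_sq_eq_sum {T : V →ₗ[ℂ] V} (hT : T.IsSymmetric) (hn : finrank ℂ V = n) (x : V) :
    ‖x‖ ^ 2 = ∑ i, ‖(hT.eigenvectorBasis hn).repr x i‖ ^ 2 := by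
  rw [← EuclideanSpace.norm_sq_eq, LinearIsometryEquiv.norm_map]

/-- Weyl's monotonicity principle for sorted eigenvalues. -/
theorem eigenvalues_add_le {A B : V →ₗ[ℂ] V} (hA : A.IsSymmetric) (hB : B.IsSymmetric)
    (hn : finrank ℂ V = n) {δ : ℝ}
    (h : ∀ x, (inner ℂ (B x) x).re + δ * ‖x‖ ^ 2 ≤ (inner ℂ (A x) x).re) (k : Fin n) :
    hB.eigenvalues hn k + δ ≤ hA.eigenvalues hn k := by
  -- A nonzero vector in the span of the first `k + 1` eigenvectors of `B` and in that of the
  -- last `n - k` eigenvectors of `A`: these are `n - 1` linear conditions.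
  let f : V →ₗ[ℂ] ({i : Fin n // i ≠ k} → ℂ) := LinearMap.pi fun i =>
    if k < i.1 then (EuclideanSpace.proj i.1).toLinearMap ∘ₗ (hB.eigenvectorBasis hn).repr.toLinearMap
    else (EuclideanSpace.proj i.1).toLinearMap ∘ₗ (hA.eigenvectorBasis hn).repr.toLinearMap
  have hf : LinearMap.ker f ≠ ⊥ := by
    refine LinearMap.ker_ne_bot_of_finrank_lt ?_
    rw [finrank_fintype_fun_eq_card, hn, Fintype.card_subtype_compl]
    simp
    exact k.pos
  obtain ⟨x, hx, hx0⟩ := (Submodule.ne_bot_iff _).1 hf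
  have hcoord : ∀ i, i ≠ k → (k < i → (hB.eigenvectorBasis hn).repr x i = 0) ∧
      (i < k → (hA.eigenvectorBasis hn).repr x i = 0) := by
    intro i hi
    have := congrFun (LinearMap.mem_ker.1 hx) ⟨i, hi⟩
    simp only [f, LinearMap.pi_apply, Pi.zero_apply] at this
    constructor
    · intro hki
      simpa [if_pos hki] using this
    · intro hki
      simpa [if_neg hki.not_gt] using this
  have h1 : hB.eigenvalues hn k * ‖x‖ ^ 2 ≤ (inner ℂ (B x) x).re := by
    rw [re_inner_apply_eq_sum hB hn, norm_sq_eq_sum hB hn, Finset.mul_sum]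
    refine Finset.sum_le_sum fun i _ => ?_
    rcases le_or_gt i k with hi | hi
    · exact mul_le_mul_of_nonneg_right (hB.eigenvalues_antitone hn hi) (by positivity)
    · simp [(hcoord i hi.ne').1 hi]
  have h2 : (inner ℂ (A x) x).re ≤ hA.eigenvalues hn k * ‖x‖ ^ 2 := by
    rw [re_inner_apply_eq_sum hA hn, norm_sq_eq_sum hA hn, Finset.mul_sum]
    refine Finset.sum_le_sum fun i _ => ?_
    rcases le_or_gt k i with hi | hi
    · exact mul_le_mul_of_nonneg_right (hA.eigenvalues_antitone hn hi) (by positivity)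
    · simp [(hcoord i hi.ne).2 hi]
  have hpos : 0 < ‖x‖ ^ 2 := by positivity
  have h3 := h x
  refine le_of_mul_le_mul_right ?_ hpos
  linarith

/-- The lowest eigenvalue bounds the quadratic form from below. -/
theorem eigenvalues_mul_norm_sq_le_re_inner {T : V →ₗ[ℂ] V} (hT : T.IsSymmetric) (hn : finrank ℂ V = n)
    {k : Fin n} (hk : ∀ i, i ≤ k) (x : V) :
    hT.eigenvalues hn k * ‖x‖ ^ 2 ≤ (inner ℂ (T x) x).re := by
  rw [re_inner_apply_eq_sum hT hn, norm_sq_eq_sum hT hn, Finset.mul_sum]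
  exact Finset.sum_le_sum fun i _ =>
    mul_le_mul_of_nonneg_right (hT.eigenvalues_antitone hn (hk i)) (by positivity)

theorem le_eigenvalues {T : V →ₗ[ℂ] V} (hT : T.IsSymmetric) (hn : finrank ℂ V = n) {m : ℝ}
    (h : ∀ x, m * ‖x‖ ^ 2 ≤ (inner ℂ (T x) x).re) (k : Fin n) : m ≤ hT.eigenvalues hn k := by
  have h1 := h (hT.eigenvectorBasis hn k)
  rw [hT.apply_eigenvectorBasis, inner_smul_left] at h1
  simpa using h1

theorem continuousAt_eigenvalues {T : ℝ → V →ₗ[ℂ] V} (hT : ∀ E, (T E).IsSymmetric)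
    (hn : finrank ℂ V = n) {E₀ : ℝ}
    (hc : ∀ ε > 0, ∀ᶠ E in 𝓝 E₀, ∀ x,
      |(inner ℂ (T E x) x).re - (inner ℂ (T E₀ x) x).re| ≤ ε * ‖x‖ ^ 2) (k : Fin n) :
    ContinuousAt (fun E => (hT E).eigenvalues hn k) E₀ := by
  rw [Metric.continuousAt_iff']
  intro ε hε
  filter_upwards [hc (ε / 2) (half_pos hε)] with E hE
  have h1 := eigenvalues_add_le (hT E₀) (hT E) hn (δ := -(ε / 2))
    (fun x => by have := abs_le.1 (hE x); linarith) k
  have h2 := eigenvalues_add_le (hT E) (hT E₀) hn (δ := -(ε / 2))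
    (fun x => by have := abs_le.1 (hE x); linarith) k
  rw [Real.dist_eq, abs_lt]
  constructor <;> linarith

/-- A continuous nonincreasing function has exactly one fixed point. -/
theorem existsUnique_fixedPoint {f : ℝ → ℝ} (hf : Antitone f) (hc : Continuous f) :
    ∃! E, f E = E := by
  obtain ⟨E, hE⟩ : ∃ E, f E = E := by
    have h1 : f (max 0 (f 0)) - max 0 (f 0) ≤ 0 :=
      sub_nonpos.2 ((hf (le_max_left _ _)).trans (le_max_right _ _))
    have h2 : 0 ≤ f (min 0 (f 0)) - min 0 (f 0) :=
      sub_nonneg.2 ((min_le_right _ _).trans (hf (min_le_left _ _)))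
    obtain ⟨E, hE⟩ := mem_range_of_exists_le_of_exists_ge (hc.sub continuous_id) ⟨_, h1⟩ ⟨_, h2⟩
    exact ⟨E, sub_eq_zero.1 hE⟩
  refine ⟨E, hE, fun E' hE' => ?_⟩
  have hE' : f E' = E' := hE'
  rcases le_total E E' with h | h
  · have := hf h
    linarith
  · have := hf h
    linarith

/-- For a continuous nonincreasing family of symmetric operators, the eigenproblem
`T(E) a = E a` has as many solutions as the dimension: each sorted eigenvalue crosses the
diagonal once. -/
theorem encard_eigenvalue_crossings {T : ℝ → V →ₗ[ℂ] V} (hT : ∀ E, (T E).IsSymmetric)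
    (hn : finrank ℂ V = n)
    (hanti : ∀ E₁ E₂, E₁ ≤ E₂ → ∀ x, (inner ℂ (T E₂ x) x).re ≤ (inner ℂ (T E₁ x) x).re)
    (hc : ∀ E₀, ∀ ε > 0, ∀ᶠ E in 𝓝 E₀, ∀ x,
      |(inner ℂ (T E x) x).re - (inner ℂ (T E₀ x) x).re| ≤ ε * ‖x‖ ^ 2) :
    {p : ℝ × ℕ | p.2 < finrank ℂ (End.eigenspace (T p.1) (p.1 : ℂ))}.encard = n := by
  have hex : ∀ k, ∃! E, (hT E).eigenvalues hn k = E := fun k =>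
    existsUnique_fixedPoint
      (fun E₁ E₂ h => by
        have := eigenvalues_add_le (hT E₁) (hT E₂) hn (δ := 0) (fun x => by
          simpa using hanti E₁ E₂ h x) k
        simpa using this)
      (continuous_iff_continuousAt.2 fun E₀ => continuousAt_eigenvalues hT hn (hc E₀) k)
  choose F hF hFu using hex
  have hcard : ∀ E : ℝ, finrank ℂ (End.eigenspace (T E) (E : ℂ)) =
      (Finset.univ.filter fun k => F k = E).card := by
    intro E
    rw [← (hT E).card_filter_eigenvalues_eq hn]
    congr 1
    ext k
    simp only [Finset.mem_filter, Finset.mem_univ, true_and]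
    constructor
    · intro h
      exact (hFu k E (Complex.ofReal_injective h)).symm
    · rintro rfl
      exact congrArg _ (hF k)
  have hset : {p : ℝ × ℕ | p.2 < finrank ℂ (End.eigenspace (T p.1) (p.1 : ℂ))} =
      ((Finset.univ.image F).biUnion fun E => {E} ×ˢ
        Finset.range (Finset.univ.filter fun k => F k = E).card : Finset (ℝ × ℕ)) := by
    ext ⟨E, j⟩
    simp only [Set.mem_ofPred_eq, hcard, Finset.coe_biUnion, Set.mem_iUnion, Finset.mem_coe,
      Finset.mem_product, Finset.mem_singleton, Finset.mem_range, Finset.mem_image,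
      Finset.mem_univ, true_and]
    constructor
    · intro h
      obtain ⟨k, hk⟩ := Finset.card_pos.1 (Nat.zero_lt_of_lt h)
      exact ⟨E, ⟨k, (Finset.mem_filter.1 hk).2⟩, rfl, h⟩
    · rintro ⟨_, _, rfl, h⟩
      exact h
  rw [hset, Set.encard_coe_eq_coe_finsetCard, Finset.card_biUnion]
  · have h := Finset.card_eq_sum_card_image F Finset.univ
    rw [Finset.card_univ, Fintype.card_fin] at h
    simp only [Finset.card_product, Finset.card_singleton, one_mul, Finset.card_range]
    exact_mod_cast h.symm
  · intro E₁ _ E₂ _ hne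
    rw [Function.onFun, Finset.disjoint_left]
    rintro ⟨E, j⟩ h1 h2
    simp only [Finset.mem_product, Finset.mem_singleton] at h1 h2
    exact hne (h1.1.symm.trans h2.1)

end Eigenvalues


/-! ### Brune's matrix as a symmetric operator -/

namespace Parameters

open Module

variable {NL NC : ℕ} (u : Constants) (P : Parameters NL NC)

theorem isSymm_bruneMatrix (ρ : Fin NC → ℂ) : (P.bruneMatrix u ρ).IsSymm := by
  unfold bruneMatrix
  rw [Matrix.IsSymm, Matrix.transpose_sub, Matrix.diagonal_transpose, Matrix.transpose_mul,
    Matrix.transpose_mul, Matrix.transpose_transpose, Matrix.diagonal_transpose, Matrix.mul_assoc]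

theorem bruneMatrix_apply (ρ : Fin NC → ℂ) (l j : Fin NL) :
    P.bruneMatrix u ρ l j = Matrix.diagonal P.energy l j -
      ∑ c, P.width l c * ((P.channel c).shift u (ρ c) - P.boundary c) * P.width j c := by
  unfold bruneMatrix
  rw [Matrix.sub_apply, Matrix.mul_apply]
  simp only [Matrix.mul_diagonal, Matrix.transpose_apply]

/-- Brune's matrix as an operator on the complex Euclidean space. -/
noncomputable def bruneOp (ρ : Fin NC → ℂ) :
    EuclideanSpace ℂ (Fin NL) →ₗ[ℂ] EuclideanSpace ℂ (Fin NL) :=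
  Matrix.toEuclideanLin ((P.bruneMatrix u ρ).map (fun x : ℝ => (x : ℂ)))

theorem isSymmetric_bruneOp (ρ : Fin NC → ℂ) : (P.bruneOp u ρ).IsSymmetric := by
  refine Matrix.isSymmetric_toEuclideanLin_iff.2 ?_
  ext i j
  simp only [Matrix.conjTranspose_apply, Matrix.map_apply]
  rw [← (P.isSymm_bruneMatrix u ρ).apply i j]
  exact Complex.conj_ofReal _

theorem finrank_solutionSpace (p : ℂ × (Fin NC → ℂ)) :
    finrank ℂ (P.solutionSpace u p) = finrank ℂ (End.eigenspace (P.bruneOp u p.2) p.1) := by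
  refine (LinearEquiv.finrank_eq (LinearEquiv.ofSubmodules
    (WithLp.linearEquiv 2 ℂ (Fin NL → ℂ)) _ _ ?_)).symm
  ext a
  simp only [Submodule.mem_map, solutionSpace, End.mem_eigenspace_iff, bruneOp]
  constructor
  · rintro ⟨x, hx, rfl⟩
    simpa [Matrix.toLpLin_apply] using congrArg (WithLp.ofLp) hx
  · intro h
    refine ⟨WithLp.toLp 2 a, ?_, rfl⟩
    have := congrArg (WithLp.toLp 2) h
    simpa [Matrix.toLpLin_apply] using this

/-- The component of a vector in a channel, `(γᵀ x)_c`. -/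
noncomputable def channelComponent (c : Fin NC) (x : EuclideanSpace ℂ (Fin NL)) : ℂ :=
  ∑ l, (P.width l c : ℂ) * x l

theorem re_inner_bruneOp (ρ : Fin NC → ℂ) (x : EuclideanSpace ℂ (Fin NL)) :
    (inner ℂ (P.bruneOp u ρ x) x).re = ∑ l, P.energy l * ‖x l‖ ^ 2 -
      ∑ c, ((P.channel c).shift u (ρ c) - P.boundary c) * ‖P.channelComponent c x‖ ^ 2 := by
  set s : Fin NC → ℝ := fun c => (P.channel c).shift u (ρ c) - P.boundary c with hs
  have hx : ∀ l, (P.bruneOp u ρ x) l =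
      P.energy l * x l - ∑ c, P.width l c * s c * P.channelComponent c x := by
    intro l
    simp only [bruneOp, Matrix.toLpLin_apply, Matrix.mulVec, dotProduct,
      Matrix.map_apply, bruneMatrix_apply, Complex.ofReal_sub (Matrix.diagonal _ _ _), sub_mul,
      Finset.sum_sub_distrib, channelComponent, Complex.ofReal_sum, Complex.ofReal_mul,
      Finset.sum_mul, Finset.mul_sum, hs]
    congr 1
    · rw [Finset.sum_eq_single l]
      · simp
      · intro j _ hj
        simp [Matrix.diagonal_apply_ne _ hj.symm]
      · simp
    · rw [Finset.sum_comm]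
      refine Finset.sum_congr rfl fun c _ => Finset.sum_congr rfl fun j _ => ?_
      ring
  have h2 : inner ℂ (P.bruneOp u ρ x) x = (((∑ l, P.energy l * ‖x l‖ ^ 2 -
      ∑ c, s c * ‖P.channelComponent c x‖ ^ 2 : ℝ)) : ℂ) := by
    rw [PiLp.inner_apply]
    simp only [hx, RCLike.inner_apply, map_sub, map_sum, map_mul, Complex.conj_ofReal, mul_sub,
      Finset.sum_sub_distrib, Finset.mul_sum]
    push_cast
    congr 1
    · refine Finset.sum_congr rfl fun l _ => ?_
      rw [← Complex.mul_conj']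
      ring
    · rw [Finset.sum_comm]
      refine Finset.sum_congr rfl fun c _ => ?_
      rw [← Complex.mul_conj', ← mul_assoc]
      generalize (starRingEnd ℂ) (P.channelComponent c x) = y
      rw [channelComponent, Finset.mul_sum, Finset.sum_mul]
      refine Finset.sum_congr rfl fun l _ => ?_
      ring
  rw [h2, Complex.ofReal_re]

/-- A common bound for the squared norms of the channel components of unit vectors. -/
theorem exists_channelComponent_le :
    ∃ W ≥ 0, ∀ c x, ‖P.channelComponent c x‖ ^ 2 ≤ W * ‖x‖ ^ 2 := by
  have h : ∀ c x, ‖P.channelComponent c x‖ ^ 2 ≤ (∑ l, P.width l c ^ 2) * ‖x‖ ^ 2 := by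
    intro c x
    have h1 : ‖P.channelComponent c x‖ ≤ ∑ l, |P.width l c| * ‖x l‖ := by
      refine (norm_sum_le _ _).trans (Finset.sum_le_sum fun l _ => ?_)
      rw [norm_mul, Complex.norm_real, Real.norm_eq_abs]
    rw [EuclideanSpace.norm_sq_eq]
    calc _ ≤ (∑ l, |P.width l c| * ‖x l‖) ^ 2 := by gcongr
      _ ≤ (∑ l, |P.width l c| ^ 2) * ∑ l, ‖x l‖ ^ 2 := Finset.sum_mul_sq_le_sq_mul_sq _ _ _
      _ = _ := by simp only [sq_abs]
  refine ⟨∑ c, ∑ l, P.width l c ^ 2, by positivity, fun c x => (h c x).trans ?_⟩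
  gcongr
  exact Finset.single_le_sum (f := fun c => ∑ l, P.width l c ^ 2)
    (fun _ _ => by positivity) (Finset.mem_univ c)

theorem continuousAt_re_inner_bruneOp {ρ : ℝ → Fin NC → ℂ} {E₀ : ℝ}
    (h : ∀ c, ContinuousAt (fun E => (P.channel c).shift u (ρ E c)) E₀) {ε : ℝ} (hε : 0 < ε) :
    ∀ᶠ E in 𝓝 E₀, ∀ x, |(inner ℂ (P.bruneOp u (ρ E) x) x).re -
      (inner ℂ (P.bruneOp u (ρ E₀) x) x).re| ≤ ε * ‖x‖ ^ 2 := by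
  obtain ⟨W, hW0, hW⟩ := P.exists_channelComponent_le
  have hlim : Tendsto (fun E => ∑ c, |(P.channel c).shift u (ρ E c) -
      (P.channel c).shift u (ρ E₀ c)| * W) (𝓝 E₀) (𝓝 0) := by
    have : ContinuousAt (fun E => ∑ c, |(P.channel c).shift u (ρ E c) -
      (P.channel c).shift u (ρ E₀ c)| * W) E₀ := by
      refine tendsto_finsetSum _ fun c _ => ?_
      exact (((h c).sub continuousAt_const).abs).mul continuousAt_const
    simpa [ContinuousAt] using this
  filter_upwards [hlim.eventually (Iio_mem_nhds hε)] with E hE x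
  have hE : ∑ c, |(P.channel c).shift u (ρ E c) - (P.channel c).shift u (ρ E₀ c)| * W < ε := hE
  rw [re_inner_bruneOp, re_inner_bruneOp, sub_sub_sub_cancel_left, ← Finset.sum_sub_distrib]
  refine (Finset.abs_sum_le_sum_abs _ _).trans ?_
  calc _ ≤ ∑ c, (|(P.channel c).shift u (ρ E c) - (P.channel c).shift u (ρ E₀ c)| * W) * ‖x‖ ^ 2 := by
        refine Finset.sum_le_sum fun c _ => ?_
        rw [← sub_mul, sub_sub_sub_cancel_right, abs_mul, abs_sub_comm,
          abs_of_nonneg (sq_nonneg ‖P.channelComponent c x‖), mul_assoc]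
        exact mul_le_mul_of_nonneg_left (hW c x) (abs_nonneg _)
    _ = (∑ c, |(P.channel c).shift u (ρ E c) - (P.channel c).shift u (ρ E₀ c)| * W) * ‖x‖ ^ 2 := by
        rw [Finset.sum_mul]
    _ ≤ _ := by gcongr

/-! ### Poles as eigenvalue crossings -/

theorem isBranchPole_iff {p : ℂ × (Fin NC → ℂ)} : P.IsBranchPole u p ↔
    p ∈ P.surface u ∧ (∀ c, (P.channel c).IsRegular u (p.2 c)) ∧
      0 < finrank ℂ (P.solutionSpace u p) := by
  rw [IsBranchPole, ← Submodule.ne_bot_iff, finrank_pos_iff, Submodule.nontrivial_iff_ne_bot]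

theorem multiplicity_eq_finrank {p : ℂ × (Fin NC → ℂ)} (hp : p ∈ P.surface u)
    (hr : ∀ c, (P.channel c).IsRegular u (p.2 c)) :
    P.multiplicity u p = finrank ℂ (P.solutionSpace u p) := by
  unfold multiplicity
  split_ifs with h
  · rfl
  · rw [isBranchPole_iff] at h
    have : ¬ 0 < finrank ℂ (P.solutionSpace u p) := fun h' => h ⟨hp, hr, h'⟩
    omega

theorem multiplicity_pos_iff {p : ℂ × (Fin NC → ℂ)} :
    0 < P.multiplicity u p ↔ P.IsBranchPole u p := by
  unfold multiplicity
  split_ifs with h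
  · exact iff_of_true ((isBranchPole_iff u P).1 h).2.2 h
  · exact iff_of_false (lt_irrefl 0) h

/-- Brune's matrix is Hermitian, so poles have real energy. -/
theorem IsBranchPole.im_eq_zero {p : ℂ × (Fin NC → ℂ)} (h : P.IsBranchPole u p) : p.1.im = 0 := by
  have h1 := ((isBranchPole_iff u P).1 h).2.2
  rw [finrank_solutionSpace, finrank_pos_iff, Submodule.nontrivial_iff_ne_bot] at h1
  have h2 := (P.isSymmetric_bruneOp u p.2).conj_eigenvalue_eq_self (μ := p.1)
    (Module.End.hasEigenvalue_iff.2 h1)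
  exact Complex.conj_eq_iff_im.1 h2

end Parameters

theorem Channel.rho_sq (u : Constants) (ch : Channel) (s : ℤˣ) (E : ℂ) :
    ch.rho u s E ^ 2 = (ch.rho0 u : ℂ) ^ 2 * (E - ch.threshold) := by
  have hs : (((s : ℤ) : ℂ)) ^ 2 = 1 := by
    rcases Int.units_eq_one_or s with rfl | rfl <;> simp
  have hsq : ((E - (ch.threshold : ℂ)) ^ (1 / 2 : ℂ)) ^ 2 = E - ch.threshold := by
    rw [one_div]
    exact Complex.cpow_ofNat_inv_pow _ 2
  rw [Channel.rho, mul_pow, mul_pow, hs, hsq, one_mul]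

theorem Channel.rho_neg_one (u : Constants) (ch : Channel) (E : ℂ) :
    ch.rho u (-1) E = -ch.rho u 1 E := by
  simp [Channel.rho]

namespace Parameters

variable {NL NC : ℕ} (u : Constants) (P : Parameters NL NC)

theorem sheet_subset_surface (σ : Fin NC → ℤˣ) : P.sheet u σ ⊆ P.surface u := by
  rintro ⟨E, ρ⟩ (rfl : ρ = P.rho u σ E) c
  exact (P.channel c).rho_sq u (σ c) E

theorem exists_mem_sheet {p : ℂ × (Fin NC → ℂ)} (hp : p ∈ P.surface u) :
    ∃ σ : Fin NC → ℤˣ, p ∈ P.sheet u σ := by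
  have h : ∀ c, ∃ s : ℤˣ, p.2 c = (P.channel c).rho u s p.1 := by
    intro c
    have hc := hp c
    rw [← (P.channel c).rho_sq u 1, sq_eq_sq_iff_eq_or_eq_neg] at hc
    rcases hc with h | h
    · exact ⟨1, h⟩
    · exact ⟨-1, by rw [h, Channel.rho_neg_one]⟩
  choose σ hσ using h
  exact ⟨σ, funext hσ⟩

end Parameters


/-! ### Neutral channels below the threshold on the `-` sheet -/

namespace Channel

open Polynomial

variable (u : Constants) (ch : Channel)

/-- The variable `x` with `ρ = i x / 2` on the `-` sheet below the threshold. -/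
noncomputable def minusVar (E : ℝ) : ℝ := -(2 * ch.rho0 u * Real.sqrt (ch.threshold - E))

theorem continuous_minusVar : Continuous (ch.minusVar u) := by
  unfold minusVar
  fun_prop

theorem minusVar_strictMonoOn : StrictMonoOn (ch.minusVar u) (Set.Iic ch.threshold) := by
  intro E₁ _ E₂ h₂ h
  have h₂ : E₂ ≤ ch.threshold := h₂
  have h0 := ch.rho0_pos u
  refine neg_lt_neg (mul_lt_mul_of_pos_left ?_ (by positivity))
  exact Real.sqrt_lt_sqrt (by linarith) (by linarith)

theorem tendsto_minusVar : Tendsto (ch.minusVar u) atBot atBot := by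
  have h0 := ch.rho0_pos u
  refine tendsto_neg_atTop_atBot.comp (Tendsto.const_mul_atTop (by positivity)
    (Real.tendsto_sqrt_atTop.comp ?_))
  exact tendsto_atTop_add_const_left _ _ tendsto_neg_atBot_atTop

theorem exists_minusVar_eq {x : ℝ} (hx : x < 0) : ∃ E < ch.threshold, ch.minusVar u E = x := by
  have h0 := ch.rho0_pos u
  have h1 : 0 < -x / (2 * ch.rho0 u) := div_pos (by linarith) (by positivity)
  refine ⟨ch.threshold - (-x / (2 * ch.rho0 u)) ^ 2, by nlinarith, ?_⟩
  rw [minusVar, sub_sub_cancel, Real.sqrt_sq h1.le]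
  field_simp

theorem rho_neg_one_of_le {E : ℝ} (h : E ≤ ch.threshold) :
    ch.rho u (-1) E = Complex.I * ((ch.minusVar u E / 2 : ℝ) : ℂ) := by
  rcases h.lt_or_eq with h | h
  · rw [rho_of_lt u ch _ h, minusVar]
    push_cast
    ring
  · subst h
    simp [rho_threshold, minusVar]

variable {ch}

theorem IsNeutral.shift_rho_neg_one (hn : ch.IsNeutral) {E : ℝ} (h : E ≤ ch.threshold)
    (hQ : (besselPoly ch.ℓ).eval (ch.minusVar u E) ≠ 0) :
    ch.shift u (ch.rho u (-1) E) = neutralLogDeriv ch.ℓ (ch.minusVar u E) := by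
  rw [shift, hn.coulomb_eq_zero, rho_neg_one_of_le u ch h, reducedLogDeriv_neutral _ hQ,
    Complex.ofReal_re]

theorem IsNeutral.isRegular_rho_neg_one (hn : ch.IsNeutral) {E : ℝ} (h : E ≤ ch.threshold)
    (hQ : (besselPoly ch.ℓ).eval (ch.minusVar u E) ≠ 0) :
    ch.IsRegular u (ch.rho u (-1) E) := by
  rw [rho_neg_one_of_le u ch h]
  rcases eq_or_ne (ch.minusVar u E) 0 with h0 | h0
  · left
    simp [h0]
  · right
    rw [hn.coulomb_eq_zero, Complex.ofReal_zero, zero_div]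
    exact (outgoingWave_zero_ne_zero_iff _ h0).2 hQ

/-- Far below the threshold, `S` is at most of the order of `√|E|`. -/
theorem tendsto_add_mul_neutralLogDeriv (ch : Channel) {w : ℝ} (hw : 0 ≤ w) :
    Tendsto (fun E => E + w * neutralLogDeriv ch.ℓ (ch.minusVar u E)) atBot atBot := by
  obtain ⟨c, hc⟩ := exists_neutralLogDeriv_le ch.ℓ
  have hlim : Tendsto (fun E : ℝ => E * (1 / 2) + (w * c + ch.threshold / 2 + (w * ch.rho0 u) ^ 2 / 2))
      atBot atBot :=
    tendsto_atBot_add_const_right _ _ (tendsto_id.atBot_mul_const (by norm_num))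
  refine tendsto_atBot_mono' _ ?_ hlim
  filter_upwards [(ch.tendsto_minusVar u).eventually hc, eventually_le_atBot ch.threshold]
    with E hE hET
  have h1 := mul_le_mul_of_nonneg_left hE hw
  have h2 := Real.sq_sqrt (sub_nonneg.2 hET)
  -- `w ρ₀ √(E_T - E) ≤ (E_T - E) / 2 + (w ρ₀)² / 2`
  have h3 := sq_nonneg (Real.sqrt (ch.threshold - E) - w * ch.rho0 u)
  unfold minusVar at h1 ⊢
  nlinarith

/-- In odd angular momentum, on the `-` sheet `L` is finite below some energy below the threshold,
near which it is unbounded from above. -/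
theorem IsNeutral.exists_shift_pole (hn : ch.IsNeutral) (hℓ : Odd ch.ℓ) :
    ∃ E₀ < ch.threshold, (∀ E < E₀, (besselPoly ch.ℓ).eval (ch.minusVar u E) ≠ 0) ∧
      Tendsto (fun E : ℝ => ch.shift u (ch.rho u (-1) E)) (𝓝[<] E₀) atTop := by
  obtain ⟨x₀, hx₀, hne, hlim⟩ := exists_tendsto_neutralLogDeriv_atTop hℓ
  obtain ⟨E₀, hE₀, he⟩ := ch.exists_minusVar_eq u hx₀
  have hlt : ∀ E < E₀, ch.minusVar u E < x₀ := fun E hE =>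
    he ▸ minusVar_strictMonoOn u ch (hE.le.trans hE₀.le : E ≤ ch.threshold) hE₀.le hE
  refine ⟨E₀, hE₀, fun E hE => hne _ (hlt E hE), ?_⟩
  have h1 : Tendsto (ch.minusVar u) (𝓝[<] E₀) (𝓝[<] x₀) := by
    refine tendsto_nhdsWithin_iff.2 ⟨?_, ?_⟩
    · have := (continuous_minusVar u ch).tendsto E₀
      rw [he] at this
      exact this.mono_left nhdsWithin_le_nhds
    · filter_upwards [self_mem_nhdsWithin] with E hE using hlt E hE
  refine (hlim.comp h1).congr' ?_
  filter_upwards [self_mem_nhdsWithin] with E hE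
  have hE : E < E₀ := hE
  exact (hn.shift_rho_neg_one u (hE.le.trans hE₀.le) (hne _ (hlt E hE))).symm

end Channel

namespace Parameters

open Module

variable {NL NC : ℕ} (u : Constants) (P : Parameters NL NC)

/-! ### The physical sheet -/

theorem isRegular_rho_one (E : ℝ) (c : Fin NC) :
    (P.channel c).IsRegular u (P.rho u 1 E c) := (P.channel c).isRegular_rho_one u E

theorem multiplicity_rho_one (E : ℝ) : P.multiplicity u ((E : ℂ), P.rho u 1 E) =
    finrank ℂ (End.eigenspace (P.bruneOp u (P.rho u 1 E)) (E : ℂ)) := by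
  rw [multiplicity_eq_finrank u P (P.sheet_subset_surface u 1 rfl) (P.isRegular_rho_one u E),
    finrank_solutionSpace]

theorem poleCount_physicalSheet : P.poleCount u (P.sheet u 1) = NL := by
  have h := encard_eigenvalue_crossings (T := fun E : ℝ => P.bruneOp u (P.rho u 1 E))
    (fun E => P.isSymmetric_bruneOp u _) (finrank_euclideanSpace_fin (𝕜 := ℂ) (n := NL))
    (fun E₁ E₂ hE x => by
      rw [re_inner_bruneOp, re_inner_bruneOp]
      gcongr with c
      exact (P.channel c).monotone_shift_rho_one u hE)
    (fun E₀ ε hε => P.continuousAt_re_inner_bruneOp u (ρ := fun E : ℝ => P.rho u 1 E)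
      (fun c => ((P.channel c).continuous_shift_rho_one u).continuousAt) hε)
  have hinj : Function.Injective
      (fun q : ℝ × ℕ => ((((q.1 : ℝ) : ℂ), P.rho u 1 (q.1 : ℂ)), q.2)) := by
    rintro ⟨E, j⟩ ⟨E', j'⟩ he
    simp only [Prod.mk.injEq, Complex.ofReal_inj] at he
    exact Prod.ext he.1.1 he.2
  rw [← h, ← hinj.encard_image, poleCount]
  congr 1
  ext ⟨⟨E, ρ⟩, j⟩
  constructor
  · rintro ⟨hρ, hj⟩
    have hρ : ρ = P.rho u 1 E := hρ
    subst hρ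
    have hpole := (multiplicity_pos_iff u P).1 (Nat.zero_lt_of_lt hj)
    have hE : ((E.re : ℝ) : ℂ) = E := Complex.ext rfl (hpole.im_eq_zero u P).symm
    rw [← hE] at hj
    refine ⟨(E.re, j), ?_, by simp only [hE]⟩
    have hj : j < P.multiplicity u ((E.re : ℂ), P.rho u 1 E.re) := hj
    rw [multiplicity_rho_one] at hj
    exact hj
  · rintro ⟨⟨E', j'⟩, hj, he⟩
    simp only [Prod.mk.injEq] at he
    obtain ⟨⟨rfl, rfl⟩, rfl⟩ := he
    refine ⟨rfl, ?_⟩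
    have hj : j' < finrank ℂ (End.eigenspace (P.bruneOp u (P.rho u 1 E')) (E' : ℂ)) := hj
    rw [← multiplicity_rho_one] at hj
    exact hj

/-- Away from the shadow poles, only channels above their thresholds can be on the `-` sheet, where
the shift function has the same value on both sheets. -/
theorem multiplicity_eq_of_not_isShadowPole {p : ℂ × (Fin NC → ℂ)} (hp : P.IsBranchPole u p)
    (hs : ¬ P.IsShadowPole u p) : P.IsBranchPole u (p.1, P.rho u 1 p.1) ∧
      P.multiplicity u p = P.multiplicity u (p.1, P.rho u 1 p.1) := by
  suffices h : P.multiplicity u p = P.multiplicity u (p.1, P.rho u 1 p.1) from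
    ⟨(multiplicity_pos_iff u P).1 (h ▸ (multiplicity_pos_iff u P).2 hp), h⟩
  obtain ⟨σ, hσ⟩ := P.exists_mem_sheet u hp.1
  obtain ⟨E, ρ⟩ := p
  have hρ : ρ = P.rho u σ E := hσ
  subst hρ
  obtain ⟨E, rfl⟩ : ∃ r : ℝ, E = r :=
    ⟨E.re, Complex.ext rfl (by simpa using hp.im_eq_zero u P)⟩
  have hshift : ∀ c, (P.channel c).shift u (P.rho u σ E c) =
      (P.channel c).shift u (P.rho u 1 E c) := by
    intro c
    rcases lt_or_ge E (P.channel c).threshold with h | h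
    · rcases Int.units_eq_one_or (σ c) with h1 | h1
      · simp only [rho, h1, Pi.one_apply]
      · exact absurd ⟨hp, E, rfl, c, h, by simp only [rho, h1]⟩ hs
    · exact (P.channel c).shift_rho_of_le u (σ c) h
  rw [multiplicity_eq_finrank u P hp.1 hp.2.1, multiplicity_eq_finrank u P
    (P.sheet_subset_surface u 1 rfl) (P.isRegular_rho_one u E)]
  have hB : P.bruneMatrix u (P.rho u σ E) = P.bruneMatrix u (P.rho u 1 E) := by
    ext i j
    simp only [bruneMatrix_apply, hshift]
  unfold solutionSpace
  dsimp only
  rw [hB]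

end Parameters

namespace Parameters

open Module

variable {NL NC : ℕ} (u : Constants) (P : Parameters NL NC)

/-! ### The shadow poles of odd neutral channels -/

theorem rho_update_self (c : Fin NC) (E : ℂ) :
    P.rho u (Function.update 1 c (-1)) E c = (P.channel c).rho u (-1) E := by
  simp [rho]

theorem rho_update_of_ne {c c' : Fin NC} (h : c' ≠ c) (E : ℂ) :
    P.rho u (Function.update 1 c (-1)) E c' = (P.channel c').rho u 1 E := by
  simp [rho, Function.update_of_ne h]

/-- A lower bound for the eigenvalues of Brune's matrix, in terms of the positive parts of
`S - B`. -/
theorem exists_le_re_inner_bruneOp : ∃ m W : ℝ, 0 ≤ W ∧ ∀ (ρ : Fin NC → ℂ) x,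
    (m - ∑ c, W * max ((P.channel c).shift u (ρ c) - P.boundary c) 0) * ‖x‖ ^ 2 ≤
      (inner ℂ (P.bruneOp u ρ x) x).re := by
  obtain ⟨W, hW0, hW⟩ := P.exists_channelComponent_le
  refine ⟨-∑ l, |P.energy l|, W, hW0, fun ρ x => ?_⟩
  rw [re_inner_bruneOp, sub_mul, Finset.sum_mul]
  refine sub_le_sub ?_ (Finset.sum_le_sum fun c _ => ?_)
  · rw [EuclideanSpace.norm_sq_eq, neg_mul, Finset.mul_sum, ← Finset.sum_neg_distrib]
    refine Finset.sum_le_sum fun l _ => ?_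
    have h1 : |P.energy l| ≤ ∑ l, |P.energy l| :=
      Finset.single_le_sum (f := fun l => |P.energy l|) (fun _ _ => abs_nonneg _)
        (Finset.mem_univ l)
    rw [← neg_mul]
    refine mul_le_mul_of_nonneg_right ?_ (sq_nonneg _)
    linarith [neg_abs_le (P.energy l)]
  · calc _ ≤ max ((P.channel c).shift u (ρ c) - P.boundary c) 0 * ‖P.channelComponent c x‖ ^ 2 :=
          mul_le_mul_of_nonneg_right (le_max_left _ _) (sq_nonneg _)
      _ ≤ max ((P.channel c).shift u (ρ c) - P.boundary c) 0 * (W * ‖x‖ ^ 2) :=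
          mul_le_mul_of_nonneg_left (hW c x) (le_max_right _ _)
      _ = _ := by ring

theorem re_inner_bruneOp_single (ρ : Fin NC → ℂ) (l : Fin NL) :
    (inner ℂ (P.bruneOp u ρ (EuclideanSpace.single l 1)) (EuclideanSpace.single l 1)).re =
      P.energy l - ∑ c, ((P.channel c).shift u (ρ c) - P.boundary c) * P.width l c ^ 2 := by
  have h : ∀ c, P.channelComponent c (EuclideanSpace.single l 1) = P.width l c := by
    intro c
    simp [channelComponent]
  rw [re_inner_bruneOp]
  simp only [h, Complex.norm_real, Real.norm_eq_abs, sq_abs]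
  congr 1
  rw [Finset.sum_eq_single l]
  · simp
  · intro j _ hj
    simp [hj]
  · simp

/-- With an odd neutral channel on its `-` sheet, the lowest eigenvalue of Brune's matrix is above
the diagonal far below the threshold, and below the diagonal near the energy where `S` is infinite;
it crosses the diagonal in between. -/
theorem exists_isShadowPole {c : Fin NC} (hc : c ∈ P.oddNeutralChannels) :
    ∃ E : ℝ, E < (P.channel c).threshold ∧
      P.IsShadowPole u ((E : ℂ), P.rho u (Function.update 1 c (-1)) (E : ℂ)) := by
  obtain ⟨hneu, hodd, l, hl⟩ := hc
  obtain ⟨E₀, hE₀, hne, hpole⟩ := hneu.exists_shift_pole u hodd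
  set σ : Fin NC → ℤˣ := Function.update 1 c (-1) with hσ
  set S : Fin NC → ℝ → ℝ := fun c' E => (P.channel c').shift u (P.rho u σ E c') with hS
  have hSne : ∀ c' ≠ c, S c' = fun E : ℝ => (P.channel c').shift u ((P.channel c').rho u 1 E) := by
    intro c' h
    ext E
    simp only [hS, hσ, rho_update_of_ne u P h]
  have hSc : ∀ E < E₀, S c E = neutralLogDeriv (P.channel c).ℓ ((P.channel c).minusVar u E) := by
    intro E hE
    simp only [hS, hσ, rho_update_self]
    exact hneu.shift_rho_neg_one u (hE.le.trans hE₀.le) (hne E hE)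
  have hScont : ∀ c', ∀ E < E₀, ContinuousAt (S c') E := by
    intro c' E hE
    rcases eq_or_ne c' c with rfl | h
    · refine ((continuousAt_neutralLogDeriv _ (hne E hE)).comp
        ((P.channel c').continuous_minusVar u).continuousAt).congr ?_
      filter_upwards [Iio_mem_nhds hE] with E' hE' using (hSc E' hE').symm
    · rw [hSne c' h]
      exact ((P.channel c').continuous_shift_rho_one u).continuousAt
  have hpos : 0 < NL := l.pos
  set k : Fin NL := ⟨NL - 1, by omega⟩ with hk
  have hkmax : ∀ i, i ≤ k := fun i => Fin.le_def.2 (by have := i.2; simp only [hk]; omega)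
  set lam : ℝ → ℝ := fun E => (P.isSymmetric_bruneOp u (P.rho u σ E)).eigenvalues
    (finrank_euclideanSpace_fin (𝕜 := ℂ) (n := NL)) k with hlam
  have hlamc : ∀ E < E₀, ContinuousAt lam E := fun E hE =>
    continuousAt_eigenvalues (T := fun E : ℝ => P.bruneOp u (P.rho u σ E))
      (fun E => P.isSymmetric_bruneOp u _) _
      (fun ε hε => P.continuousAt_re_inner_bruneOp u (ρ := fun E : ℝ => P.rho u σ E)
        (fun c' => hScont c' E hE) hε) k
  -- The channels on their `+` sheets have bounded positive parts of `S - B` below `E₀`, and the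
  -- one on its `-` sheet contributes `O(√|E|)`.
  have hfar : ∀ᶠ E in atBot, E < lam E := by
    obtain ⟨m, W, hW, hq⟩ := P.exists_le_re_inner_bruneOp u
    set b : ℝ := m - ∑ c' ∈ Finset.univ.erase c, W * max (S c' E₀ - P.boundary c') 0 with hb
    filter_upwards [((P.channel c).tendsto_add_mul_neutralLogDeriv u hW).eventually
      (eventually_lt_atBot (b + W * P.boundary c)), eventually_lt_atBot b, eventually_lt_atBot E₀]
      with E h1 h2 h3
    rw [← hSc E h3] at h1
    have hle := le_eigenvalues (P.isSymmetric_bruneOp u (P.rho u σ E))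
      (finrank_euclideanSpace_fin (𝕜 := ℂ) (n := NL)) (hq (P.rho u σ E)) k
    refine lt_of_lt_of_le ?_ hle
    have hsum : ∑ c' ∈ Finset.univ.erase c, W * max (S c' E - P.boundary c') 0 ≤
        ∑ c' ∈ Finset.univ.erase c, W * max (S c' E₀ - P.boundary c') 0 := by
      refine Finset.sum_le_sum fun c' h => mul_le_mul_of_nonneg_left ?_ hW
      rw [hSne c' (Finset.ne_of_mem_erase h)]
      exact max_le_max (sub_le_sub_right ((P.channel c').monotone_shift_rho_one u h3.le) _) le_rfl
    have hsplit := Finset.add_sum_erase Finset.univ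
      (fun c' => W * max (S c' E - P.boundary c') 0) (Finset.mem_univ c)
    have hmax : E + W * max (S c E - P.boundary c) 0 < b := by
      rcases max_cases (S c E - P.boundary c) 0 with ⟨h, -⟩ | ⟨h, -⟩ <;> rw [h] <;> linarith
    simp only [hS] at hsplit hsum hmax hb
    linarith
  -- The diagonal entry of a level coupled to the channel `c` tends to `-∞`.
  have hnear : ∀ᶠ E in 𝓝[<] E₀, lam E < E := by
    have hlim : Tendsto (fun E => E + ∑ c', (S c' E - P.boundary c') * P.width l c' ^ 2)
        (𝓝[<] E₀) atTop := by
      have hcpole : Tendsto (fun E => (S c E - P.boundary c) * P.width l c ^ 2) (𝓝[<] E₀) atTop := by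
        refine Tendsto.atTop_mul_const (by positivity) (tendsto_atTop_add_const_right _ _ ?_)
        simpa only [hS, hσ, rho_update_self] using hpole
      have hrest : Tendsto (fun E => E + ∑ c' ∈ Finset.univ.erase c,
          (S c' E - P.boundary c') * P.width l c' ^ 2) (𝓝[<] E₀)
          (𝓝 (E₀ + ∑ c' ∈ Finset.univ.erase c, (S c' E₀ - P.boundary c') * P.width l c' ^ 2)) := by
        refine Tendsto.mono_left (Tendsto.add tendsto_id (tendsto_finsetSum _ fun c' h => ?_))
          nhdsWithin_le_nhds
        rw [hSne c' (Finset.ne_of_mem_erase h)]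
        exact (((P.channel c').continuous_shift_rho_one u).tendsto E₀ |>.sub_const _).mul_const _
      refine (hcpole.atTop_add hrest).congr fun E => ?_
      rw [← Finset.add_sum_erase Finset.univ
        (fun c' => (S c' E - P.boundary c') * P.width l c' ^ 2) (Finset.mem_univ c)]
      ring
    filter_upwards [hlim.eventually (eventually_gt_atTop (P.energy l))] with E hE
    have h1 := eigenvalues_mul_norm_sq_le_re_inner (P.isSymmetric_bruneOp u (P.rho u σ E))
      (finrank_euclideanSpace_fin (𝕜 := ℂ) (n := NL)) hkmax (EuclideanSpace.single l 1)
    rw [re_inner_bruneOp_single] at h1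
    simp only [PiLp.norm_single, norm_one, one_pow, mul_one] at h1
    simp only [hS] at hE
    simp only [hlam]
    linarith
  obtain ⟨E₂, hE₂, hE₂lt⟩ := (hnear.and self_mem_nhdsWithin).exists
  have hE₂lt : E₂ < E₀ := hE₂lt
  obtain ⟨E₁, hE₁, hE₁lt⟩ := (hfar.and (eventually_lt_atBot E₂)).exists
  obtain ⟨E, hE, hEz⟩ := intermediate_value_Icc' (f := fun E => lam E - E) hE₁lt.le
    (fun E hE => ((hlamc E (hE.2.trans_lt hE₂lt)).sub continuousAt_id).continuousWithinAt)
    (show (0 : ℝ) ∈ Set.Icc _ _ from ⟨by linarith, by linarith⟩)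
  have hEE₀ : E < E₀ := hE.2.trans_lt hE₂lt
  have hlamE : lam E = E := sub_eq_zero.1 hEz
  refine ⟨E, hEE₀.trans hE₀, ?_, E, rfl, c, hEE₀.trans hE₀, rho_update_self u P c E⟩
  refine (isBranchPole_iff u P).2 ⟨P.sheet_subset_surface u σ rfl, fun c' => ?_, ?_⟩
  · rcases eq_or_ne c' c with rfl | h
    · simp only [hσ, rho_update_self]
      exact hneu.isRegular_rho_neg_one u (hEE₀.trans hE₀).le (hne E hEE₀)
    · simp only [hσ, rho_update_of_ne u P h]
      exact (P.channel c').isRegular_rho_one u E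
  · rw [finrank_solutionSpace, finrank_pos_iff, Submodule.nontrivial_iff_ne_bot]
    have h := (P.isSymmetric_bruneOp u (P.rho u σ E)).hasEigenvalue_eigenvalues
      (finrank_euclideanSpace_fin (𝕜 := ℂ) (n := NL)) k
    rw [show (P.isSymmetric_bruneOp u (P.rho u σ E)).eigenvalues
      (finrank_euclideanSpace_fin (𝕜 := ℂ) (n := NL)) k = E from hlamE] at h
    exact Module.End.hasEigenvalue_iff.1 h

/-! ### Change of boundary parameter -/

theorem exists_isBoundaryChange (B' : Fin NC → ℝ) :
    ∃ P' : Parameters NL NC, P'.boundary = B' ∧ P.IsBoundaryChange P' := by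
  set M : Matrix (Fin NL) (Fin NL) ℝ := Matrix.diagonal P.energy -
    P.width * Matrix.diagonal (fun c => B' c - P.boundary c) * P.width.transpose with hM
  have hMsymm : M.IsHermitian := by
    rw [Matrix.IsHermitian, Matrix.conjTranspose_eq_transpose_of_trivial, hM,
      Matrix.transpose_sub, Matrix.diagonal_transpose, Matrix.transpose_mul, Matrix.transpose_mul,
      Matrix.transpose_transpose, Matrix.diagonal_transpose, Matrix.mul_assoc]
  set U : Matrix (Fin NL) (Fin NL) ℝ := hMsymm.eigenvectorUnitary.1 with hU
  have hU1 : U.transpose * U = 1 := by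
    have h := Matrix.UnitaryGroup.star_mul_self hMsymm.eigenvectorUnitary
    rwa [Matrix.star_eq_conjTranspose, Matrix.conjTranspose_eq_transpose_of_trivial] at h
  have hMd : M = U * Matrix.diagonal hMsymm.eigenvalues * U.transpose := by
    have h := hMsymm.spectral_theorem
    rw [Unitary.conjStarAlgAut_apply] at h
    rw [← Matrix.conjTranspose_eq_transpose_of_trivial U]
    exact h
  refine ⟨⟨P.channel, hMsymm.eigenvalues, U.transpose * P.width, B'⟩, rfl, rfl, U.transpose, ?_, ?_,
    rfl⟩
  · rw [Matrix.transpose_transpose, hU1]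
  · rw [Matrix.transpose_transpose]
    exact hMd

variable {P}

/-- At every point of the surface, a change of boundary parameter conjugates Brune's matrix by an
orthogonal matrix. -/
theorem IsBoundaryChange.exists_bruneMatrix_eq {P' : Parameters NL NC} (h : P.IsBoundaryChange P') :
    ∃ K : Matrix (Fin NL) (Fin NL) ℝ, K * K.transpose = 1 ∧
      ∀ ρ, P'.bruneMatrix u ρ = K * P.bruneMatrix u ρ * K.transpose := by
  obtain ⟨hch, K, hK, he, hw⟩ := h
  refine ⟨K, hK, fun ρ => ?_⟩
  have he' : Matrix.diagonal P'.energy = K * (Matrix.diagonal P.energy -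
      P.width * Matrix.diagonal (fun c => P'.boundary c - P.boundary c) * P.width.transpose) *
        K.transpose := by
    rw [he]
    simp only [← Matrix.mul_assoc, hK, Matrix.one_mul]
    rw [Matrix.mul_assoc, hK, Matrix.mul_one]
  have hd : Matrix.diagonal (fun c => (P.channel c).shift u (ρ c) - P.boundary c) =
      Matrix.diagonal (fun c => P'.boundary c - P.boundary c) +
        Matrix.diagonal (fun c => (P.channel c).shift u (ρ c) - P'.boundary c) := by
    rw [Matrix.diagonal_add]
    congr 1
    ext c
    ring
  unfold bruneMatrix
  rw [he', hd, hw, hch, Matrix.transpose_mul]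
  simp only [Matrix.mul_add, Matrix.add_mul, Matrix.mul_sub, Matrix.sub_mul, Matrix.mul_assoc]
  abel

theorem finrank_eigenspace_conj {K A : Matrix (Fin NL) (Fin NL) ℝ} (hK : K * K.transpose = 1)
    (μ : ℂ) :
    finrank ℂ (End.eigenspace
      (Matrix.toLin' ((K * A * K.transpose).map (fun x : ℝ => (x : ℂ)))) μ) =
      finrank ℂ (End.eigenspace (Matrix.toLin' (A.map (fun x : ℝ => (x : ℂ)))) μ) := by
  have hmul : ∀ X Y : Matrix (Fin NL) (Fin NL) ℝ, (X * Y).map (fun x : ℝ => (x : ℂ)) =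
      X.map (fun x : ℝ => (x : ℂ)) * Y.map (fun x : ℝ => (x : ℂ)) :=
    fun X Y => Matrix.map_mul (f := Complex.ofRealHom)
  have hone : (1 : Matrix (Fin NL) (Fin NL) ℝ).map (fun x : ℝ => (x : ℂ)) = 1 :=
    Matrix.map_one _ Complex.ofReal_zero Complex.ofReal_one
  have h1 : K.map (fun x : ℝ => (x : ℂ)) * K.transpose.map (fun x : ℝ => (x : ℂ)) = 1 := by
    rw [← hmul, hK, hone]
  have h2 : K.transpose.map (fun x : ℝ => (x : ℂ)) * K.map (fun x : ℝ => (x : ℂ)) = 1 := by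
    rw [← hmul, mul_eq_one_comm.1 hK, hone]
  rw [hmul, hmul]
  generalize K.map (fun x : ℝ => (x : ℂ)) = X at h1 h2
  generalize K.transpose.map (fun x : ℝ => (x : ℂ)) = Y at h1 h2
  generalize A.map (fun x : ℝ => (x : ℂ)) = C
  refine (LinearEquiv.finrank_eq (LinearEquiv.ofSubmodules (Matrix.toLin'OfInv h2 h1) _ _ ?_)).symm
  ext a
  simp only [Submodule.mem_map, End.mem_eigenspace_iff, Matrix.toLin'_mul]
  constructor
  · rintro ⟨x, hx, rfl⟩
    have e : Matrix.toLin' Y (Matrix.toLin' X x) = x := by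
      rw [← Matrix.toLin'_mul_apply, h2, Matrix.toLin'_one, LinearMap.id_apply]
    change Matrix.toLin' X (Matrix.toLin' C (Matrix.toLin' Y (Matrix.toLin' X x))) =
      μ • Matrix.toLin' X x
    rw [e, hx, map_smul]
  · intro h
    have e : ∀ x, Matrix.toLin' Y (Matrix.toLin' X x) = x := fun x => by
      rw [← Matrix.toLin'_mul_apply, h2, Matrix.toLin'_one, LinearMap.id_apply]
    refine ⟨Matrix.toLin' Y a, ?_, ?_⟩
    · have := congrArg (Matrix.toLin' Y) h
      simp only [LinearMap.comp_apply, e, map_smul] at this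
      exact this
    · change Matrix.toLin' X (Matrix.toLin' Y a) = a
      rw [← Matrix.toLin'_mul_apply, h1, Matrix.toLin'_one, LinearMap.id_apply]

theorem IsBoundaryChange.finrank_solutionSpace {P' : Parameters NL NC} (h : P.IsBoundaryChange P')
    (p : ℂ × (Fin NC → ℂ)) :
    finrank ℂ (P'.solutionSpace u p) = finrank ℂ (P.solutionSpace u p) := by
  obtain ⟨K, hK, hb⟩ := h.exists_bruneMatrix_eq u
  unfold solutionSpace
  rw [hb, finrank_eigenspace_conj hK]

theorem IsBoundaryChange.isBranchPole_iff {P' : Parameters NL NC} (h : P.IsBoundaryChange P')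
    (p : ℂ × (Fin NC → ℂ)) : P'.IsBranchPole u p ↔ P.IsBranchPole u p := by
  rw [Parameters.isBranchPole_iff, Parameters.isBranchPole_iff, h.finrank_solutionSpace u p]
  unfold surface
  rw [h.1]

theorem IsBoundaryChange.multiplicity_eq {P' : Parameters NL NC} (h : P.IsBoundaryChange P')
    (p : ℂ × (Fin NC → ℂ)) : P'.multiplicity u p = P.multiplicity u p := by
  have hb := h.isBranchPole_iff u p
  unfold multiplicity
  by_cases hp : P.IsBranchPole u p
  · rw [if_pos hp, if_pos (hb.2 hp), h.finrank_solutionSpace u p]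
  · rw [if_neg hp, if_neg (mt hb.1 hp)]

theorem IsBoundaryChange.isShadowPole_iff {P' : Parameters NL NC} (h : P.IsBoundaryChange P')
    (p : ℂ × (Fin NC → ℂ)) : P'.IsShadowPole u p ↔ P.IsShadowPole u p := by
  unfold IsShadowPole
  rw [h.isBranchPole_iff u p, h.1]

end Parameters

namespace Parameters

open Module

variable {NL NC : ℕ} (u : Constants) (P : Parameters NL NC)

/-! ### Counting the poles on all sheets -/


/-- The shadow poles of the odd neutral channels are distinct from each other and from the poles of
the physical sheet, because below its threshold a channel has different wavenumbers on its two
sheets. -/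
theorem add_encard_oddNeutralChannels_le :
    (NL : ℕ∞) + P.oddNeutralChannels.encard ≤ P.poleCount u (P.surface u) := by
  choose! E hE hpole using fun c (hc : c ∈ P.oddNeutralChannels) => P.exists_isShadowPole u hc
  have hrho : ∀ c ∈ P.oddNeutralChannels,
      (P.channel c).rho u (-1) (E c) ≠ (P.channel c).rho u 1 (E c) := by
    intro c hc h
    have hκ : (P.channel c).rho0 u * Real.sqrt ((P.channel c).threshold - E c) ≠ 0 :=
      mul_ne_zero ((P.channel c).rho0_pos u).ne' (Real.sqrt_pos.2 (by linarith [hE c hc])).ne'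
    have h0 : (P.channel c).rho u 1 (E c) = 0 := by
      rw [Channel.rho_neg_one] at h
      exact self_eq_neg.1 h.symm
    rw [Channel.rho_of_lt u _ 1 (hE c hc), Units.val_one, Int.cast_one, one_mul] at h0
    rcases mul_eq_zero.1 h0 with h0 | h0
    · exact Complex.I_ne_zero h0
    · exact hκ (by exact_mod_cast h0)
  set pt : Fin NC → (ℂ × (Fin NC → ℂ)) × ℕ := fun c =>
    (((E c : ℂ), P.rho u (Function.update 1 c (-1)) (E c)), 0) with hpt
  have hinj : Set.InjOn pt P.oddNeutralChannels := by
    intro c hc c' _ h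
    by_contra hne
    simp only [hpt, Prod.mk.injEq, and_true, Complex.ofReal_inj] at h
    have h2 := congrFun h.2 c
    rw [rho_update_self, rho_update_of_ne u P hne, ← h.1] at h2
    exact hrho c hc h2
  have hdisj : Disjoint {x : (ℂ × (Fin NC → ℂ)) × ℕ | x.1 ∈ P.sheet u 1 ∧
      x.2 < P.multiplicity u x.1} (pt '' P.oddNeutralChannels) := by
    rw [Set.disjoint_left]
    rintro _ hx ⟨c, hc, rfl⟩
    have h : P.rho u (Function.update 1 c (-1)) (E c) = P.rho u 1 (E c) := hx.1
    have h2 := congrFun h c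
    rw [rho_update_self] at h2
    exact hrho c hc h2
  rw [← P.poleCount_physicalSheet u, ← hinj.encard_image]
  unfold poleCount
  rw [← Set.encard_union_eq hdisj]
  refine Set.encard_le_encard (Set.union_subset (fun x hx =>
    ⟨P.sheet_subset_surface u 1 hx.1, hx.2⟩) ?_)
  rintro _ ⟨c, hc, rfl⟩
  exact ⟨(hpole c hc).1.1, (multiplicity_pos_iff u P).2 (hpole c hc).1⟩

/-! ### One level and one even neutral channel -/

theorem isShadowPole_single_iff {ch : Channel} {e γ B : ℝ} {E : ℝ} (hE : E < ch.threshold)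
    (hreg : ch.IsRegular u (ch.rho u (-1) E)) :
    (single ch e γ B).IsShadowPole u ((E : ℂ), fun _ => ch.rho u (-1) E) ↔
      e = E + γ ^ 2 * (ch.shift u (ch.rho u (-1) E) - B) := by
  have hb : (single ch e γ B).bruneMatrix u (fun _ => ch.rho u (-1) E) 0 0 =
      e - γ * (ch.shift u (ch.rho u (-1) E) - B) * γ := by
    rw [bruneMatrix_apply]
    simp [single]
  have hmem : ∀ a, a ∈ (single ch e γ B).solutionSpace u ((E : ℂ), fun _ => ch.rho u (-1) E) ↔
      ((e - γ * (ch.shift u (ch.rho u (-1) E) - B) * γ : ℝ) : ℂ) * a 0 = E * a 0 := by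
    intro a
    rw [solutionSpace, End.mem_eigenspace_iff, funext_iff, Fin.forall_fin_one,
      Matrix.toLin'_apply, Matrix.mulVec, dotProduct, Fin.sum_univ_one, Matrix.map_apply, hb,
      Pi.smul_apply, smul_eq_mul]
  constructor
  · rintro ⟨⟨-, -, a, ha, ha0⟩, -⟩
    have h0 : a 0 ≠ 0 := fun h => ha0 (funext fun i => by rw [Fin.eq_zero i, h]; rfl)
    have := Complex.ofReal_injective (mul_right_cancel₀ h0 ((hmem a).1 ha))
    linarith
  · intro h
    refine ⟨⟨fun _ => ch.rho_sq u (-1) E, fun _ => hreg, fun _ => 1, (hmem _).2 ?_, ?_⟩,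
      E, rfl, 0, hE, rfl⟩
    · rw [h]
      congr 2
      ring
    · intro h
      exact one_ne_zero (congrFun h 0)

/-- In even angular momentum `E + γ² (S(E) - B)` is bounded from above on the `-` sheet, so that
there is a shadow pole if the resonance energy is in its range, and there is none if the resonance
energy is large. -/
theorem exists_isShadowPole_single {ch : Channel} (hn : ch.IsNeutral) (hℓ : Even ch.ℓ) (γ B : ℝ) :
    (∃ e : ℝ, ∃ p, (single ch e γ B).IsShadowPole u p) ∧
      ∃ e : ℝ, ∀ p, ¬ (single ch e γ B).IsShadowPole u p := by
  have hQ : ∀ x, (besselPoly ch.ℓ).eval x ≠ 0 := fun x => (eval_besselPoly_pos_of_even hℓ x).ne'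
  have hreg : ∀ E < ch.threshold, ch.IsRegular u (ch.rho u (-1) (E : ℝ)) := fun E hE =>
    hn.isRegular_rho_neg_one u hE.le (hQ _)
  have hiff := fun (e E : ℝ) (hE : E < ch.threshold) =>
    isShadowPole_single_iff u (e := e) (γ := γ) (B := B) hE (hreg E hE)
  refine ⟨⟨_, _, (hiff _ (ch.threshold - 1) (by linarith)).2 rfl⟩, ?_⟩
  set f : ℝ → ℝ := fun E => E + γ ^ 2 * neutralLogDeriv ch.ℓ (ch.minusVar u E) with hf
  have hfc : Continuous f := by
    have : Continuous (neutralLogDeriv ch.ℓ) :=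
      continuous_iff_continuousAt.2 fun x => continuousAt_neutralLogDeriv _ (hQ x)
    exact continuous_id.add (continuous_const.mul (this.comp (ch.continuous_minusVar u)))
  obtain ⟨E₁, hE₁⟩ := eventually_atBot.1
    ((ch.tendsto_add_mul_neutralLogDeriv u (sq_nonneg γ)).eventually (eventually_le_atBot 0))
  obtain ⟨b, hb⟩ := (isCompact_Icc (a := E₁) (b := ch.threshold)).bddAbove_image hfc.continuousOn
  have hbound : ∀ E < ch.threshold, f E ≤ max b 0 := by
    intro E hE
    rcases le_or_gt E E₁ with h | h
    · exact (hE₁ E h).trans (le_max_right _ _)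
    · exact (hb (Set.mem_image_of_mem f ⟨h.le, hE.le⟩)).trans (le_max_left _ _)
  refine ⟨max b 0 + 1 - γ ^ 2 * B, ?_⟩
  rintro ⟨_, ρ⟩ ⟨hp, E, rfl, c, hE, hρ⟩
  have hE : E < ch.threshold := hE
  have hρ' : ρ = fun _ => ch.rho u (-1) E := funext fun i => by
    rw [Subsingleton.elim i c]
    exact hρ
  subst hρ'
  have h := (hiff _ E hE).1 ⟨hp, E, rfl, c, hE, hρ⟩
  rw [hn.shift_rho_neg_one u hE.le (hQ _)] at h
  have := hbound E hE
  simp only [hf] at this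
  linarith

end Parameters

end RMatrix

theorem theorem2 (u : RMatrix.Constants) :
    (∀ (NL NC : ℕ) (P : RMatrix.Parameters NL NC),
      -- all poles are real, and they lie on the `2 ^ NC` sheets
      ((∀ p, P.IsBranchPole u p → p.1.im = 0 ∧ ∃ σ : Fin NC → ℤˣ, p ∈ P.sheet u σ) ∧
        Fintype.card (Fin NC → ℤˣ) = 2 ^ NC) ∧
      -- exactly `NL` poles on the physical sheet
      P.poleCount u (P.sheet u 1) = NL ∧
      -- the other poles are shadow poles, below a threshold, on a `-` sheet: a pole that is not
      -- of this kind is a pole of the physical sheet, with the same multiplicity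
      (∀ p, P.IsBranchPole u p → ¬ P.IsShadowPole u p →
        P.IsBranchPole u (p.1, P.rho u 1 p.1) ∧
          P.multiplicity u p = P.multiplicity u (p.1, P.rho u 1 p.1)) ∧
      -- invariance under change of boundary parameters
      (∀ B' : Fin NC → ℝ, ∃ P' : RMatrix.Parameters NL NC,
        P'.boundary = B' ∧ P.IsBoundaryChange P') ∧
      (∀ P' : RMatrix.Parameters NL NC, P.IsBoundaryChange P' → ∀ p,
        P'.multiplicity u p = P.multiplicity u p ∧
          (P'.IsShadowPole u p ↔ P.IsShadowPole u p)) ∧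
      -- each odd neutral channel adds a shadow pole below its threshold on its `-` sheet
      (∀ c ∈ P.oddNeutralChannels, ∃ E : ℝ, E < (P.channel c).threshold ∧
        P.IsShadowPole u ((E : ℂ), P.rho u (Function.update 1 c (-1)) (E : ℂ))) ∧
      -- total number of poles on all sheets
      (NL : ℕ∞) ≤ P.poleCount u (P.surface u) ∧
      (NL : ℕ∞) + P.oddNeutralChannels.encard ≤ P.poleCount u (P.surface u)) ∧
    -- the existence of further shadow poles depends on the values of the parameters
    (∀ ch : RMatrix.Channel, ch.IsNeutral → Even ch.ℓ → ∀ γ B : ℝ, γ ≠ 0 →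
      (∃ E₁ : ℝ, ∃ p, (RMatrix.Parameters.single ch E₁ γ B).IsShadowPole u p) ∧
      (∃ E₂ : ℝ, ∀ p, ¬ (RMatrix.Parameters.single ch E₂ γ B).IsShadowPole u p)) := by
  refine ⟨fun NL NC P => ⟨⟨fun p hp => ⟨hp.im_eq_zero u P, P.exists_mem_sheet u hp.1⟩, ?_⟩,
    P.poleCount_physicalSheet u, fun p => P.multiplicity_eq_of_not_isShadowPole u,
    P.exists_isBoundaryChange, fun P' h p => ⟨h.multiplicity_eq u p, h.isShadowPole_iff u p⟩,
    fun c hc => P.exists_isShadowPole u hc, ?_, P.add_encard_oddNeutralChannels_le u⟩,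
    fun ch hn hℓ γ B _ => RMatrix.Parameters.exists_isShadowPole_single u hn hℓ γ B⟩
  · rw [Fintype.card_fun, Fintype.card_fin, Fintype.card_units_int]
  · exact le_self_add.trans (P.add_encard_oddNeutralChannels_le u)
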